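/- Let $\mathcal L\in\{\mathcal{EL},\mathcal{EL}_\bot,\mathcal{ELI},\mathcal{ELI}_\bot\}$. Concepts are built by $C,D::=\top\mid\bot\mid A\mid C\sqcap D\mid\exists r.C$ with $A$ a concept name and $r$ a role name or an inverse role; inverse roles are allowed only for $\mathcal{ELI},\mathcal{ELI}_\bot$, and $\bot$ only for $\mathcal{EL}_\bot,\mathcal{ELI}_\bot$. An $\mathcal L$-ontology is a finite set of inclusions $C\sqsubseteq D$ between $\mathcal L$-concepts. An ABox is a finite nonempty set of assertions $A(a)$, $r(a,b)$; $\mathsf{ind}(\mathcal A)$ is the set of individuals in $\mathcal A$. An ABox-AQ example is a pair $(\mathcal A,Q(a))$ of an ABox $\mathcal A$ and an atomic query $Q(a)$ with $Q$ a concept name and $a\in\mathsf{ind}(\mathcal A)$. An ontology $\mathcal O$ fits a pair $E=(E^+,E^-)$ of finite sets of examples if $\mathcal A\cup\mathcal O\models Q(a)$ for all $(\mathcal A,Q(a))\in E^+$ and $\mathcal A\cup\mathcal O\not\models Q(a)$ for all $(\mathcal A,Q(a))\in E^-$, where entailment quantifies over all interpretations (under the standard names assumption). $(\mathcal L,\mathrm{AQ})$-ontology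 fitting is the problem to decide, given $E$, whether some $\mathcal L$-ontology fits $E$. An $\mathcal{EL}$-simulation from an ABox $\mathcal A$ to an ABox $\mathcal C$ is a relation $S\subseteq\mathsf{ind}(\mathcal A)\times\mathsf{ind}(\mathcal C)$ such that $(d,d')\in S$ and $A(d)\in\mathcal A$ imply $A(d')\in\mathcal C$, and $(d,d')\in S$ and $r(d,e)\in\mathcal A$ imply that there is $r(d',e')\in\mathcal C$ with $(e,e')\in S$. For $\mathcal{ELI},\mathcal{ELI}_\bot$ also: $(d,d')\in S$ and $r(e,d)\in\mathcal A$ imply that there is $r(e',d')\in\mathcal C$ with $(e,e')\in S$. For $\mathcal{EL}_\bot,\mathcal{ELI}_\bot$ also: for every $d\in\mathsf{ind}(\mathcal A)$ there is $d'$ with $(d,d')\in S$. Let $\mathcal A^-$ be the disjoint union of the ABoxes of the examples in $E^-$ (empty if $E^-=\emptyset$). Consider the rule (R) on ABoxes $\mathcal C$: if $(\mathcal A,Q(a))\in E^+$ and $S$ is an $\mathcal L$-simulation from $\mathcal A$ to $\mathcal C$, replace $\mathcal C$ by $\mathcal C\cup\{Q(b)\mid(a,b)\in S\}$. Then: 1.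 For every $E$, there is exactly one set of assertions $\mathcal A^\pm$ that is obtained from $\mathcal A^-$ by finitely many applications of (R) and is not changed by any further application. It satisfies $\mathcal A^-\subseteq\mathcal A^\pm\subseteq\mathcal A^-\cup\{Q(b)\mid(\mathcal A,Q(a))\in E^+,\ b\in\mathsf{ind}(\mathcal A^-)\}$, and $E$ admits no fitting $\mathcal L$-ontology if and only if $Q(a)\in\mathcal A^\pm$ for some $(\mathcal A,Q(a))\in E^-$ (where $a$ stands for its copy in the component of $\mathcal A^-$ that stems from this example). 2. $(\mathcal L,\mathrm{AQ})$-ontology fitting is in $\mathrm{PTime}$. -/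

import Mathlib

namespace OntologyFitting

/-! ### Names, roles, concepts, ontologies

The countably infinite sets of concept, role and individual names consist of the finite words over
`{0,1}`, so that a name has a size and can be written on a machine tape. -/

abbrev ConceptName := List Bool
abbrev RoleName := List Bool
abbrev IndName := List Bool

/-- A role is a role name `r` or an inverse role `r⁻`. -/
inductive Role
  | name (r : RoleName)
  | inv (r : RoleName)

/-- `ELI⊥`-concepts: `C, D ::= ⊤ | ⊥ | A | C ⊓ D | ∃ R. C`. -/
inductive Concept
  | top
  | bot
  | atom (A : ConceptName)
  | inter (C D : Concept)
  | ex (R : Role) (C : Concept)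

/-- The four description logics `EL`, `EL⊥`, `ELI`, `ELI⊥`. -/
inductive DL
  | EL
  | ELbot
  | ELI
  | ELIbot

/-- The logic has the concept `⊥`. -/
def DL.HasBot : DL → Prop
  | EL => False
  | ELbot => True
  | ELI => False
  | ELIbot => True

/-- The logic has inverse roles. -/
def DL.HasInv : DL → Prop
  | EL => False
  | ELbot => False
  | ELI => True
  | ELIbot => True

/-- The role `R` may be used in `L`-concepts. -/
def Role.IsIn (L : DL) : Role → Prop
  | .name _ => True
  | .inv _ => L.HasInv

/-- `C` is an `L`-concept. -/
def Concept.IsIn (L : DL) : Concept → Prop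
  | .top => True
  | .bot => L.HasBot
  | .atom _ => True
  | .inter C D => C.IsIn L ∧ D.IsIn L
  | .ex R C => R.IsIn L ∧ C.IsIn L

/-- A concept inclusion `lhs ⊑ rhs`. -/
structure ConceptInclusion where
  lhs : Concept
  rhs : Concept

/-- An ontology is a finite set of concept inclusions. -/
abbrev Ontology := Finset ConceptInclusion

/-- `O` is an `L`-ontology. -/
def Ontology.IsIn (L : DL) (O : Ontology) : Prop :=
  ∀ i ∈ O, i.lhs.IsIn L ∧ i.rhs.IsIn L

/-! ### Interpretations -/

/-- A set with subsets for the concept names and binary relations for the role names. (The domain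
may be empty here; it is nonempty in an `Interpretation`.) -/
structure RelStr where
  Dom : Type
  conc : ConceptName → Set Dom
  role : RoleName → Dom → Dom → Prop

/-- The extension of a role. -/
def RelStr.roleExt (I : RelStr) : Role → I.Dom → I.Dom → Prop
  | .name r => fun d e => I.role r d e
  | .inv r => fun d e => I.role r e d

/-- The extension of a concept. -/
def RelStr.conceptExt (I : RelStr) : Concept → Set I.Dom
  | .top => Set.univ
  | .bot => ∅
  | .atom A => I.conc A
  | .inter C D => I.conceptExt C ∩ I.conceptExt D
  | .ex R C => {d | ∃ e, I.roleExt R d e ∧ e ∈ I.conceptExt C}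

/-- Interpretations under the standard names assumption: an individual name may or may not be an
element of the domain, and those that are denote themselves. Up to isomorphism this says that the
names denote through an injective partial map into the domain. -/
structure Interpretation extends RelStr where
  nonempty : Nonempty Dom
  ind : IndName → Option Dom
  ind_inj : ∀ a b d, ind a = some d → ind b = some d → a = b

/-- `I` is a model of the ontology `O`. -/
def Interpretation.ModelsOntology (I : Interpretation) (O : Ontology) : Prop :=
  ∀ i ∈ O, I.conceptExt i.lhs ⊆ I.conceptExt i.rhs

/-! ### ABoxes -/

/-- Concept assertions `A(a)` and role assertions `r(a,b)` over a set `N` of individuals. -/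
inductive Assertion (N : Type)
  | conc (A : ConceptName) (a : N)
  | role (r : RoleName) (a b : N)
  deriving DecidableEq

/-- The individuals in an assertion. -/
def Assertion.inds {N : Type} : Assertion N → List N
  | .conc _ a => [a]
  | .role _ a b => [a, b]

/-- Renaming of the individuals in an assertion. -/
def Assertion.map {N M : Type} (f : N → M) : Assertion N → Assertion M
  | .conc A a => .conc A (f a)
  | .role r a b => .role r (f a) (f b)

/-- Finite sets of assertions. (The ABoxes in examples are required to be nonempty below; the
disjoint union of an empty family of ABoxes is empty.) -/
abbrev ABox (N : Type) := Finset (Assertion N)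

/-- `ind(𝒜)`: the individuals used in `𝒜`. -/
def ABox.ind {N : Type} (A : ABox N) : Set N := {a | ∃ α ∈ A, a ∈ α.inds}

/-- An ABox viewed as an interpretation with domain `ind(𝒜)`. -/
def ABox.toRelStr {N : Type} (A : ABox N) : RelStr where
  Dom := {a : N // a ∈ A.ind}
  conc P := {a | Assertion.conc P a.1 ∈ A}
  role r a b := Assertion.role r a.1 b.1 ∈ A

/-- `I` satisfies an assertion. -/
def Interpretation.Satisfies (I : Interpretation) : Assertion IndName → Prop
  | .conc P a => ∃ d, I.ind a = some d ∧ d ∈ I.conc P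
  | .role r a b => ∃ d e, I.ind a = some d ∧ I.ind b = some e ∧ I.role r d e

/-- `I` is a model of the ABox `A`. -/
def Interpretation.ModelsABox (I : Interpretation) (A : ABox IndName) : Prop :=
  ∀ α ∈ A, I.Satisfies α

/-- `𝒜 ∪ 𝒪 ⊨ Q(a)`: the atomic query `Q(a)` holds in all models of `𝒜` and `𝒪`. -/
def Entails (A : ABox IndName) (O : Ontology) (Q : ConceptName) (a : IndName) : Prop :=
  ∀ I : Interpretation, I.ModelsABox A → I.ModelsOntology O → I.Satisfies (.conc Q a)

/-! ### Examples and fitting -/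

/-- An ABox-AQ example `(𝒜, Q(a))`, with `𝒜` nonempty and `a ∈ ind(𝒜)`. -/
structure Example where
  abox : ABox IndName
  concept : ConceptName
  individual : IndName
  abox_nonempty : abox.Nonempty
  individual_mem : individual ∈ abox.ind
  deriving DecidableEq

/-- A collection `E = (E⁺, E⁻)` of labeled ABox-AQ examples. -/
structure Collection where
  pos : Finset Example
  neg : Finset Example

/-- The ontology `O` fits the collection `E`. -/
def Fits (O : Ontology) (E : Collection) : Prop :=
  (∀ e ∈ E.pos, Entails e.abox O e.concept e.individual) ∧
  (∀ e ∈ E.neg, ¬ Entails e.abox O e.concept e.individual)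

/-- `E` admits a fitting `L`-ontology. -/
def HasFitting (L : DL) (E : Collection) : Prop :=
  ∃ O : Ontology, O.IsIn L ∧ Fits O E

/-! ### Simulations -/

/-- `S` is an `L`-simulation from `I` to `J`. -/
structure IsSimulation (L : DL) (I J : RelStr) (S : I.Dom → J.Dom → Prop) : Prop where
  atom : ∀ P d d', d ∈ I.conc P → S d d' → d' ∈ J.conc P
  rel : ∀ r d e d', I.role r d e → S d d' → ∃ e', J.role r d' e' ∧ S e e'
  irel : L.HasInv → ∀ r d e d', I.role r e d → S d d' → ∃ e', J.role r e' d' ∧ S e e'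
  tot : L.HasBot → ∀ d, ∃ d', S d d'

/-! ### Saturation -/

/-- The disjoint union `𝒜⁻` of the ABoxes of the negative examples; the individual `a` of the
example `e` becomes `(e, a)`. -/
def negUnion (E : Collection) : ABox (Example × IndName) :=
  E.neg.biUnion fun e => e.abox.image (Assertion.map fun a => (e, a))

/-- `C` is a completion of `𝒜⁻`:
`𝒜⁻ ⊆ C ⊆ 𝒜⁻ ∪ {Q(b) | (𝒜, Q(a)) ∈ E⁺, b ∈ ind(𝒜⁻)}`. -/
def IsCompletion (E : Collection) (C : ABox (Example × IndName)) : Prop :=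
  negUnion E ⊆ C ∧
  ∀ α ∈ C, α ∈ negUnion E ∨ ∃ e ∈ E.pos, ∃ b ∈ (negUnion E).ind, α = .conc e.concept b

/-- One application of the rule (R) to `C`, with result `C'`: for a positive example `(𝒜, Q(a))`
and an `L`-simulation `S` from `𝒜` to `C`, add `Q(b)` for all `(a, b) ∈ S`. -/
def RuleStep (L : DL) (E : Collection) (C C' : ABox (Example × IndName)) : Prop :=
  ∃ e ∈ E.pos, ∃ S : e.abox.toRelStr.Dom → C.toRelStr.Dom → Prop,
    IsSimulation L e.abox.toRelStr C.toRelStr S ∧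
    ∀ α, α ∈ C' ↔ α ∈ C ∨
      ∃ b : C.toRelStr.Dom, S ⟨e.individual, e.individual_mem⟩ b ∧ α = .conc e.concept b.1

/-- `C` is obtained from `𝒜⁻` by exhaustively applying the rule (R): finitely many applications
lead from `𝒜⁻` to `C`, and no application changes `C`. -/
def IsSaturation (L : DL) (E : Collection) (C : ABox (Example × IndName)) : Prop :=
  Relation.ReflTransGen (RuleStep L E) (negUnion E) C ∧ ∀ C', RuleStep L E C C' → C' = C

/-! ### Words and polynomial time -/

/-- The alphabet over which collections of examples are written. -/
inductive Symbol
  | bit (b : Bool)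
  | delim
  | conc
  | role
  | query
  | pos
  | neg
  deriving DecidableEq, Fintype

def encodeName (w : List Bool) : List Symbol := w.map Symbol.bit ++ [Symbol.delim]

def encodeAssertion : Assertion IndName → List Symbol
  | .conc P a => Symbol.conc :: (encodeName P ++ encodeName a)
  | .role r a b => Symbol.role :: (encodeName r ++ encodeName a ++ encodeName b)

/-- `w` is the word that writes the example `e` with label `s`, listing the assertions of its ABox
in some order. -/
def EncodesExample (s : Symbol) (e : Example) (w : List Symbol) : Prop :=
  ∃ l : List (Assertion IndName), (∀ α, α ∈ l ↔ α ∈ e.abox) ∧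
    w = s :: (l.flatMap encodeAssertion ++
      Symbol.query :: (encodeName e.concept ++ encodeName e.individual))

/-- `w` is a concatenation of words that write the examples in `F` with label `s`, in some
order. -/
def EncodesExamples (s : Symbol) (F : Finset Example) (w : List Symbol) : Prop :=
  ∃ l : List (Example × List Symbol), (∀ e, e ∈ l.map Prod.fst ↔ e ∈ F) ∧
    (∀ p ∈ l, EncodesExample s p.1 p.2) ∧ w = l.flatMap Prod.snd

/-- The word `w` encodes the collection `E`: first the positive, then the negative examples. -/
def Encodes (E : Collection) (w : List Symbol) : Prop :=
  ∃ u v, EncodesExamples Symbol.pos E.pos u ∧ EncodesExamples Symbol.neg E.neg v ∧ w = u ++ v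

/-- The decision problem `(L, AQ)`-ontology fitting, as a set of words: the encodings of the
collections that admit a fitting `L`-ontology. -/
def fittingProblem (L : DL) : Language Symbol :=
  {w | ∃ E : Collection, Encodes E w ∧ HasFitting L E}

/-- `PTime`: the characteristic function of the language, on all words, is computed by a (multi-stack)
Turing machine in time polynomial in the length of the word. -/
def InPTime {Γ : Type} (P : Language Γ) : Prop :=
  ∃ f : List Γ → Bool, (∀ w, f w = true ↔ w ∈ P) ∧
    Nonempty (Turing.TM2ComputableInPolyTime (fun w : List Γ => w) Computability.encodeBool f)

end OntologyFitting

namespace OntologyFitting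

/-! ### Homomorphisms and concepts -/

/-! The saturation `C` is the least set of assertions that contains `𝒜⁻` and is closed under (R):
simulations compose with inclusions, so rule applications never leave a closed superset of `𝒜⁻`.
Uniqueness follows, and existence holds because there are only finitely many completions.
`exists_fitting_iff` relates this least closed set to fitting, by two constructions.

If `C` contains no negative query, a fitting ontology is read off from `C`
(`Closed.exists_ontology`). As `C` is finite, each individual of a positive ABox has a
characteristic concept `D`: it holds there, and an element of `C` that satisfies `D` satisfies all
`⊥`-free concepts that hold there. Inclusion of these concept types satisfies the local conditions
of a simulation. If it is total, or totality is not required, closedness makes `D ⊑ Q` true in `C`,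
for `D` taken at the queried individual. Otherwise some individual has a characteristic concept that
is empty in `C`, and `D ⊑ ⊥` is true there. Either inclusion forces the positive example, and `C`
itself is a model that refutes all negative queries.

Conversely, let `O` fit. The assertions of `C` that hold in the disjoint union of countermodels for
the negative examples form a closed set containing `𝒜⁻`, hence are all of `C`, while the negative
queries fail in their components. Closedness is the soundness of (R), `rule_sound`. Its proof uses
the structure of subsets of a model, in which a subset satisfies exactly the concepts that all its
elements satisfy. It is again a model of `O`; sending an individual to the set of elements that
simulate it gives a model of the positive ABox, so the query holds at all these elements.

For `PTime`, the pairs in no simulation and the queries added by (R) are both least fixed points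
over polynomially many candidates (`lfp_stable`), so polynomially many stages suffice. For the
machine, a small language of stack programs is compiled to multi-stack Turing machines
(`Exec.evalsTo`). Data are binary trees written in preorder, and the class `PolyFn` is closed under
composition, pairing, case distinction and size-bounded iteration, hence under list operations and
`lfp`. A parser with an inverse (`parse_sound`, `parse_writeCollection`) links words to collections.
-/

/-- `h` is a homomorphism from `I` to `J`. -/
structure IsHom (I J : RelStr) (h : I.Dom → J.Dom) : Prop where
  conc : ∀ P d, d ∈ I.conc P → h d ∈ J.conc P
  role : ∀ r d e, I.role r d e → J.role r (h d) (h e)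

theorem IsHom.roleExt {I J : RelStr} {h : I.Dom → J.Dom} (hh : IsHom I J h) {R : Role}
    {d e : I.Dom} (H : I.roleExt R d e) : J.roleExt R (h d) (h e) := by
  cases R
  · exact hh.role _ _ _ H
  · exact hh.role _ _ _ H

theorem IsHom.conceptExt {I J : RelStr} {h : I.Dom → J.Dom} (hh : IsHom I J h) (D : Concept) :
    ∀ d, d ∈ I.conceptExt D → h d ∈ J.conceptExt D := by
  induction D with
  | top => intro d _; trivial
  | bot => intro d hd; exact hd.elim
  | atom A => intro d hd; exact hh.conc A d hd
  | inter C D hC hD => intro d hd; exact ⟨hC d hd.1, hD d hd.2⟩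
  | ex R C hC =>
    rintro d ⟨e, hR, he⟩
    exact ⟨h e, hh.roleExt hR, hC e he⟩

/-- An assertion holds in `I` when the individuals denote according to `h`. -/
def HoldsUnder {N : Type} (I : RelStr) (h : N → Option I.Dom) : Assertion N → Prop
  | .conc P a => ∃ d, h a = some d ∧ d ∈ I.conc P
  | .role r a b => ∃ d e, h a = some d ∧ h b = some e ∧ I.role r d e

theorem HoldsUnder.exists_eq_some {N : Type} {I : RelStr} {h : N → Option I.Dom}
    {α : Assertion N} (H : HoldsUnder I h α) {a : N} (ha : a ∈ α.inds) : ∃ d, h a = some d := by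
  cases α with
  | conc P b =>
    obtain ⟨d, hd, -⟩ := H
    simp only [Assertion.inds, List.mem_singleton] at ha
    exact ⟨d, ha ▸ hd⟩
  | role r b c =>
    obtain ⟨d, e, hd, he, -⟩ := H
    simp only [Assertion.inds, List.mem_cons, List.not_mem_nil, or_false] at ha
    rcases ha with rfl | rfl
    exacts [⟨d, hd⟩, ⟨e, he⟩]

theorem Interpretation.satisfies_iff (I : Interpretation) (α : Assertion IndName) :
    I.Satisfies α ↔ HoldsUnder I.toRelStr I.ind α := by
  cases α <;> rfl

/-- If the assertions of an ABox hold in `I`, the denotation is a homomorphism. -/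
theorem exists_isHom {N : Type} {A : ABox N} {I : RelStr} {h : N → Option I.Dom}
    (H : ∀ α ∈ A, HoldsUnder I h α) :
    ∃ g : A.toRelStr.Dom → I.Dom, IsHom A.toRelStr I g ∧ ∀ a, h a.1 = some (g a) := by
  have hdef : ∀ a : A.toRelStr.Dom, ∃ d, h a.1 = some d := by
    rintro ⟨a, α, hα, ha⟩
    exact (H α hα).exists_eq_some ha
  choose g hg using hdef
  refine ⟨g, ⟨?_, ?_⟩, hg⟩
  · intro P d hd
    obtain ⟨x, hx, hP⟩ := H _ hd
    rw [hg] at hx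
    cases hx
    exact hP
  · intro r d e hd
    obtain ⟨x, y, hx, hy, hr⟩ := H _ hd
    rw [hg] at hx hy
    cases hx
    cases hy
    exact hr

/-- The inclusion of an ABox in a larger one. -/
def ABox.incl {N : Type} {C C' : ABox N} (h : C ⊆ C') (b : C.toRelStr.Dom) : C'.toRelStr.Dom :=
  ⟨b.1, let ⟨α, hα, hb⟩ := b.2; ⟨α, h hα, hb⟩⟩

theorem ABox.isHom_incl {N : Type} {C C' : ABox N} (h : C ⊆ C') :
    IsHom C.toRelStr C'.toRelStr (ABox.incl h) :=
  ⟨fun _ _ hd => h hd, fun _ _ _ hd => h hd⟩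

/-- Applied to inclusions of ABoxes this makes (R) monotone; applied to denotation maps it moves a
simulation into a model. -/
theorem IsSimulation.comp_hom {L : DL} {I J K : RelStr} {S : I.Dom → J.Dom → Prop}
    (hS : IsSimulation L I J S) {h : J.Dom → K.Dom} (hh : IsHom J K h) :
    IsSimulation L I K fun d k => ∃ d', S d d' ∧ h d' = k where
  atom := by
    rintro P d _ hd ⟨d', hs, rfl⟩
    exact hh.conc _ _ (hS.atom P d d' hd hs)
  rel := by
    rintro r d e _ hd ⟨d', hs, rfl⟩
    obtain ⟨e', hr, he⟩ := hS.rel r d e d' hd hs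
    exact ⟨h e', hh.role _ _ _ hr, e', he, rfl⟩
  irel := by
    rintro hi r d e _ hd ⟨d', hs, rfl⟩
    obtain ⟨e', hr, he⟩ := hS.irel hi r d e d' hd hs
    exact ⟨h e', hh.role _ _ _ hr, e', he, rfl⟩
  tot := by
    intro hb d
    obtain ⟨d', hd⟩ := hS.tot hb d
    exact ⟨h d', d', hd, rfl⟩

/-! ### Characteristic concepts -/

/-- The logic without `⊥`. -/
def DL.noBot : DL → DL
  | EL => EL
  | ELbot => EL
  | ELI => ELI
  | ELIbot => ELI

theorem DL.hasInv_noBot (L : DL) : L.noBot.HasInv ↔ L.HasInv := by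
  cases L <;> simp [DL.noBot, DL.HasInv]

theorem Concept.IsIn.of_noBot {L : DL} {D : Concept} (h : D.IsIn L.noBot) : D.IsIn L := by
  induction D with
  | top => trivial
  | bot => cases L <;> simp [DL.noBot, Concept.IsIn, DL.HasBot] at h
  | atom A => trivial
  | inter C D hC hD => exact ⟨hC h.1, hD h.2⟩
  | ex R C hC =>
    refine ⟨?_, hC h.2⟩
    cases R with
    | name r => trivial
    | inv r => exact (DL.hasInv_noBot L).1 h.1

/-- The `⊥`-free `L`-concepts that hold at `d` also hold at `d'`. -/
def ConceptLE (L : DL) (I J : RelStr) (d : I.Dom) (d' : J.Dom) : Prop :=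
  ∀ D : Concept, D.IsIn L.noBot → d ∈ I.conceptExt D → d' ∈ J.conceptExt D

/-- Every element of `J` that lacks some concept of `d` is excluded by one such concept. Finitely
many of them are needed, so their conjunction is a concept. -/
theorem exists_characteristic_concept (L : DL) (I J : RelStr) [Finite J.Dom] (d : I.Dom) :
    ∃ D : Concept, D.IsIn L.noBot ∧ d ∈ I.conceptExt D ∧
      ∀ d' ∈ J.conceptExt D, ConceptLE L I J d d' := by
  classical
  have key : ∀ s : Finset J.Dom, ∃ D : Concept, D.IsIn L.noBot ∧ d ∈ I.conceptExt D ∧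
      ∀ d' ∈ s, d' ∈ J.conceptExt D → ConceptLE L I J d d' := by
    intro s
    induction s using Finset.induction_on with
    | empty => exact ⟨.top, trivial, trivial, by simp⟩
    | insert x s _ ih =>
      obtain ⟨D, hD, hd, hs⟩ := ih
      by_cases hx : ConceptLE L I J d x
      · refine ⟨D, hD, hd, fun d' hd' h => ?_⟩
        rcases Finset.mem_insert.1 hd' with rfl | hd'
        exacts [hx, hs d' hd' h]
      · simp only [ConceptLE, not_forall] at hx
        obtain ⟨D', hD', hdD', hx⟩ := hx
        refine ⟨.inter D D', ⟨hD, hD'⟩, ⟨hd, hdD'⟩, fun d' hd' h => ?_⟩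
        rcases Finset.mem_insert.1 hd' with rfl | hd'
        exacts [(hx h.2).elim, hs d' hd' h.1]
  have := Fintype.ofFinite J.Dom
  obtain ⟨D, hD, hd, hs⟩ := key Finset.univ
  exact ⟨D, hD, hd, fun d' => hs d' (Finset.mem_univ _)⟩

/-- The Hennessy–Milner argument: if `D` is the characteristic concept of a successor `e` of `d`,
then `∃r.D` passes from `d` to `d'` and yields a successor of `d'` that satisfies all concepts of
`e`. -/
theorem isSimulation_conceptLE (L : DL) (I J : RelStr) [Finite J.Dom]
    (htot : L.HasBot → ∀ d, ∃ d', ConceptLE L I J d d') :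
    IsSimulation L I J (ConceptLE L I J) where
  atom P d d' hd h := h (.atom P) trivial hd
  rel r d e d' hd h := by
    obtain ⟨D, hD, he, hs⟩ := exists_characteristic_concept L I J e
    obtain ⟨e', hr, he'⟩ := h (.ex (.name r) D) ⟨trivial, hD⟩ ⟨e, hd, he⟩
    exact ⟨e', hr, hs e' he'⟩
  irel hi r d e d' hd h := by
    obtain ⟨D, hD, he, hs⟩ := exists_characteristic_concept L I J e
    obtain ⟨e', hr, he'⟩ := h (.ex (.inv r) D) ⟨(DL.hasInv_noBot L).2 hi, hD⟩ ⟨e, hd, he⟩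
    exact ⟨e', hr, hs e' he'⟩
  tot := htot

/-! ### The ontology of a closed ABox -/

/-- No application of the rule (R) for the positive examples `pos` changes `C`. -/
def Closed {N : Type} (L : DL) (pos : Finset Example) (C : ABox N) : Prop :=
  ∀ e ∈ pos, ∀ S : e.abox.toRelStr.Dom → C.toRelStr.Dom → Prop,
    IsSimulation L e.abox.toRelStr C.toRelStr S →
    ∀ b, S ⟨e.individual, e.individual_mem⟩ b → Assertion.conc e.concept b.1 ∈ C

instance finite_toRelStr_dom {N : Type} (C : ABox N) : Finite C.toRelStr.Dom := by
  classical
  have h : C.ind = ⋃ α ∈ C, {a | a ∈ α.inds} := by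
    ext a
    simp [ABox.ind]
  have : C.ind.Finite := by
    rw [h]
    exact C.finite_toSet.biUnion fun α _ => α.inds.finite_toSet
  exact this.to_subtype

/-- The relational structure `I` is a model of `O`. -/
def RelStr.Models (I : RelStr) (O : Ontology) : Prop :=
  ∀ i ∈ O, I.conceptExt i.lhs ⊆ I.conceptExt i.rhs

/-- Denotation is a homomorphism, so the characteristic concept holds in every model of the ABox.
The inclusion then forces the query, or excludes all models if its right-hand side is `⊥`. -/
theorem exists_inclusion {N : Type} {L : DL} {pos : Finset Example} {C : ABox N}
    (hC : Closed L pos C) {e : Example} (he : e ∈ pos) :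
    ∃ i : ConceptInclusion, (i.lhs.IsIn L ∧ i.rhs.IsIn L) ∧
      C.toRelStr.conceptExt i.lhs ⊆ C.toRelStr.conceptExt i.rhs ∧
      ∀ O : Ontology, i ∈ O → Entails e.abox O e.concept e.individual := by
  by_cases htot : L.HasBot → ∀ d, ∃ d', ConceptLE L e.abox.toRelStr C.toRelStr d d'
  · obtain ⟨D, hD, hd, hs⟩ := exists_characteristic_concept L e.abox.toRelStr C.toRelStr
      ⟨e.individual, e.individual_mem⟩
    refine ⟨⟨D, .atom e.concept⟩, ⟨hD.of_noBot, trivial⟩, fun b hb => ?_, fun O hO I hA hI => ?_⟩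
    · exact hC e he _ (isSimulation_conceptLE L _ _ htot) b (hs b hb)
    · obtain ⟨g, hg, hind⟩ := exists_isHom fun α hα => (I.satisfies_iff α).1 (hA α hα)
      exact ⟨_, hind ⟨e.individual, e.individual_mem⟩, hI _ hO (hg.conceptExt D _ hd)⟩
  -- Here `⊥` is available and some individual `d` has no counterpart in `C`, so its characteristic
  -- concept is empty in `C`.
  · push Not at htot
    obtain ⟨hb, d, hd⟩ := htot
    obtain ⟨D, hD, hdD, hs⟩ := exists_characteristic_concept L e.abox.toRelStr C.toRelStr d
    refine ⟨⟨D, .bot⟩, ⟨hD.of_noBot, hb⟩, fun b hb => (hd b (hs b hb)).elim,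
      fun O hO I hA hI => ?_⟩
    obtain ⟨g, hg, -⟩ := exists_isHom fun α hα => (I.satisfies_iff α).1 (hA α hα)
    exact (hI _ hO (hg.conceptExt D _ hdD)).elim

theorem Closed.exists_ontology {N : Type} {L : DL} {pos : Finset Example} {C : ABox N}
    (hC : Closed L pos C) :
    ∃ O : Ontology, O.IsIn L ∧ C.toRelStr.Models O ∧
      ∀ e ∈ pos, Entails e.abox O e.concept e.individual := by
  classical
  choose i hi using fun e : {e // e ∈ pos} => exists_inclusion hC e.2
  refine ⟨pos.attach.image i, ?_, ?_, ?_⟩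
  · intro j hj
    obtain ⟨e, -, rfl⟩ := Finset.mem_image.1 hj
    exact (hi e).1
  · intro j hj
    obtain ⟨e, -, rfl⟩ := Finset.mem_image.1 hj
    exact (hi e).2.1
  · intro e he
    exact (hi ⟨e, he⟩).2.2 _ (Finset.mem_image_of_mem _ (Finset.mem_attach _ _))

/-! ### The power structure -/

/-- The structure on (copies of) the subsets of `I`, where a subset satisfies the `L`-concepts that
all of its elements satisfy. -/
def powerStr (L : DL) (I : RelStr) : RelStr where
  Dom := {U : Set I.Dom // L.HasBot → U.Nonempty} × IndName
  conc P := {x | x.1.1 ⊆ I.conc P}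
  role r x y := (∀ u ∈ x.1.1, ∃ v ∈ y.1.1, I.role r u v) ∧
    (L.HasInv → ∀ v ∈ y.1.1, ∃ u ∈ x.1.1, I.role r u v)

/-- An inverse role occurs only in logics with inverse roles. There both conditions on a role are in
force, and passing to the inverse swaps them. -/
theorem powerStr_roleExt {L : DL} {I : RelStr} {R : Role} (hR : R.IsIn L)
    (x y : (powerStr L I).Dom) :
    (powerStr L I).roleExt R x y ↔ (∀ u ∈ x.1.1, ∃ v ∈ y.1.1, I.roleExt R u v) ∧
      (L.HasInv → ∀ v ∈ y.1.1, ∃ u ∈ x.1.1, I.roleExt R u v) := by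
  cases R with
  | name r => rfl
  | inv r =>
    have hR : L.HasInv := hR
    simp only [RelStr.roleExt, powerStr, hR, true_imp_iff]
    exact and_comm

/-- This carries inclusions from `I` to its power structure. Nonemptiness of the subsets is needed
for `⊥` alone. -/
theorem mem_conceptExt_powerStr {L : DL} {I : RelStr} {D : Concept} (hD : D.IsIn L) :
    ∀ x : (powerStr L I).Dom, x ∈ (powerStr L I).conceptExt D ↔ x.1.1 ⊆ I.conceptExt D := by
  induction D with
  | top => intro x; exact ⟨fun _ _ _ => trivial, fun _ => trivial⟩
  | bot =>
    intro x
    refine ⟨fun h => h.elim, fun h => ?_⟩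
    obtain ⟨u, hu⟩ := x.1.2 hD
    exact (h hu).elim
  | atom A => intro x; rfl
  | inter C D hC hD' =>
    intro x
    exact (and_congr (hC hD.1 x) (hD' hD.2 x)).trans Set.subset_inter_iff.symm
  | ex R C hC =>
    intro x
    constructor
    · rintro ⟨y, hR, hy⟩ u hu
      obtain ⟨v, hv, hr⟩ := ((powerStr_roleExt hD.1 x y).1 hR).1 u hu
      exact ⟨v, hr, (hC hD.2 y).1 hy hv⟩
    · intro h
      refine ⟨(⟨{v | v ∈ I.conceptExt C ∧ ∃ u ∈ x.1.1, I.roleExt R u v}, fun hb => ?_⟩, x.2), ?_, ?_⟩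
      · obtain ⟨u, hu⟩ := x.1.2 hb
        obtain ⟨v, hr, hv⟩ := h hu
        exact ⟨v, hv, u, hu, hr⟩
      · refine (powerStr_roleExt hD.1 _ _).2 ⟨fun u hu => ?_, fun _ v hv => hv.2⟩
        obtain ⟨v, hr, hv⟩ := h hu
        exact ⟨v, ⟨hv, u, hu, hr⟩, hr⟩
      · exact (hC hD.2 _).2 fun v hv => hv.1

/-- The rule (R) is sound: if the assertions of `C` hold in a model of `O`, then so do the
assertions that the rule adds. -/
theorem rule_sound {N : Type} {L : DL} {O : Ontology} (hO : O.IsIn L) {e : Example}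
    (he : Entails e.abox O e.concept e.individual) {C : ABox N} {I : RelStr} (hI : I.Models O)
    {g : C.toRelStr.Dom → I.Dom} (hg : IsHom C.toRelStr I g)
    {S : e.abox.toRelStr.Dom → C.toRelStr.Dom → Prop}
    (hS : IsSimulation L e.abox.toRelStr C.toRelStr S) {b : C.toRelStr.Dom}
    (hb : S ⟨e.individual, e.individual_mem⟩ b) : g b ∈ I.conc e.concept := by
  classical
  have hT := hS.comp_hom hg
  set T : e.abox.toRelStr.Dom → I.Dom → Prop := fun d k => ∃ d', S d d' ∧ g d' = k
  -- An individual denotes the set of elements that simulate it. The second coordinate keeps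
  -- individuals with the same set apart, as the standard names assumption demands.
  let pt : e.abox.toRelStr.Dom → (powerStr L I).Dom := fun a => (⟨{k | T a k}, fun h => hT.tot h a⟩, a.1)
  let J : Interpretation :=
    { powerStr L I with
      nonempty := ⟨pt ⟨e.individual, e.individual_mem⟩⟩
      ind := fun a => if h : a ∈ e.abox.ind then some (pt ⟨a, h⟩) else none
      ind_inj := by
        intro a b d ha hb
        split_ifs at ha hb
        exact congrArg Prod.snd ((Option.some.inj ha).trans (Option.some.inj hb).symm) }
  have hind : ∀ a (h : a ∈ e.abox.ind), J.ind a = some (pt ⟨a, h⟩) := fun a h => dif_pos h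
  have hJA : J.ModelsABox e.abox := by
    intro α hα
    cases α with
    | conc P a =>
      have ha : a ∈ e.abox.ind := ⟨_, hα, by simp [Assertion.inds]⟩
      exact ⟨_, hind a ha, fun k hk => hT.atom P ⟨a, ha⟩ k hα hk⟩
    | role r a c =>
      have ha : a ∈ e.abox.ind := ⟨_, hα, by simp [Assertion.inds]⟩
      have hc : c ∈ e.abox.ind := ⟨_, hα, by simp [Assertion.inds]⟩
      refine ⟨_, _, hind a ha, hind c hc, fun k hk => ?_, fun hi k hk => ?_⟩
      · obtain ⟨k', hr, hk'⟩ := hT.rel r ⟨a, ha⟩ ⟨c, hc⟩ k hα hk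
        exact ⟨k', hk', hr⟩
      · obtain ⟨k', hr, hk'⟩ := hT.irel hi r ⟨c, hc⟩ ⟨a, ha⟩ k hα hk
        exact ⟨k', hk', hr⟩
  have hJO : J.ModelsOntology O := by
    intro i hi x hx
    exact (mem_conceptExt_powerStr (hO i hi).2 x).2
      (((mem_conceptExt_powerStr (hO i hi).1 x).1 hx).trans (hI i hi))
  obtain ⟨d, hd, hdQ⟩ := he J hJA hJO
  rw [hind _ e.individual_mem] at hd
  cases hd
  exact hdQ ⟨b, hb, rfl⟩

/-! ### Fitting and closed ABoxes -/

/-- The disjoint union of a family of structures. -/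
def sigmaStr {ι : Type} (I : ι → RelStr) : RelStr where
  Dom := Σ i, (I i).Dom
  conc P := {x | x.2 ∈ (I x.1).conc P}
  role r x y := ∃ i d e, x = ⟨i, d⟩ ∧ y = ⟨i, e⟩ ∧ (I i).role r d e

/-- The inclusion of a component in the disjoint union. -/
def sigmaStr.mk {ι : Type} (I : ι → RelStr) (i : ι) (d : (I i).Dom) : (sigmaStr I).Dom := ⟨i, d⟩

theorem mem_conceptExt_sigmaStr {ι : Type} {I : ι → RelStr} (D : Concept) :
    ∀ i (d : (I i).Dom), (⟨i, d⟩ : (sigmaStr I).Dom) ∈ (sigmaStr I).conceptExt D ↔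
      d ∈ (I i).conceptExt D := by
  induction D with
  | top => intro i d; exact Iff.rfl
  | bot => intro i d; exact Iff.rfl
  | atom A => intro i d; exact Iff.rfl
  | inter C D hC hD => intro i d; exact and_congr (hC i d) (hD i d)
  | ex R C hC =>
    intro i d
    constructor
    · rintro ⟨⟨j, e⟩, hR, he⟩
      cases R <;>
      · obtain ⟨k, x, y, hx, hy, hr⟩ := hR
        cases hx
        cases hy
        exact ⟨_, hr, (hC _ _).1 he⟩
    · rintro ⟨e, hR, he⟩
      refine ⟨⟨i, e⟩, ?_, (hC _ _).2 he⟩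
      cases R <;> exact ⟨i, _, _, rfl, rfl, hR⟩

theorem sigmaStr_models {ι : Type} {I : ι → RelStr} {O : Ontology} (h : ∀ i, (I i).Models O) :
    (sigmaStr I).Models O := by
  rintro i hi ⟨j, d⟩ hd
  exact (mem_conceptExt_sigmaStr _ _ _).2 (h j i hi ((mem_conceptExt_sigmaStr _ _ _).1 hd))

section Tagged

variable {T : Type} [DecidableEq T]

/-- The disjoint union of a family of ABoxes indexed by a finite set. -/
def tagged (neg : Finset T) (abox : T → ABox IndName) : ABox (T × IndName) :=
  neg.biUnion fun t => (abox t).image (Assertion.map fun a => (t, a))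

theorem mem_tagged {neg : Finset T} {abox : T → ABox IndName} {α : Assertion (T × IndName)} :
    α ∈ tagged neg abox ↔ ∃ t ∈ neg, ∃ β ∈ abox t, β.map (fun a => (t, a)) = α := by
  simp [tagged]

theorem inds_map {N M : Type} (f : N → M) (α : Assertion N) :
    (α.map f).inds = α.inds.map f := by
  cases α <;> rfl

theorem mem_ind_tagged {neg : Finset T} {abox : T → ABox IndName} {t : T} (ht : t ∈ neg)
    {a : IndName} (ha : a ∈ (abox t).ind) : (t, a) ∈ (tagged neg abox).ind := by
  obtain ⟨α, hα, ha⟩ := ha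
  refine ⟨_, mem_tagged.2 ⟨t, ht, α, hα, rfl⟩, ?_⟩
  rw [inds_map]
  exact List.mem_map_of_mem ha

/-- If `C` is the least closed ABox that contains the disjoint union of the negative ABoxes, then
some `L`-ontology fits if and only if `C` contains no negative query. -/
theorem exists_fitting_iff {L : DL} {pos : Finset Example} {neg : Finset T}
    {abox : T → ABox IndName} {Q : T → ConceptName} {a : T → IndName}
    (ha : ∀ t ∈ neg, a t ∈ (abox t).ind) {C : ABox (T × IndName)} (h0 : tagged neg abox ⊆ C)
    (hC : Closed L pos C)
    (hleast : ∀ C' ⊆ C, tagged neg abox ⊆ C' → Closed L pos C' → C ⊆ C') :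
    (∃ O : Ontology, O.IsIn L ∧ (∀ e ∈ pos, Entails e.abox O e.concept e.individual) ∧
      ∀ t ∈ neg, ¬ Entails (abox t) O (Q t) (a t)) ↔
    ∀ t ∈ neg, Assertion.conc (Q t) (t, a t) ∉ C := by
  classical
  constructor
  · rintro ⟨O, hOL, hpos, hneg⟩ t ht hbad
    have hmod : ∀ t : {t // t ∈ neg}, ∃ I : Interpretation, I.ModelsABox (abox t.1) ∧
        I.ModelsOntology O ∧ ¬ I.Satisfies (.conc (Q t) (a t)) := by
      intro t
      have := hneg t.1 t.2
      simpa only [Entails, not_forall, exists_prop] using this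
    choose I hIA hImod hIQ using hmod
    -- All components of `C` must be interpreted at once, hence the disjoint union of the
    -- countermodels.
    let J := sigmaStr fun t => (I t).toRelStr
    have hJ : J.Models O := sigmaStr_models fun t => hImod t
    let h : T × IndName → Option J.Dom := fun x =>
      if hx : x.1 ∈ neg then ((I ⟨x.1, hx⟩).ind x.2).map (sigmaStr.mk _ ⟨x.1, hx⟩) else none
    have hh : ∀ t (ht : t ∈ neg) b, h (t, b) = ((I ⟨t, ht⟩).ind b).map (sigmaStr.mk _ ⟨t, ht⟩) :=
      fun t ht b => dif_pos ht
    have hsub : tagged neg abox ⊆ C.filter (HoldsUnder J h) := by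
      intro α hα
      refine Finset.mem_filter.2 ⟨h0 hα, ?_⟩
      obtain ⟨s, hs, β, hβ, rfl⟩ := mem_tagged.1 hα
      have := hIA ⟨s, hs⟩ β hβ
      cases β with
      | conc P b =>
        obtain ⟨d, hd, hP⟩ := this
        exact ⟨⟨⟨s, hs⟩, d⟩, by rw [hh s hs, hd]; rfl, hP⟩
      | role r b c =>
        obtain ⟨d, e, hd, he, hr⟩ := this
        exact ⟨⟨⟨s, hs⟩, d⟩, ⟨⟨s, hs⟩, e⟩, by rw [hh s hs, hd]; rfl, by rw [hh s hs, he]; rfl,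
          _, _, _, rfl, rfl, hr⟩
    -- What (R) adds lies in `C` because `C` is closed, and holds in `J` because (R) is sound.
    have hclosed : Closed L pos (C.filter (HoldsUnder J h)) := by
      intro e he S hS b hb
      obtain ⟨g, hg, hgh⟩ := exists_isHom (A := C.filter (HoldsUnder J h)) (I := J) (h := h)
        fun α hα => (Finset.mem_filter.1 hα).2
      refine Finset.mem_filter.2 ⟨?_, g b, hgh b, rule_sound hOL (hpos e he) hJ hg hS hb⟩
      exact hC e he _ (hS.comp_hom (ABox.isHom_incl (Finset.filter_subset _ _)))
        (ABox.incl (Finset.filter_subset _ _) b) ⟨b, hb, rfl⟩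
    have hmem := hleast _ (Finset.filter_subset _ _) hsub hclosed hbad
    obtain ⟨d, hd, hQ⟩ := (Finset.mem_filter.1 hmem).2
    obtain ⟨d', hd', rfl⟩ := Option.map_eq_some_iff.1 ((hh t ht _).symm.trans hd)
    exact hIQ ⟨t, ht⟩ ⟨d', hd', hQ⟩
  · intro hbad
    obtain ⟨O, hOL, hCO, hpos⟩ := hC.exists_ontology
    refine ⟨O, hOL, hpos, fun t ht hent => hbad t ht ?_⟩
    have hind : ∀ b ∈ (abox t).ind, (t, b) ∈ C.ind := by
      intro b hb
      obtain ⟨α, hα, hb⟩ := mem_ind_tagged ht hb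
      exact ⟨α, h0 hα, hb⟩
    -- The same structure `C` refutes every negative example; only the naming depends on `t`, as
    -- names go to the individuals of that component.
    let I : Interpretation :=
      { C.toRelStr with
        nonempty := ⟨⟨(t, a t), hind _ (ha t ht)⟩⟩
        ind := fun b => if hb : (t, b) ∈ C.ind then some ⟨(t, b), hb⟩ else none
        ind_inj := by
          intro b c d hb hc
          split_ifs at hb hc
          have := congrArg Subtype.val ((Option.some.inj hb).trans (Option.some.inj hc).symm)
          exact congrArg Prod.snd this }
    have hI : ∀ b (hb : (t, b) ∈ C.ind), I.ind b = some ⟨(t, b), hb⟩ := fun b hb => dif_pos hb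
    have hA : I.ModelsABox (abox t) := by
      intro α hα
      have hα' : α.map (fun a => (t, a)) ∈ C := h0 (mem_tagged.2 ⟨t, ht, α, hα, rfl⟩)
      cases α with
      | conc P b => exact ⟨_, hI b (hind b ⟨_, hα, by simp [Assertion.inds]⟩), hα'⟩
      | role r b c =>
        exact ⟨_, _, hI b (hind b ⟨_, hα, by simp [Assertion.inds]⟩),
          hI c (hind c ⟨_, hα, by simp [Assertion.inds]⟩), hα'⟩
    obtain ⟨d, hd, hQ⟩ := hent I hA hCO
    rw [hI _ (hind _ (ha t ht))] at hd
    cases hd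
    exact hQ

end Tagged

/-! ### Saturation -/

theorem RuleStep.subset {L : DL} {E : Collection} {C C' : ABox (Example × IndName)}
    (h : RuleStep L E C C') : C ⊆ C' := by
  obtain ⟨e, -, S, -, hC'⟩ := h
  exact fun α hα => (hC' α).2 (Or.inl hα)

/-- The simulation used for `C` is, after composition with the inclusion, a simulation into `D`, and
there its queries are already present. -/
theorem RuleStep.subset_of_closed {L : DL} {E : Collection} {C C' D : ABox (Example × IndName)}
    (h : RuleStep L E C C') (hD : Closed L E.pos D) (hCD : C ⊆ D) : C' ⊆ D := by
  obtain ⟨e, he, S, hS, hC'⟩ := h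
  intro α hα
  rcases (hC' α).1 hα with hα | ⟨b, hb, rfl⟩
  · exact hCD hα
  · exact hD e he _ (hS.comp_hom (ABox.isHom_incl hCD)) (ABox.incl hCD b) ⟨b, hb, rfl⟩

theorem subset_of_reflTransGen_of_closed {L : DL} {E : Collection}
    {C D : ABox (Example × IndName)} (h : Relation.ReflTransGen (RuleStep L E) (negUnion E) C)
    (hD : Closed L E.pos D) (h0 : negUnion E ⊆ D) : C ⊆ D := by
  induction h with
  | refl => exact h0
  | tail _ hstep ih => exact hstep.subset_of_closed hD ih

theorem IsSaturation.closed {L : DL} {E : Collection} {C : ABox (Example × IndName)}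
    (h : IsSaturation L E C) : Closed L E.pos C := by
  classical
  intro e he S hS b hb
  have := Fintype.ofFinite C.toRelStr.Dom
  -- The result of the application has to be exhibited as a finite set, which is possible as `C` has
  -- finitely many individuals.
  let C' : ABox (Example × IndName) := C ∪
    (Finset.univ.filter fun b : C.toRelStr.Dom => S ⟨e.individual, e.individual_mem⟩ b).image
      fun b => Assertion.conc e.concept b.1
  have hstep : RuleStep L E C C' := by
    refine ⟨e, he, S, hS, fun α => ?_⟩
    simp only [C', Finset.mem_union, Finset.mem_image, Finset.mem_filter, Finset.mem_univ,
      true_and, eq_comm (a := α)]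
  have hC' : C' ⊆ C := (h.2 C' hstep).le
  exact hC' <| Finset.mem_union_right _
    (Finset.mem_image_of_mem _ (Finset.mem_filter.2 ⟨Finset.mem_univ _, hb⟩))

theorem IsCompletion.ind_subset {E : Collection} {C : ABox (Example × IndName)}
    (h : IsCompletion E C) : C.ind ⊆ (negUnion E).ind := by
  rintro b ⟨α, hα, hb⟩
  rcases h.2 α hα with hα | ⟨e, -, c, hc, rfl⟩
  · exact ⟨α, hα, hb⟩
  · simp only [Assertion.inds, List.mem_singleton] at hb
    exact hb ▸ hc

theorem RuleStep.isCompletion {L : DL} {E : Collection} {C C' : ABox (Example × IndName)}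
    (h : RuleStep L E C C') (hC : IsCompletion E C) : IsCompletion E C' := by
  refine ⟨hC.1.trans h.subset, fun α hα => ?_⟩
  obtain ⟨e, he, S, -, hC'⟩ := h
  rcases (hC' α).1 hα with hα | ⟨b, -, rfl⟩
  · exact hC.2 α hα
  · exact Or.inr ⟨e, he, b.1, hC.ind_subset b.2, rfl⟩

theorem isCompletion_of_reflTransGen {L : DL} {E : Collection} {C : ABox (Example × IndName)}
    (h : Relation.ReflTransGen (RuleStep L E) (negUnion E) C) : IsCompletion E C := by
  induction h with
  | refl => exact ⟨subset_rfl, fun α hα => Or.inl hα⟩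
  | tail _ hstep ih => exact hstep.isCompletion ih

/-- Completions are subsets of one finite set of assertions. This replaces a termination argument
for (R). -/
theorem finite_isCompletion (E : Collection) : {C | IsCompletion E C}.Finite := by
  have hcand : {α | α ∈ negUnion E ∨ ∃ e ∈ E.pos, ∃ b ∈ (negUnion E).ind,
      α = Assertion.conc e.concept b}.Finite := by
    refine (negUnion E).finite_toSet.union ?_
    have hind : (negUnion E).ind.Finite := Set.finite_coe_iff.1 (finite_toRelStr_dom (negUnion E))
    refine ((E.pos.finite_toSet.prod hind).image fun x => Assertion.conc x.1.concept x.2).subset ?_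
    rintro _ ⟨e, he, b, hb, rfl⟩
    exact ⟨(e, b), ⟨he, hb⟩, rfl⟩
  refine (hcand.toFinset.powerset.finite_toSet).subset fun C hC => ?_
  simp only [Finset.coe_powerset, Set.mem_preimage, Set.mem_powerset_iff]
  intro α hα
  exact (hcand.mem_toFinset).2 (hC.2 α hα)

theorem exists_isSaturation (L : DL) (E : Collection) : ∃ C, IsSaturation L E C := by
  have hfin : {C | Relation.ReflTransGen (RuleStep L E) (negUnion E) C}.Finite :=
    (finite_isCompletion E).subset fun C hC => isCompletion_of_reflTransGen hC
  -- A derivable set that is maximal under inclusion is unchanged by every further application.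
  obtain ⟨C, hC⟩ := hfin.exists_maximal ⟨negUnion E, Relation.ReflTransGen.refl⟩
  exact ⟨C, hC.1, fun C' h => le_antisymm (hC.2 (hC.1.tail h) h.subset) h.subset⟩

/-- The first part of the theorem: the saturation exists, is unique, and decides fitting. -/
theorem saturation_spec (L : DL) (E : Collection) :
    ∃ C : ABox (Example × IndName),
      IsSaturation L E C ∧ (∀ C', IsSaturation L E C' → C' = C) ∧ IsCompletion E C ∧
      (¬ HasFitting L E ↔ ∃ e ∈ E.neg, Assertion.conc e.concept (e, e.individual) ∈ C) := by
  obtain ⟨C, hC⟩ := exists_isSaturation L E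
  have hcomp := isCompletion_of_reflTransGen hC.1
  refine ⟨C, hC, fun C' hC' => ?_, hcomp, ?_⟩
  -- Both sets are derivable and closed, so each contains the other.
  · exact (subset_of_reflTransGen_of_closed hC'.1 hC.closed hcomp.1).antisymm
      (subset_of_reflTransGen_of_closed hC.1 hC'.closed (isCompletion_of_reflTransGen hC'.1).1)
  · have := exists_fitting_iff (L := L) (pos := E.pos) (neg := E.neg) (abox := Example.abox)
      (Q := Example.concept) (a := Example.individual) (fun e _ => e.individual_mem) (C := C)
      hcomp.1 hC.closed fun C' _ h0 hC' => subset_of_reflTransGen_of_closed hC.1 hC' h0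
    rw [HasFitting]
    simp only [Fits]
    rw [this]
    push Not
    rfl

end OntologyFitting

namespace OntologyFitting

/-! ### Structured programs over stacks -/

section Programs

variable {K : Type}

/-- Structured programs over a family of stacks. The program `loop k again body` pops the symbol
`o` from the stack `k` (`none` if it is empty), runs `body o` and starts over if `again o`. -/
inductive Prog (Γ : K → Type)
  | skip
  | push (k : K) (s : Γ k)
  | seq (p q : Prog Γ)
  | loop (k : K) (again : Option (Γ k) → Bool) (body : Option (Γ k) → Prog Γ)

variable {Γ : K → Type}

namespace Prog

/-- The lists of programs that occur when `p` and then `c` is run, up to the end of `p`. -/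
def conts : Prog Γ → List (Prog Γ) → Set (List (Prog Γ))
  | skip, c => {skip :: c}
  | push k s, c => {push k s :: c}
  | seq p q, c => {seq p q :: c} ∪ (p.conts (q :: c) ∪ q.conts c)
  | loop k again body, c => {loop k again body :: c} ∪
      ⋃ o, (body o).conts (if again o then loop k again body :: c else c)

/-- A loop has one body for each symbol or for the empty stack, hence finitely many. The finite set
obtained provides the control states of the machine. -/
theorem finite_conts [∀ k, Finite (Γ k)] (p : Prog Γ) : ∀ c, (p.conts c).Finite := by
  induction p with
  | skip => intro c; exact Set.finite_singleton _
  | push k s => intro c; exact Set.finite_singleton _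
  | seq p q hp hq => intro c; exact (Set.finite_singleton _).union ((hp _).union (hq _))
  | loop k again body h =>
    intro c
    exact (Set.finite_singleton _).union (Set.finite_iUnion fun o => h o _)

theorem cons_mem_conts (p : Prog Γ) (c : List (Prog Γ)) : p :: c ∈ p.conts c := by
  cases p with
  | skip => exact rfl
  | push k s => exact rfl
  | seq p q => exact Or.inl rfl
  | loop k again body => exact Or.inl rfl

variable [DecidableEq K]

/-- The contents of the stacks. -/
abbrev Store (Γ : K → Type) := ∀ k, List (Γ k)

/-- One step of a list of programs that are run one after the other. -/
def step : List (Prog Γ) × Store Γ → Option (List (Prog Γ) × Store Γ)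
  | ([], _) => none
  | (skip :: c, S) => some (c, S)
  | (push k s :: c, S) => some (c, Function.update S k (s :: S k))
  | (seq p q :: c, S) => some (p :: q :: c, S)
  | (loop k again body :: c, S) =>
    some (body (S k).head? :: (if again (S k).head? then loop k again body :: c else c),
      Function.update S k (S k).tail)

/-- `n` steps lead from `x` to `y`. -/
def Runs (n : ℕ) (x y : List (Prog Γ) × Store Γ) : Prop := (flip bind step)^[n] (some x) = some y

theorem Runs.trans {m n : ℕ} {x y z : List (Prog Γ) × Store Γ} (h : Runs m x y) (h' : Runs n y z) :
    Runs (m + n) x z := by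
  unfold Runs at *
  rw [Nat.add_comm, Function.iterate_add_apply, h, h']

theorem Runs.of_step {x y : List (Prog Γ) × Store Γ} (h : step x = some y) : Runs 1 x y := h

/-- The program `p` leads from `S` to `S'` in at most `t` steps. -/
def Exec (p : Prog Γ) (S S' : Store Γ) (t : ℕ) : Prop :=
  ∃ n ≤ t, ∀ c, Runs n (p :: c, S) (c, S')

theorem Exec.mono {p : Prog Γ} {S S' : Store Γ} {t t' : ℕ} (h : Exec p S S' t) (ht : t ≤ t') :
    Exec p S S' t' :=
  let ⟨n, hn, hr⟩ := h
  ⟨n, hn.trans ht, hr⟩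

theorem exec_skip (S : Store Γ) : Exec skip S S 1 := ⟨1, le_rfl, fun _ => Runs.of_step rfl⟩

theorem exec_push {k : K} {s : Γ k} {S S' : Store Γ} (h : Function.update S k (s :: S k) = S') :
    Exec (push k s) S S' 1 :=
  ⟨1, le_rfl, fun _ => Runs.of_step (h ▸ rfl)⟩

theorem Exec.seq {p q : Prog Γ} {S S' S'' : Store Γ} {t t' : ℕ} (h : Exec p S S' t)
    (h' : Exec q S' S'' t') : Exec (p.seq q) S S'' (1 + t + t') := by
  obtain ⟨m, hm, h⟩ := h
  obtain ⟨n, hn, h'⟩ := h'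
  exact ⟨1 + m + n, by omega, fun c => ((Runs.of_step rfl).trans (h _)).trans (h' c)⟩

/-- The popped symbol and the remaining store enter through equations, so that an application can
name them in simplified form. -/
theorem Exec.loop_exit {k : K} {again : Option (Γ k) → Bool} {body : Option (Γ k) → Prog Γ}
    {S S₁ S' : Store Γ} {o : Option (Γ k)} {t : ℕ} (ho : (S k).head? = o)
    (hS : Function.update S k (S k).tail = S₁) (ha : again o = false)
    (h : Exec (body o) S₁ S' t) : Exec (loop k again body) S S' (1 + t) := by
  subst ho hS
  obtain ⟨m, hm, h⟩ := h
  refine ⟨1 + m, by omega, fun c => (Runs.of_step rfl).trans ?_⟩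
  rw [ha]
  exact h c

theorem Exec.loop_again {k : K} {again : Option (Γ k) → Bool} {body : Option (Γ k) → Prog Γ}
    {S S₁ S' S'' : Store Γ} {o : Option (Γ k)} {t t' : ℕ} (ho : (S k).head? = o)
    (hS : Function.update S k (S k).tail = S₁) (ha : again o = true)
    (h : Exec (body o) S₁ S' t) (h' : Exec (loop k again body) S' S'' t') :
    Exec (loop k again body) S S'' (1 + t + t') := by
  subst ho hS
  obtain ⟨m, hm, h⟩ := h
  obtain ⟨n, hn, h'⟩ := h'
  refine ⟨1 + m + n, by omega, fun c => ((Runs.of_step rfl).trans ?_).trans (h' c)⟩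
  rw [ha]
  exact h _

/-! ### Compilation to Turing machines -/

/-- The invariant behind the finite control: a run stays among the listed continuations until the
program is finished. -/
theorem step_mem_conts (p : Prog Γ) : ∀ c, ∀ d ∈ p.conts c, ∀ S y, step (d, S) = some y →
    y.1 ∈ p.conts c ∨ y.1 = c := by
  induction p with
  | skip =>
    rintro c _ rfl S y h
    cases h
    exact Or.inr rfl
  | push k s =>
    rintro c _ rfl S y h
    cases h
    exact Or.inr rfl
  | seq p q hp hq =>
    rintro c d (rfl | hd | hd) S y h
    · cases h
      exact Or.inl (Or.inr (Or.inl (cons_mem_conts p _)))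
    · rcases hp _ d hd S y h with h | h
      · exact Or.inl (Or.inr (Or.inl h))
      · exact Or.inl (Or.inr (Or.inr (h ▸ cons_mem_conts q c)))
    · rcases hq _ d hd S y h with h | h
      · exact Or.inl (Or.inr (Or.inr h))
      · exact Or.inr h
  | loop k again body hb =>
    rintro c d (rfl | hd) S y h
    · cases h
      exact Or.inl (Or.inr (Set.mem_iUnion.2 ⟨_, cons_mem_conts _ _⟩))
    · obtain ⟨o, hd⟩ := Set.mem_iUnion.1 hd
      rcases hb o _ d hd S y h with h | h
      · exact Or.inl (Or.inr (Set.mem_iUnion.2 ⟨o, h⟩))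
      · split_ifs at h
        · exact Or.inl (Or.inl h)
        · exact Or.inr h

/-- The labels of the Turing machine of `p`. -/
def Label (p : Prog Γ) : Type := {c : List (Prog Γ) // c = [] ∨ c ∈ p.conts []}

open scoped Classical in
/-- The label of a list of programs. -/
noncomputable def label (p : Prog Γ) (c : List (Prog Γ)) : p.Label :=
  -- The default only makes the function total; by `step_mem_conts` a run never needs it.
  if h : c = [] ∨ c ∈ p.conts [] then ⟨c, h⟩ else ⟨[], Or.inl rfl⟩

open Turing.TM2.Stmt in
/-- The statement of the Turing machine of `p` for a list of programs. -/
noncomputable def stmt (p : Prog Γ) :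
    List (Prog Γ) → Turing.TM2.Stmt Γ p.Label (∀ k, Option (Γ k))
  -- The registers are cleared because the final configuration in `Turing.haltList` carries the
  -- initial internal state.
  | [] => load (fun _ _ => none) halt
  | skip :: c => goto fun _ => p.label c
  | push k s :: c => Turing.TM2.Stmt.push k (fun _ => s) (goto fun _ => p.label c)
  | seq q r :: c => goto fun _ => p.label (q :: r :: c)
  | loop k again body :: c => pop k (fun v o => Function.update v k o) (goto fun v =>
      p.label (body (v k) :: (if again (v k) then loop k again body :: c else c)))

/-- The Turing machine of `p`. -/
noncomputable def toFinTM2 [Fintype K] [∀ k, Fintype (Γ k)] (p : Prog Γ) (k₀ k₁ : K) :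
    Turing.FinTM2 where
  K := K
  k₀ := k₀
  k₁ := k₁
  Γ := Γ
  Λ := p.Label
  main := p.label [p]
  ΛFin := by
    classical
    exact (((Set.finite_singleton ([] : List (Prog Γ))).union (finite_conts p [])).subset
      (s := {c | c = [] ∨ c ∈ p.conts []}) fun c hc => hc).fintype
  σ := ∀ k, Option (Γ k)
  initialState := fun _ => none
  m l := p.stmt l.1

/-- One program step is one machine step. The registers merely hand a popped symbol to the following
jump, so their contents are irrelevant and quantified away. -/
theorem step_stmt (p : Prog Γ) {c : List (Prog Γ)} (hc : c = [] ∨ c ∈ p.conts [])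
    {S : Store Γ} {y : List (Prog Γ) × Store Γ} (h : step (c, S) = some y)
    (v : ∀ k, Option (Γ k)) :
    ∃ v', Turing.TM2.step (fun l : p.Label => p.stmt l.1) ⟨some (p.label c), v, S⟩ =
      some ⟨some (p.label y.1), v', y.2⟩ := by
  have hl : (p.label c).1 = c := by simp [label, hc]
  rw [Turing.TM2.step.eq_2, hl]
  match c, h with
  | skip :: c, h => cases h; exact ⟨_, rfl⟩
  | push k s :: c, h => cases h; exact ⟨_, rfl⟩
  | seq q r :: c, h => cases h; exact ⟨_, rfl⟩
  | loop k again body :: c, h =>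
    cases h
    refine ⟨Function.update v k (S k).head?, ?_⟩
    simp [stmt]

theorem runs_stmt (p : Prog Γ) (n : ℕ) : ∀ {c : List (Prog Γ)} (_ : c = [] ∨ c ∈ p.conts [])
    {S S' : Store Γ} (_ : Runs n (c, S) ([], S')) (v : ∀ k, Option (Γ k)),
    ∃ v', (flip bind (Turing.TM2.step (fun l : p.Label => p.stmt l.1)))^[n]
      (some ⟨some (p.label c), v, S⟩) = some ⟨some (p.label []), v', S'⟩ := by
  induction n with
  | zero =>
    intro c hc S S' h v
    cases h
    exact ⟨v, rfl⟩
  | succ n ih =>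
    intro c hc S S' h v
    rw [Runs, Function.iterate_succ_apply] at h
    cases hy : step (c, S) with
    -- A run that has stopped stays at `none`, contrary to the assumption that it reaches a final
    -- store.
    | none =>
      have : flip bind step (some (c, S)) = none := hy
      rw [this] at h
      have hnone : ∀ n, (flip bind (step (Γ := Γ)))^[n] none = none := by
        intro n
        induction n with
        | zero => rfl
        | succ n ih => rw [Function.iterate_succ_apply]; exact ih
      rw [hnone] at h
      cases h
    | some y =>
      have hy' : flip bind step (some (c, S)) = some y := hy
      rw [hy'] at h
      obtain ⟨v', hv'⟩ := step_stmt p hc hy v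
      have hmem : y.1 = [] ∨ y.1 ∈ p.conts [] := by
        rcases hc with rfl | hc
        · cases hy
        · exact (step_mem_conts p [] c hc S y hy).symm
      obtain ⟨v'', hv''⟩ := ih hmem h v'
      refine ⟨v'', ?_⟩
      rw [Function.iterate_succ_apply]
      have : flip bind (Turing.TM2.step (fun l : p.Label => p.stmt l.1))
          (some ⟨some (p.label c), v, S⟩) = some ⟨some (p.label y.1), v', y.2⟩ := hv'
      rw [this, hv'']

/-- The Turing machine of a program takes one step more than the program. -/
theorem Exec.evalsTo [Fintype K] [∀ k, Fintype (Γ k)] {p : Prog Γ} {S S' : Store Γ} {t : ℕ}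
    (h : Exec p S S' t) (k₀ k₁ : K) :
    Nonempty (StateTransition.EvalsToInTime (p.toFinTM2 k₀ k₁).step
      ⟨some (p.label [p]), fun _ => none, S⟩ (some ⟨none, fun _ => none, S'⟩) (t + 1)) := by
  obtain ⟨n, hn, h⟩ := h
  obtain ⟨v', hv'⟩ := runs_stmt p n (Or.inr (cons_mem_conts p [])) (h []) fun _ => none
  refine ⟨⟨⟨n + 1, ?_⟩, Nat.succ_le_succ hn⟩⟩
  rw [Function.iterate_succ_apply']
  refine (congrArg _ hv').trans ?_
  have key : Turing.TM2.step (fun l : p.Label => p.stmt l.1) ⟨some (p.label []), v', S'⟩ =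
      some ⟨none, fun _ => none, S'⟩ := by
    have hl : (p.label []).1 = [] := by simp [label]
    rw [Turing.TM2.step.eq_2, hl]
    rfl
  exact key

end Prog

end Programs

end OntologyFitting

namespace OntologyFitting

/-! ### Binary trees on stacks -/

/-- Binary trees, the data on which the programs below work. -/
inductive Code
  | nil
  | cons (l r : Code)

/-- The word that writes a tree in preorder. -/
def Code.bits : Code → List Bool
  | nil => [false]
  | cons l r => true :: (l.bits ++ r.bits)

/-- The size of a tree. -/
def Code.size (t : Code) : ℕ := t.bits.length

@[simp] theorem Code.size_nil : Code.nil.size = 1 := rfl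

@[simp] theorem Code.size_cons (l r : Code) : (Code.cons l r).size = l.size + r.size + 1 := by
  simp [Code.size, Code.bits]

@[simp] theorem Code.length_bits (t : Code) : t.bits.length = t.size := rfl

theorem Code.size_pos (t : Code) : 1 ≤ t.size := by
  cases t <;> simp

/-- Preorder words are prefix-free. The remainders `u` and `v` let the induction handle the two
children one after the other. -/
theorem Code.eq_of_bits_append : ∀ (s t : Code) (u v : List Bool),
    s.bits ++ u = t.bits ++ v → s = t ∧ u = v
  | nil, nil, u, v, h => ⟨rfl, by simpa [bits] using h⟩
  | nil, cons _ _, u, v, h => by simp [bits] at h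
  | cons _ _, nil, u, v, h => by simp [bits] at h
  | cons a b, cons c d, u, v, h => by
    simp only [bits, List.cons_append, List.cons.injEq, true_and, List.append_assoc] at h
    obtain ⟨rfl, h'⟩ := eq_of_bits_append a c _ _ h
    obtain ⟨rfl, h''⟩ := eq_of_bits_append b d _ _ h'
    exact ⟨rfl, h''⟩

theorem Code.bits_inj {s t : Code} : s.bits = t.bits ↔ s = t :=
  ⟨fun h => (eq_of_bits_append s t [] [] (by simpa using h)).1, fun h => h ▸ rfl⟩

/-- The stacks: the input, three stacks for trees, and the output. -/
inductive Stk
  | inp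
  | main
  | aux
  | cnt
  | out
  deriving DecidableEq

instance : Fintype Stk :=
  ⟨{.inp, .main, .aux, .cnt, .out}, fun k => by cases k <;> decide⟩

/-- The alphabets of the stacks. On the inner stacks `none` is a bottom marker. -/
def Stk.Γ : Stk → Type
  | inp => Symbol
  | main => Option Bool
  | aux => Option Bool
  | cnt => Option Bool
  | out => Bool

instance (k : Stk) : Fintype k.Γ := by
  cases k <;> (unfold Stk.Γ; infer_instance)

/-- The programs over these stacks. -/
abbrev TProg := Prog Stk.Γ

/-- The contents of the stacks. -/
def store (i : List Symbol) (m a b : List (Option Bool)) (o : List Bool) : Prog.Store Stk.Γ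
  | .inp => i
  | .main => m
  | .aux => a
  | .cnt => b
  | .out => o

section Store

variable {i i' : List Symbol} {m m' a a' b b' : List (Option Bool)} {o o' : List Bool}

theorem update_inp : Function.update (store i m a b o) .inp i' = store i' m a b o := by
  funext k; cases k <;> rfl
theorem update_main : Function.update (store i m a b o) .main m' = store i m' a b o := by
  funext k; cases k <;> rfl
theorem update_aux : Function.update (store i m a b o) .aux a' = store i m a' b o := by
  funext k; cases k <;> rfl
theorem update_cnt : Function.update (store i m a b o) .cnt b' = store i m a b' o := by
  funext k; cases k <;> rfl
theorem update_out : Function.update (store i m a b o) .out o' = store i m a b o' := by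
  funext k; cases k <;> rfl

namespace TProg

open Prog

/-- Push on the main stack. -/
abbrev pushMain (x : Option Bool) : TProg := .push .main x
/-- Push on the auxiliary stack. -/
abbrev pushAux (x : Option Bool) : TProg := .push .aux x
/-- Push on the counter stack. -/
abbrev pushCnt (x : Option Bool) : TProg := .push .cnt x
/-- Push on the output stack. -/
abbrev pushOut (x : Bool) : TProg := .push .out x

theorem exec_pushMain (x : Option Bool) :
    Exec (pushMain x) (store i m a b o) (store i (x :: m) a b o) 1 := by
  exact exec_push (Γ := Stk.Γ) update_main
theorem exec_pushAux (x : Option Bool) :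
    Exec (pushAux x) (store i m a b o) (store i m (x :: a) b o) 1 := by
  exact exec_push (Γ := Stk.Γ) update_aux
theorem exec_pushCnt (x : Option Bool) :
    Exec (pushCnt x) (store i m a b o) (store i m a (x :: b) o) 1 := by
  exact exec_push (Γ := Stk.Γ) update_cnt
theorem exec_pushOut (x : Bool) :
    Exec (pushOut x) (store i m a b o) (store i m a b (x :: o)) 1 := by
  exact exec_push (Γ := Stk.Γ) update_out

variable {again : Option (Option Bool) → Bool} {body : Option (Option Bool) → TProg}
  {S S' : Prog.Store Stk.Γ} {t t' : ℕ} {x : Option Bool}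

theorem loop_main_exit (ha : again (some x) = false)
    (h : Exec (body (some x)) (store i m a b o) S t) :
    Exec (.loop .main again body : TProg) (store i (x :: m) a b o) S (1 + t) :=
  Exec.loop_exit (k := Stk.main) rfl update_main ha h
theorem loop_main_again (ha : again (some x) = true)
    (h : Exec (body (some x)) (store i m a b o) S t)
    (h' : Exec (.loop .main again body : TProg) S S' t') :
    Exec (.loop .main again body : TProg) (store i (x :: m) a b o) S' (1 + t + t') :=
  Exec.loop_again (k := Stk.main) rfl update_main ha h h'
theorem loop_aux_exit (ha : again (some x) = false)
    (h : Exec (body (some x)) (store i m a b o) S t) :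
    Exec (.loop .aux again body : TProg) (store i m (x :: a) b o) S (1 + t) :=
  Exec.loop_exit (k := Stk.aux) rfl update_aux ha h
theorem loop_aux_again (ha : again (some x) = true)
    (h : Exec (body (some x)) (store i m a b o) S t)
    (h' : Exec (.loop .aux again body : TProg) S S' t') :
    Exec (.loop .aux again body : TProg) (store i m (x :: a) b o) S' (1 + t + t') :=
  Exec.loop_again (k := Stk.aux) rfl update_aux ha h h'
theorem loop_cnt_exit (ha : again (some x) = false)
    (h : Exec (body (some x)) (store i m a b o) S t) :
    Exec (.loop .cnt again body : TProg) (store i m a (x :: b) o) S (1 + t) :=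
  Exec.loop_exit (k := Stk.cnt) rfl update_cnt ha h
theorem loop_cnt_again (ha : again (some x) = true)
    (h : Exec (body (some x)) (store i m a b o) S t)
    (h' : Exec (.loop .cnt again body : TProg) S S' t') :
    Exec (.loop .cnt again body : TProg) (store i m a (x :: b) o) S' (1 + t + t') :=
  Exec.loop_again (k := Stk.cnt) rfl update_cnt ha h h'

/-- The symbol is not the marker. -/
def isBit : Option (Option Bool) → Bool
  | some (some _) => true
  | _ => false

/-- Run `g x` for a bit `x`, and `d` for a marker. -/
def onBit (g : Bool → TProg) (d : TProg) : Option (Option Bool) → TProg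
  | some (some x) => g x
  | _ => d

/-- Pop the bits above the marker from the auxiliary stack, and run `g` on each. -/
def drainAux (g : Bool → TProg) : TProg := .loop .aux isBit (onBit g .skip)

/-- Pop the bits above the marker from the counter stack, and run `g` on each. -/
def drainCnt (g : Bool → TProg) : TProg := .loop .cnt isBit (onBit g .skip)

/-- Pop a bit `x` from the main stack and run `g x`. -/
def popMain (g : Bool → TProg) : TProg := .loop .main (fun _ => false) (onBit g .skip)

/-- Pop from the counter stack and run `g x` for a bit `x`, and `d` for a marker. -/
def popCnt (g : Bool → TProg) (d : TProg) : TProg := .loop .cnt (fun _ => false) (onBit g d)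

section

variable {g : Bool → TProg} {d : TProg} {x : Bool}

theorem drainAux_exit : Exec (drainAux g) (store i m (none :: a) b o) (store i m a b o) 2 :=
  loop_aux_exit (x := none) (again := isBit) (body := onBit g .skip) rfl (exec_skip _)

theorem drainAux_again (h : Exec (g x) (store i m a b o) S t) (h' : Exec (drainAux g) S S' t') :
    Exec (drainAux g) (store i m (some x :: a) b o) S' (1 + t + t') :=
  loop_aux_again (again := isBit) (body := onBit g .skip) rfl h h'

theorem drainCnt_exit : Exec (drainCnt g) (store i m a (none :: b) o) (store i m a b o) 2 :=
  loop_cnt_exit (x := none) (again := isBit) (body := onBit g .skip) rfl (exec_skip _)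

theorem drainCnt_again (h : Exec (g x) (store i m a b o) S t) (h' : Exec (drainCnt g) S S' t') :
    Exec (drainCnt g) (store i m a (some x :: b) o) S' (1 + t + t') :=
  loop_cnt_again (again := isBit) (body := onBit g .skip) rfl h h'

theorem exec_popMain (h : Exec (g x) (store i m a b o) S t) :
    Exec (popMain g) (store i (some x :: m) a b o) S (1 + t) :=
  loop_main_exit (again := fun _ => false) (body := onBit g .skip) rfl h

theorem exec_popCnt_bit (h : Exec (g x) (store i m a b o) S t) :
    Exec (popCnt g d) (store i m a (some x :: b) o) S (1 + t) :=
  loop_cnt_exit (again := fun _ => false) (body := onBit g d) rfl h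

theorem exec_popCnt_mark (h : Exec d (store i m a b o) S t) :
    Exec (popCnt g d) (store i m a (none :: b) o) S (1 + t) :=
  loop_cnt_exit (again := fun _ => false) (body := onBit g d) rfl h

end

theorem exec_drainAux_main (l : List Bool) : ∀ m,
    Exec (drainAux fun x => pushMain (some x)) (store i m (l.map some ++ none :: a) b o)
      (store i (l.reverse.map some ++ m) a b o) (2 * l.length + 2) := by
  induction l with
  | nil => exact fun m => drainAux_exit
  | cons x l ih =>
    intro m
    refine Exec.mono ?_ (show 1 + 1 + (2 * l.length + 2) ≤ _ by simp; omega)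
    have := ih (some x :: m)
    exact drainAux_again (exec_pushMain (some x)) (by simpa using this)

theorem exec_drainAux_cnt (l : List Bool) : ∀ b,
    Exec (drainAux fun x => pushCnt (some x)) (store i m (l.map some ++ none :: a) b o)
      (store i m a (l.reverse.map some ++ b) o) (2 * l.length + 2) := by
  induction l with
  | nil => exact fun m => drainAux_exit
  | cons x l ih =>
    intro b
    refine Exec.mono ?_ (show 1 + 1 + (2 * l.length + 2) ≤ _ by simp; omega)
    have := ih (some x :: b)
    exact drainAux_again (exec_pushCnt (some x)) (by simpa using this)

theorem exec_drainAux_main_cnt (l : List Bool) : ∀ m b,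
    Exec (drainAux fun x => (pushMain (some x)).seq (pushCnt (some x)))
      (store i m (l.map some ++ none :: a) b o)
      (store i (l.reverse.map some ++ m) a (l.reverse.map some ++ b) o) (4 * l.length + 2) := by
  induction l with
  | nil => exact fun m b => drainAux_exit
  | cons x l ih =>
    intro m b
    refine Exec.mono ?_ (show 1 + (1 + 1 + 1) + (4 * l.length + 2) ≤ _ by simp; omega)
    have := ih (some x :: m) (some x :: b)
    exact drainAux_again ((exec_pushMain (some x)).seq (exec_pushCnt (some x)))
      (by simpa using this)

theorem exec_drainAux_skip (l : List Bool) :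
    Exec (drainAux fun _ => .skip) (store i m (l.map some ++ none :: a) b o)
      (store i m a b o) (2 * l.length + 2) := by
  induction l with
  | nil => exact drainAux_exit
  | cons x l ih =>
    refine Exec.mono ?_ (show 1 + 1 + (2 * l.length + 2) ≤ _ by simp; omega)
    exact drainAux_again (exec_skip _) ih

theorem exec_drainCnt_aux (l : List Bool) : ∀ a,
    Exec (drainCnt fun x => pushAux (some x)) (store i m a (l.map some ++ none :: b) o)
      (store i m (l.reverse.map some ++ a) b o) (2 * l.length + 2) := by
  induction l with
  | nil => exact fun m => drainCnt_exit
  | cons x l ih =>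
    intro a
    refine Exec.mono ?_ (show 1 + 1 + (2 * l.length + 2) ≤ _ by simp; omega)
    have := ih (some x :: a)
    exact drainCnt_again (exec_pushAux (some x)) (by simpa using this)

theorem exec_drainCnt_skip (l : List Bool) :
    Exec (drainCnt fun _ => .skip) (store i m a (l.map some ++ none :: b) o)
      (store i m a b o) (2 * l.length + 2) := by
  induction l with
  | nil => exact drainCnt_exit
  | cons x l ih =>
    refine Exec.mono ?_ (show 1 + 1 + (2 * l.length + 2) ≤ _ by simp; omega)
    exact drainCnt_again (exec_skip _) ih

/-- Move as many trees as there are bits on the counter stack from the main stack to the auxiliary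
stack. -/
def hideLoop : TProg := drainCnt fun _ => popMain fun x =>
  bif x then (pushAux (some true)).seq ((pushCnt (some true)).seq (pushCnt (some true)))
  else pushAux (some false)

/-- The counter stack holds one bit per tree still to be moved: a node replaces one by two, a leaf
removes one. The claim is relative to the rest of the run, so the induction hypotheses for the two
children can be chained. Eight steps per symbol suffice. -/
theorem exec_hideLoop (s : Code) : ∀ {m a b : List (Option Bool)} {t : ℕ},
    Exec hideLoop (store i m (s.bits.reverse.map some ++ a) b o) S t →
    Exec hideLoop (store i (s.bits.map some ++ m) a (some true :: b) o) S (8 * s.size + t) := by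
  induction s with
  | nil =>
    intro m a b t h
    refine Exec.mono ?_ (show 1 + (1 + 1) + t ≤ _ by simp)
    exact drainCnt_again (exec_popMain (exec_pushAux (some false))) h
  | cons l r hl hr =>
    intro m a b t h
    have h1 : Exec hideLoop (store i (r.bits.map some ++ m)
        (l.bits.reverse.map some ++ (some true :: a)) (some true :: b) o) S (8 * r.size + t) := by
      refine hr ?_
      simpa [Code.bits] using h
    have h2 : Exec hideLoop (store i ((l.bits ++ r.bits).map some ++ m) (some true :: a)
        (some true :: some true :: b) o) S (8 * l.size + (8 * r.size + t)) := by
      simpa using hl h1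
    refine Exec.mono ?_ (show 1 + (1 + (1 + 1 + (1 + 1 + 1))) +
      (8 * l.size + (8 * r.size + t)) ≤ _ by simp; omega)
    refine drainCnt_again (exec_popMain ((exec_pushAux (some true)).seq
      ((exec_pushCnt (some true)).seq (exec_pushCnt (some true))))) h2

/-- Move a tree from the main stack to the auxiliary stack. -/
def hide : TProg := ((pushCnt none).seq (pushCnt (some true))).seq ((pushAux none).seq hideLoop)

theorem exec_hide (s : Code) :
    Exec hide (store i (s.bits.map some ++ m) a b o)
      (store i m (s.bits.reverse.map some ++ none :: a) b o) (8 * s.size + 10) := by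
  have hexit : Exec hideLoop (store i m (s.bits.reverse.map some ++ none :: a) (none :: b) o)
      (store i m (s.bits.reverse.map some ++ none :: a) b o) (1 + 1) :=
    drainCnt_exit
  exact (((exec_pushCnt none).seq (exec_pushCnt (some true))).seq
    ((exec_pushAux none).seq (exec_hideLoop s hexit))).mono (by omega)

/-- Move a tree back from the auxiliary stack to the main stack. -/
def unhide : TProg := drainAux fun x => pushMain (some x)

theorem exec_unhide (s : Code) :
    Exec unhide (store i m (s.bits.reverse.map some ++ none :: a) b o)
      (store i (s.bits.map some ++ m) a b o) (2 * s.size + 2) := by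
  have := exec_drainAux_main (i := i) (o := o) (a := a) (b := b) s.bits.reverse m
  rwa [List.reverse_reverse, List.length_reverse] at this

/-- Remove a tree. -/
def drop : TProg := hide.seq (drainAux fun _ => .skip)

theorem exec_drop (s : Code) :
    Exec drop (store i (s.bits.map some ++ m) a b o) (store i m a b o) (10 * s.size + 13) :=
  ((exec_hide s).seq (exec_drainAux_skip s.bits.reverse)).mono (by simp; omega)

/-- Duplicate a tree. -/
def dup : TProg :=
  -- Draining the hidden word restores the tree on the main stack and puts a copy on the counter
  -- stack. Two more transfers bring this copy to the main stack in the right order.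
  (hide.seq ((pushCnt none).seq (drainAux fun x => (pushMain (some x)).seq (pushCnt (some x))))).seq
    ((pushAux none).seq ((drainCnt fun x => pushAux (some x)).seq unhide))

theorem exec_dup (s : Code) :
    Exec dup (store i (s.bits.map some ++ m) a b o)
      (store i (s.bits.map some ++ (s.bits.map some ++ m)) a b o) (16 * s.size + 25) := by
  have h1 := exec_drainAux_main_cnt (i := i) (a := a) (o := o) s.bits.reverse m (none :: b)
  rw [List.reverse_reverse] at h1
  exact (((exec_hide s).seq ((exec_pushCnt none).seq h1)).seq
    ((exec_pushAux none).seq ((exec_drainCnt_aux s.bits _).seq (exec_unhide s)))).mono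
    (by simp; omega)

/-- Push a word on the main stack. -/
def pushList : List Bool → TProg
  | [] => .skip
  | x :: l => (pushList l).seq (pushMain (some x))

theorem exec_pushList (l : List Bool) :
    Exec (pushList l) (store i m a b o) (store i (l.map some ++ m) a b o) (2 * l.length + 1) := by
  induction l with
  | nil => exact exec_skip _
  | cons x l ih => exact (ih.seq (exec_pushMain (some x))).mono (by simp; omega)

/-- Replace the bit on top of the auxiliary stack by `false`. -/
def clearFlag : TProg := .loop .aux (fun _ => false) fun _ => pushAux (some false)

theorem exec_clearFlag {f : Bool} :
    Exec clearFlag (store i m (some f :: a) b o) (store i m (some false :: a) b o) 2 :=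
  loop_aux_exit (again := fun _ => false) (body := fun _ => pushAux (some false)) rfl
    (exec_pushAux _)

/-- Compare the words above the markers on the main stack and the counter stack, and clear the flag
on the auxiliary stack if they differ. -/
def compareLoop : TProg := .loop .main isBit <| onBit
  -- If the second word ends first, its marker is put back, so that the remaining symbols of the
  -- first word are consumed in the same way.
  (fun x => popCnt (fun y => bif x == y then .skip else clearFlag) ((pushCnt none).seq clearFlag))
  (popCnt (fun _ => (drainCnt fun _ => .skip).seq clearFlag) .skip)

theorem compareLoop_exit (h : Exec (popCnt (fun _ => (drainCnt fun _ => .skip).seq clearFlag) .skip)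
    (store i m a b o) S t) : Exec compareLoop (store i (none :: m) a b o) S (1 + t) :=
  loop_main_exit (x := none) (again := isBit) (body := onBit _ _) rfl h

theorem compareLoop_again {x : Bool}
    (h : Exec (popCnt (fun y => bif x == y then .skip else clearFlag) ((pushCnt none).seq clearFlag))
      (store i m a b o) S t) (h' : Exec compareLoop S S' t') :
    Exec compareLoop (store i (some x :: m) a b o) S' (1 + t + t') :=
  loop_main_again (x := some x) (again := isBit) (body := onBit _ _) rfl h h'

/-- The flag is arbitrary so that the induction also covers the run after a mismatch; both words are
consumed in any case. -/
theorem exec_compareLoop (u : List Bool) : ∀ (v : List Bool) (f : Bool),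
    Exec compareLoop (store i (u.map some ++ none :: m) (some f :: a) (v.map some ++ none :: b) o)
      (store i m (some (f && (u == v)) :: a) b o) (6 * u.length + 2 * v.length + 6) := by
  induction u with
  | nil =>
    rintro (_ | ⟨y, v⟩) f
    · refine Exec.mono (compareLoop_exit (exec_popCnt_mark (t := 1) ?_))
        (show 1 + (1 + 1) ≤ _ by simp)
      simpa using exec_skip _
    · refine Exec.mono (compareLoop_exit (exec_popCnt_bit (t := 1 + (2 * v.length + 2) + 2) ?_))
        (show 1 + (1 + (1 + (2 * v.length + 2) + 2)) ≤ _ by simp; omega)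
      simpa using (exec_drainCnt_skip v).seq exec_clearFlag
  | cons x u ih =>
    rintro (_ | ⟨y, v⟩) f
    · refine Exec.mono (compareLoop_again (exec_popCnt_mark
        ((exec_pushCnt none).seq exec_clearFlag)) (t' := 6 * u.length + 2 * 0 + 6) ?_)
        (show 1 + (1 + (1 + 1 + 2)) + (6 * u.length + 2 * 0 + 6) ≤ _ by simp; omega)
      simpa using ih [] false
    · by_cases hxy : x = y
      · subst hxy
        refine Exec.mono (compareLoop_again (exec_popCnt_bit (t := 1)
          (S := store i (u.map some ++ none :: m) (some f :: a) (v.map some ++ none :: b) o) ?_)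
          (t' := 6 * u.length + 2 * v.length + 6) ?_)
          (show 1 + (1 + 1) + (6 * u.length + 2 * v.length + 6) ≤ _ by simp; omega)
        · simpa using exec_skip _
        · simpa using ih v f
      · refine Exec.mono (compareLoop_again (exec_popCnt_bit (t := 2)
          (S := store i (u.map some ++ none :: m) (some false :: a) (v.map some ++ none :: b) o) ?_)
          (t' := 6 * u.length + 2 * v.length + 6) ?_)
          (show 1 + (1 + 2) + (6 * u.length + 2 * v.length + 6) ≤ _ by simp; omega)
        · have : (x == y) = false := by simpa using hxy
          rw [this]
          exact exec_clearFlag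
        · have : (x :: u == y :: v) = false := beq_eq_false_iff_ne.2 (by simp [hxy])
          rw [this]
          simpa using ih v false

end TProg

end Store

end OntologyFitting

namespace OntologyFitting

/-! ### Encodings -/

/-- An encoding of a type by trees. -/
class Enc (α : Type) where
  enc : α → Code
  inj : Function.Injective enc

/-- The size of the encoding. -/
def encSize {α : Type} [Enc α] (x : α) : ℕ := (Enc.enc x).size

theorem encSize_pos {α : Type} [Enc α] (x : α) : 1 ≤ encSize x := (Enc.enc x).size_pos

/-- The encoding as the contents of a stack. -/
def word {α : Type} [Enc α] (x : α) : List (Option Bool) := (Enc.enc x).bits.map some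

section Encodings

variable {α β : Type} [Enc α] [Enc β]

instance : Enc Bool where
  enc b := bif b then .cons .nil .nil else .nil
  inj := by rintro (_ | _) (_ | _) h <;> simp at h ⊢

instance : Enc (α × β) where
  enc x := .cons (Enc.enc x.1) (Enc.enc x.2)
  inj := by
    rintro ⟨a, b⟩ ⟨c, d⟩ h
    simp only [Code.cons.injEq] at h
    rw [Enc.inj h.1, Enc.inj h.2]

/-- The encoding of lists. -/
def encList : List α → Code
  | [] => .nil
  | a :: l => .cons (Enc.enc a) (encList l)

instance : Enc (List α) where
  enc := encList
  inj := by
    intro l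
    induction l with
    | nil => rintro (_ | ⟨b, m⟩) h <;> simp [encList] at h ⊢
    | cons a l ih =>
      rintro (_ | ⟨b, m⟩) h
      · simp [encList] at h
      · simp only [encList, Code.cons.injEq] at h
        rw [Enc.inj h.1, ih h.2]

/-- The codes are those of the pairs `(false, a)` and `(true, b)`, just as a nonempty list has the
code of the pair of its head and tail. Such constructors therefore need no computation beyond
pairing. -/
instance : Enc (α ⊕ β) where
  enc
    | .inl a => .cons .nil (Enc.enc a)
    | .inr b => .cons (.cons .nil .nil) (Enc.enc b)
  inj := by
    rintro (a | a) (b | b) h <;> simp at h ⊢ <;> exact Enc.inj h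

/-- The encoding of natural numbers in unary. -/
def encNat : ℕ → Code
  | 0 => .nil
  | n + 1 => .cons .nil (encNat n)

theorem encNat_injective : Function.Injective encNat := by
  intro m
  induction m with
  | zero => rintro (_ | n) h <;> simp [encNat] at h ⊢
  | succ m ih =>
    rintro (_ | n) h
    · simp [encNat] at h
    · simp only [encNat, Code.cons.injEq, true_and] at h
      rw [ih h]

/-- A number for each symbol. -/
def symbolIndex : Symbol → ℕ
  | .bit false => 0
  | .bit true => 1
  | .delim => 2
  | .conc => 3
  | .role => 4
  | .query => 5
  | .pos => 6
  | .neg => 7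

instance : Enc Symbol where
  enc s := encNat (symbolIndex s)
  inj := encNat_injective.comp <| by
    rintro ((_ | _) | _ | _ | _ | _ | _ | _) ((_ | _) | _ | _ | _ | _ | _ | _) h <;>
      simp [symbolIndex] at h ⊢

/-- Assertions as a sum type. -/
def assertionSum {N : Type} : Assertion N → (ConceptName × N) ⊕ (RoleName × N × N)
  | .conc P a => .inl (P, a)
  | .role r a b => .inr (r, a, b)

instance : Enc (Assertion α) where
  enc x := Enc.enc (assertionSum x)
  inj := Enc.inj.comp <| by
    rintro (⟨P, a⟩ | ⟨r, a, b⟩) (⟨P', a'⟩ | ⟨r', a', b'⟩) h <;> simp [assertionSum] at h ⊢ <;>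
      assumption

theorem encSize_prod (x : α × β) : encSize x = encSize x.1 + encSize x.2 + 1 := Code.size_cons _ _

theorem encSize_nil : encSize ([] : List α) = 1 := rfl

theorem encSize_cons (a : α) (l : List α) : encSize (a :: l) = encSize a + encSize l + 1 :=
  Code.size_cons _ _

theorem encSize_bool_le (b : Bool) : encSize b ≤ 3 := by
  cases b <;> decide

theorem length_le_encSize (l : List α) : l.length ≤ encSize l := by
  induction l with
  | nil => simp
  | cons a l ih =>
    rw [encSize_cons, List.length_cons]
    omega

end Encodings

section Words

variable {α β : Type} [Enc α] [Enc β]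

theorem word_pair (x : α) (y : β) (m : List (Option Bool)) :
    word (x, y) ++ m = some true :: (word x ++ (word y ++ m)) := by
  simp [word, Enc.enc, Code.bits]

theorem word_nil (m : List (Option Bool)) : word ([] : List α) ++ m = some false :: m := rfl

theorem word_cons (x : α) (l : List α) (m : List (Option Bool)) :
    word (x :: l) ++ m = some true :: (word x ++ (word l ++ m)) := by
  simp [word, Enc.enc, Code.bits, encList]

theorem word_inl (x : α) (m : List (Option Bool)) :
    word (Sum.inl x : α ⊕ β) ++ m = some true :: some false :: (word x ++ m) := by
  simp [word, Enc.enc, Code.bits]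

theorem word_inr (y : β) (m : List (Option Bool)) :
    word (Sum.inr y : α ⊕ β) ++ m =
      some true :: some true :: some false :: some false :: (word y ++ m) := by
  simp [word, Enc.enc, Code.bits]

theorem word_false (m : List (Option Bool)) : word false ++ m = some false :: m := rfl

theorem word_true (m : List (Option Bool)) :
    word true ++ m = some true :: some false :: some false :: m := rfl

end Words

/-! ### Functions computable in polynomial time -/

theorem eval_le_eval_nat (p : Polynomial ℕ) {m n : ℕ} (h : m ≤ n) : p.eval m ≤ p.eval n := by
  rw [Polynomial.eval_eq_sum, Polynomial.eval_eq_sum]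
  exact Finset.sum_le_sum fun i _ => Nat.mul_le_mul_left _ (Nat.pow_le_pow_left h i)

open Prog TProg Polynomial

section

variable {α β γ δ σ : Type} [Enc α] [Enc β] [Enc γ] [Enc δ] [Enc σ]

/-- The program `p` computes `f` within time and size `P`: it replaces `x` by `f x` on top of the
main stack. -/
def Computes (p : TProg) (f : α → β) (P : Polynomial ℕ) : Prop :=
  ∀ x, encSize (f x) ≤ P.eval (encSize x) ∧ ∀ i m a b o,
    Exec p (store i (word x ++ m) a b o) (store i (word (f x) ++ m) a b o) (P.eval (encSize x))

/-- Some program computes `f` in polynomial time. -/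
def PolyFn (f : α → β) : Prop := ∃ p P, Computes p f P

theorem PolyFn.of_eq {f g : α → β} (hf : PolyFn f) (h : ∀ x, g x = f x) : PolyFn g :=
  (funext h : g = f) ▸ hf

namespace PolyFn

/-- A function that does not change the encoding. -/
theorem of_enc_eq {f : α → β} (h : ∀ x, Enc.enc (f x) = Enc.enc x) : PolyFn f := by
  refine ⟨.skip, X + 1, fun x => ⟨?_, fun i m a b o => ?_⟩⟩
  · simp [encSize, h]
  · rw [word, word, h]
    exact (exec_skip _).mono (by simp)

/-- Programs see codes only, so constructors whose codes are those of tuples inherit a program from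
the tuple. -/
theorem congr_enc {f : α → β} {g : α → γ} (hg : PolyFn g)
    (h : ∀ x, Enc.enc (f x) = Enc.enc (g x)) : PolyFn f := by
  obtain ⟨p, P, hp⟩ := hg
  refine ⟨p, P, fun x => ?_⟩
  have h1 : encSize (f x) = encSize (g x) := congrArg Code.size (h x)
  have h2 : word (f x) = word (g x) := congrArg (fun c => c.bits.map some) (h x)
  rw [h1, h2]
  exact hp x

theorem id : PolyFn fun x : α => x := of_enc_eq fun _ => rfl

/-- The size bound in `Computes` is needed here: it bounds the time that the second program spends
on the output of the first. -/
theorem comp {g : β → γ} {f : α → β} (hg : PolyFn g) (hf : PolyFn f) :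
    PolyFn fun x => g (f x) := by
  obtain ⟨p, P, hp⟩ := hf
  obtain ⟨q, Q, hq⟩ := hg
  refine ⟨p.seq q, 1 + P + Q.comp P, fun x => ⟨?_, fun i m a b o => ?_⟩⟩
  · have := (hq (f x)).1.trans (eval_le_eval_nat Q (hp x).1)
    simp only [eval_add, eval_comp, eval_one]
    omega
  · refine (((hp x).2 i m a b o).seq ((hq (f x)).2 i m a b o)).mono ?_
    have := eval_le_eval_nat Q (hp x).1
    simp only [eval_add, eval_comp, eval_one]
    omega

/-- One copy of the input is kept below the other. The value of `f` is hidden on the auxiliary stack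
while `g` runs on the kept copy. -/
theorem pair {f : α → β} {g : α → γ} (hf : PolyFn f) (hg : PolyFn g) :
    PolyFn fun x => (f x, g x) := by
  obtain ⟨p, P, hp⟩ := hf
  obtain ⟨q, Q, hq⟩ := hg
  refine ⟨((dup.seq p).seq (hide.seq q)).seq (unhide.seq (pushMain (some true))),
    16 * X + 11 * P + Q + 60, fun x => ⟨?_, fun i m a b o => ?_⟩⟩
  · have h1 := (hp x).1
    have h2 := (hq x).1
    simp only [encSize_prod, eval_add, eval_mul, eval_X, eval_ofNat]
    omega
  · rw [word_pair]
    have h3 : Exec hide (store i (word (f x) ++ (word x ++ m)) a b o) _ _ := exec_hide (Enc.enc (f x))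
    have h4 : Exec unhide _ (store i (word (f x) ++ (word (g x) ++ m)) a b o) _ :=
      exec_unhide (Enc.enc (f x))
    have h5 : Exec dup (store i (word x ++ m) a b o) (store i (word x ++ (word x ++ m)) a b o) _ :=
      exec_dup (Enc.enc x)
    refine (((h5.seq ((hp x).2 _ _ _ _ _)).seq (h3.seq ((hq x).2 _ _ _ _ _))).seq
        (h4.seq (exec_pushMain (some true)))).mono ?_
    have h1 := (hp x).1
    simp only [encSize] at *
    simp only [eval_add, eval_mul, eval_X, eval_ofNat]
    omega

/-- The program that drops the top tree and pushes a constant. -/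
theorem const (c : β) : PolyFn fun _ : α => c := by
  refine ⟨drop.seq (pushList (Enc.enc c).bits), 10 * X + 20 + 2 * C (encSize c),
    fun x => ⟨?_, fun i m a b o => ?_⟩⟩
  · simp only [eval_add, eval_mul, eval_X, eval_ofNat, eval_C]
    omega
  · refine ((exec_drop (Enc.enc x)).seq (exec_pushList (Enc.enc c).bits)).mono ?_
    simp only [eval_add, eval_mul, eval_X, eval_ofNat, eval_C, encSize, Code.length_bits]
    omega

theorem prod_fst : PolyFn fun x : α × β => x.1 := by
  refine ⟨popMain fun _ => hide.seq (drop.seq unhide), 20 * X + 40,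
    fun x => ⟨?_, fun i m a b o => ?_⟩⟩
  · simp only [eval_add, eval_mul, eval_X, eval_ofNat, encSize_prod]
    omega
  · obtain ⟨x, y⟩ := x
    rw [word_pair]
    refine (exec_popMain ((exec_hide (Enc.enc x)).seq ((exec_drop (Enc.enc y)).seq
      (exec_unhide (Enc.enc x))))).mono ?_
    simp only [encSize_prod]
    simp only [eval_add, eval_mul, eval_X, eval_ofNat, encSize]
    omega

theorem prod_snd : PolyFn fun x : α × β => x.2 := by
  refine ⟨popMain fun _ => drop, 20 * X + 40, fun x => ⟨?_, fun i m a b o => ?_⟩⟩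
  · simp only [eval_add, eval_mul, eval_X, eval_ofNat, encSize_prod]
    omega
  · obtain ⟨x, y⟩ := x
    rw [word_pair]
    refine (exec_popMain (exec_drop (Enc.enc x))).mono ?_
    simp only [encSize_prod]
    simp only [eval_add, eval_mul, eval_X, eval_ofNat, encSize]
    omega

theorem fst {f : α → β × γ} (hf : PolyFn f) : PolyFn fun x => (f x).1 := prod_fst.comp hf

theorem snd {f : α → β × γ} (hf : PolyFn f) : PolyFn fun x => (f x).2 := prod_snd.comp hf

theorem cond {c : α → Bool} {f g : α → β} (hc : PolyFn c) (hf : PolyFn f) (hg : PolyFn g) :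
    PolyFn fun x => bif c x then f x else g x := by
  obtain ⟨r, R, hr⟩ := hc
  obtain ⟨p, P, hp⟩ := hf
  obtain ⟨q, Q, hq⟩ := hg
  refine ⟨(dup.seq r).seq (popMain fun y =>
      -- The code of `true` has three symbols, so two remain after its first one.
      bif y then (popMain fun _ => popMain fun _ => p) else q), 16 * X + 40 + R + P + Q,
    fun x => ⟨?_, fun i m a b o => ?_⟩⟩
  · have h1 := (hp x).1
    have h2 := (hq x).1
    simp only [eval_add, eval_mul, eval_X, eval_ofNat]
    cases c x <;> simp only [cond_true, cond_false] <;> omega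
  · have h1 : Exec dup (store i (word x ++ m) a b o) (store i (word x ++ (word x ++ m)) a b o) _ :=
      exec_dup (Enc.enc x)
    have h2 := h1.seq ((hr x).2 _ _ _ _ _)
    simp only [eval_add, eval_mul, eval_X, eval_ofNat]
    cases hx : c x with
    | false =>
      rw [hx, word_false] at h2
      refine (h2.seq (exec_popMain (x := false) ((hq x).2 _ _ _ _ _))).mono ?_
      simp only [encSize]
      omega
    | true =>
      rw [hx, word_true] at h2
      refine (h2.seq (exec_popMain (x := true) (exec_popMain (x := false) (exec_popMain (x := false)
        ((hp x).2 _ _ _ _ _))))).mono ?_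
      simp only [encSize]
      omega

/-- The first symbol of the code tells whether the list is empty. Otherwise the head, the tail and
the saved input lie on the stack in this order, and two symbols `true` in front make them the code
of `((y, t), x)`. -/
theorem listCases {l : α → List β} {f : α → γ} {g : (β × List β) × α → γ} (hl : PolyFn l)
    (hf : PolyFn f) (hg : PolyFn g) :
    PolyFn fun x => match l x with
      | [] => f x
      | y :: t => g ((y, t), x) := by
  obtain ⟨r, R, hr⟩ := hl
  obtain ⟨p, P, hp⟩ := hf
  obtain ⟨q, Q, hq⟩ := hg
  refine ⟨(dup.seq r).seq (popMain fun y =>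
      bif y then (pushMain (some true)).seq ((pushMain (some true)).seq q) else p),
      16 * X + 40 + R + P + Q.comp (R + X + 1), fun x => ?_⟩
  have h1 : ∀ i m a b o, Exec dup (store i (word x ++ m) a b o)
    (store i (word x ++ (word x ++ m)) a b o) _ := fun i m a b o => exec_dup (Enc.enc x)
  have h2 := fun i m a b o => (h1 i m a b o).seq ((hr x).2 _ _ _ _ _)
  have h3 := (hr x).1
  have h4 := (hp x).1
  simp only [eval_add, eval_mul, eval_X, eval_ofNat, eval_comp, eval_one]
  cases hx : l x with
  | nil =>
    refine ⟨by simp only; omega, fun i m a b o => ?_⟩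
    have h2 := h2 i m a b o
    rw [hx, word_nil] at h2
    refine (h2.seq (exec_popMain (x := false) ((hp x).2 _ _ _ _ _))).mono ?_
    simp only [encSize]
    omega
  | cons y t =>
    have h6 : encSize ((y, t), x) ≤ R.eval (encSize x) + encSize x + 1 := by
      rw [hx, encSize_cons] at h3
      simp only [encSize_prod]
      omega
    have h5 := eval_le_eval_nat Q h6
    refine ⟨by have := (hq ((y, t), x)).1; simp only; omega, fun i m a b o => ?_⟩
    have h2 := h2 i m a b o
    have h7 := (hq ((y, t), x)).2 i m a b o
    rw [hx, word_cons] at h2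
    rw [word_pair, word_pair] at h7
    refine (h2.seq (exec_popMain (x := true) ((exec_pushMain _).seq
      ((exec_pushMain _).seq h7)))).mono ?_
    simp only [encSize] at *
    omega

theorem sumCases {s : α → β ⊕ γ} {f : β × α → δ} {g : γ × α → δ} (hs : PolyFn s)
    (hf : PolyFn f) (hg : PolyFn g) :
    PolyFn fun x => match s x with
      | .inl y => f (y, x)
      | .inr y => g (y, x) := by
  obtain ⟨r, R, hr⟩ := hs
  obtain ⟨p, P, hp⟩ := hf
  obtain ⟨q, Q, hq⟩ := hg
  refine ⟨(dup.seq r).seq (popMain fun _ => popMain fun y =>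
      -- A right summand has a tag of three symbols, of which two are left. The pushed `true` joins
      -- the content of the summand and the saved input to a pair.
      bif y then popMain fun _ => popMain fun _ => (pushMain (some true)).seq q
      else (pushMain (some true)).seq p),
      16 * X + 40 + R + P.comp (R + X + 1) + Q.comp (R + X + 1), fun x => ?_⟩
  have h1 : ∀ i m a b o, Exec dup (store i (word x ++ m) a b o)
    (store i (word x ++ (word x ++ m)) a b o) _ := fun i m a b o => exec_dup (Enc.enc x)
  have h2 := fun i m a b o => (h1 i m a b o).seq ((hr x).2 _ _ _ _ _)
  have h3 := (hr x).1
  simp only [eval_add, eval_mul, eval_X, eval_ofNat, eval_comp, eval_one]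
  cases hx : s x with
  | inl y =>
    have h6 : encSize (y, x) ≤ R.eval (encSize x) + encSize x + 1 := by
      have : encSize (Sum.inl y : β ⊕ γ) = 1 + encSize y + 1 := Code.size_cons _ _
      rw [hx] at h3
      simp only [encSize_prod]
      omega
    have h5 := eval_le_eval_nat P h6
    refine ⟨by have := (hp (y, x)).1; simp only; omega, fun i m a b o => ?_⟩
    have h2 := h2 i m a b o
    have h7 := (hp (y, x)).2 i m a b o
    rw [hx, word_inl] at h2
    rw [word_pair] at h7
    refine (h2.seq (exec_popMain (exec_popMain (x := false) ((exec_pushMain _).seq h7)))).mono ?_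
    simp only [encSize] at *
    omega
  | inr y =>
    have h6 : encSize (y, x) ≤ R.eval (encSize x) + encSize x + 1 := by
      have : encSize (Sum.inr y : β ⊕ γ) = 3 + encSize y + 1 := Code.size_cons _ _
      rw [hx] at h3
      simp only [encSize_prod]
      omega
    have h5 := eval_le_eval_nat Q h6
    refine ⟨by have := (hq (y, x)).1; simp only; omega, fun i m a b o => ?_⟩
    have h2 := h2 i m a b o
    have h7 := (hq (y, x)).2 i m a b o
    rw [hx, word_inr] at h2
    rw [word_pair] at h7
    refine (h2.seq (exec_popMain (exec_popMain (x := true) (exec_popMain (exec_popMain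
      ((exec_pushMain _).seq h7)))))).mono ?_
    simp only [encSize] at *
    omega

/-- Pop the flag from the auxiliary stack and push the corresponding Boolean. -/
def readFlag : TProg :=
  .loop .aux (fun _ => false) <| onBit (fun f => pushList (Enc.enc f).bits) .skip

theorem exec_readFlag {i : List Symbol} {m a b : List (Option Bool)} {o : List Bool} {f : Bool} :
    Exec readFlag (store i m (some f :: a) b o) (store i (word f ++ m) a b o) 8 := by
  refine (loop_aux_exit (x := some f) (again := fun _ => false) 
    (body := onBit (fun f => pushList (Enc.enc f).bits) .skip) rfl
    (exec_pushList (Enc.enc f).bits)).mono ?_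
  have := encSize_bool_le f
  simp only [encSize] at this
  simp only [Code.length_bits]
  omega

/-- Encodings are injective, so comparing the two words decides equality, whatever the decision
procedure of the type. -/
theorem prod_eq [DecidableEq α] : PolyFn fun x : α × α => decide (x.1 = x.2) := by
  refine ⟨popMain fun _ => ((hide.seq hide).seq ((pushCnt none).seq
      (drainAux fun x => pushCnt (some x)))).seq (((pushMain none).seq
      (drainAux fun x => pushMain (some x))).seq ((pushAux (some true)).seq
      (compareLoop.seq readFlag))), 30 * X + 100, fun x => ⟨?_, fun i m a b o => ?_⟩⟩
  · have := encSize_bool_le (decide (x.1 = x.2))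
    simp only [eval_add, eval_mul, eval_X, eval_ofNat]
    omega
  · obtain ⟨x, y⟩ := x
    rw [word_pair]
    have h1 := exec_drainAux_cnt (i := i) (o := o) (m := m)
      (a := (Enc.enc x).bits.reverse.map some ++ none :: a) (Enc.enc y).bits.reverse (none :: b)
    have h2 := exec_drainAux_main (i := i) (o := o) (a := a)
      (b := (Enc.enc y).bits.map some ++ none :: b) (Enc.enc x).bits.reverse (none :: m)
    rw [List.reverse_reverse] at h1 h2
    have h3 := exec_compareLoop (i := i) (o := o) (a := a) (b := b) (m := m) (Enc.enc x).bits
      (Enc.enc y).bits true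
    have h4 : (true && ((Enc.enc x).bits == (Enc.enc y).bits)) = decide (x = y) := by
      rw [Bool.true_and, Bool.eq_iff_iff, beq_iff_eq, decide_eq_true_iff, Code.bits_inj,
        Enc.inj.eq_iff]
    rw [h4] at h3
    refine (exec_popMain ((((exec_hide (Enc.enc x)).seq (exec_hide (Enc.enc y))).seq
      ((exec_pushCnt none).seq h1)).seq (((exec_pushMain none).seq h2).seq
      ((exec_pushAux (some true)).seq (h3.seq exec_readFlag))))).mono ?_
    simp only [encSize_prod]
    simp only [eval_add, eval_mul, eval_X, eval_ofNat, List.length_reverse, Code.length_bits,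
      encSize]
    omega

theorem eq [DecidableEq β] {f g : α → β} (hf : PolyFn f) (hg : PolyFn g) :
    PolyFn fun x => decide (f x = g x) := prod_eq.comp (hf.pair hg)

/-- Repeat `q` for each bit above the marker on the auxiliary stack. -/
theorem exec_iterate {g : σ → σ} {q : TProg} {Q : Polynomial ℕ} (hq : Computes q g Q)
    {i : List Symbol} {m a b : List (Option Bool)} {o : List Bool} {N : ℕ} (l : List Bool) : ∀ s : σ,
    (∀ j ≤ l.length, encSize (g^[j] s) ≤ N) →
    Exec (drainAux fun _ => q) (store i (word s ++ m) (l.map some ++ none :: a) b o)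
      (store i (word (g^[l.length] s) ++ m) a b o) ((Q.eval N + 1) * l.length + 2) := by
  induction l with
  | nil => exact fun s _ => drainAux_exit
  | cons x l ih =>
    intro s hs
    have h1 := (hq s).2 i m (l.map some ++ none :: a) b o
    have h2 := ih (g s) fun j hj => by
      rw [← Function.iterate_succ_apply]
      exact hs _ (by simp; omega)
    refine (drainAux_again h1 h2).mono ?_
    have h3 := eval_le_eval_nat Q (hs 0 (Nat.zero_le _))
    simp only [Function.iterate_zero, id_eq] at h3
    rw [List.length_cons, Nat.mul_succ]
    omega

/-- A function is computable in polynomial time if it iterates one that is, a number of times that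
is the size of an intermediate value, and the iterates have polynomial size. -/
theorem iterate {c : α → γ} {init : α → σ} {g : σ → σ} (hc : PolyFn c) (hi : PolyFn init)
    (hg : PolyFn g) (B : Polynomial ℕ)
    (hB : ∀ x, ∀ j ≤ encSize (c x), encSize (g^[j] (init x)) ≤ B.eval (encSize x)) :
    PolyFn fun x => g^[encSize (c x)] (init x) := by
  obtain ⟨r, R, hr⟩ := hc
  obtain ⟨p, P, hp⟩ := hi
  obtain ⟨q, Q, hq⟩ := hg
  -- The hidden code of `c x` serves as the loop counter, one round per symbol.
  refine ⟨((dup.seq r).seq (hide.seq p)).seq (drainAux fun _ => q),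
    16 * X + 60 + 9 * R + P + B + (Q.comp B + 1) * R, fun x => ⟨?_, fun i m a b o => ?_⟩⟩
  · have := hB x _ le_rfl
    simp only [eval_add, eval_mul, eval_X, eval_ofNat, eval_comp, eval_one]
    omega
  · have h1 : Exec dup (store i (word x ++ m) a b o) (store i (word x ++ (word x ++ m)) a b o) _ :=
      exec_dup (Enc.enc x)
    have h2 : Exec hide (store i (word (c x) ++ (word x ++ m)) a b o) _ _ :=
      exec_hide (Enc.enc (c x))
    have h3 := exec_iterate hq (i := i) (m := m) (a := a) (b := b) (o := o)
      (Enc.enc (c x)).bits.reverse (init x) (N := B.eval (encSize x)) (by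
        rw [List.length_reverse]
        exact hB x)
    simp only [List.length_reverse, Code.length_bits] at h3
    refine (((h1.seq ((hr x).2 _ _ _ _ _)).seq (h2.seq ((hp x).2 _ _ _ _ _))).seq h3).mono ?_
    have h4 := (hr x).1
    have h5 := Nat.mul_le_mul_left (Q.eval (B.eval (encSize x)) + 1) h4
    simp only [eval_add, eval_mul, eval_X, eval_ofNat, eval_comp, eval_one]
    simp only [encSize] at *
    omega

end PolyFn

/-! ### From polynomial-time functions to Turing machines -/

/-- Push a symbol on the list that is on the main stack. -/
def loadSymbol : Option Symbol → TProg
  | some s => (pushList (Enc.enc s).bits).seq (pushMain (some true))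
  | none => .skip

/-- Read the input and build its reversal as a tree. -/
def loadLoop : TProg := .loop .inp Option.isSome loadSymbol

theorem loadLoop_exit {m a b : List (Option Bool)} {o : List Bool} :
    Exec loadLoop (store [] m a b o) (store [] m a b o) (1 + 1) :=
  Exec.loop_exit (Γ := Stk.Γ) (k := .inp) (again := Option.isSome) (body := loadSymbol)
    (S := store [] m a b o) (S₁ := store [] m a b o) (o := none) rfl update_inp rfl (exec_skip _)

theorem loadLoop_again {w : List Symbol} {s : Symbol} {m a b : List (Option Bool)} {o : List Bool}
    {S S' : Prog.Store Stk.Γ} {t t' : ℕ} (h : Exec (loadSymbol (some s)) (store w m a b o) S t)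
    (h' : Exec loadLoop S S' t') : Exec loadLoop (store (s :: w) m a b o) S' (1 + t + t') :=
  Exec.loop_again (Γ := Stk.Γ) (k := .inp) (again := Option.isSome) (body := loadSymbol)
    (S := store (s :: w) m a b o) (S₁ := store w m a b o) (o := some s) rfl update_inp rfl h h'

theorem encSize_symbol_le (s : Symbol) : encSize s ≤ 15 := by
  rcases s with (_ | _) | _ | _ | _ | _ | _ | _ <;> decide

theorem exec_loadLoop {a b : List (Option Bool)} {o : List Bool} (w : List Symbol) :
    ∀ l : List Symbol, Exec loadLoop (store w (word l) a b o)
      (store [] (word (w.reverse ++ l)) a b o) (34 * w.length + 2) := by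
  induction w with
  | nil => exact fun l => loadLoop_exit
  | cons s w ih =>
    intro l
    have h1 : Exec ((pushList (Enc.enc s).bits).seq (pushMain (some true)))
        (store w (word l) a b o) (store w (word (s :: l)) a b o) 33 := by
      have := (exec_pushList (i := w) (m := word l) (a := a) (b := b) (o := o) (Enc.enc s).bits).seq
        (exec_pushMain (some true))
      rw [← List.append_nil (word (s :: l)), word_cons, List.append_nil]
      refine this.mono ?_
      have := encSize_symbol_le s
      simp only [encSize] at this
      simp only [Code.length_bits]
      omega
    have h2 := loadLoop_again (s := s) h1 (ih (s :: l))
    rw [List.reverse_cons, List.append_assoc]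
    refine h2.mono ?_
    simp only [List.length_cons]
    omega

/-- Write the Boolean on the main stack to the output. -/
def writeOut : TProg := popMain fun x =>
  bif x then popMain fun _ => popMain fun _ => pushOut true else pushOut false

theorem exec_writeOut {i : List Symbol} {a b : List (Option Bool)} {o : List Bool} (f : Bool) :
    Exec writeOut (store i (word f) a b o) (store i [] a b (f :: o)) 4 := by
  cases f with
  | false =>
    have : Exec writeOut (store i [some false] a b o) _ _ := exec_popMain (exec_pushOut false)
    exact this.mono (by omega)
  | true =>
    have h : Exec (popMain fun _ => popMain fun _ => pushOut true)
        (store i [some false, some false] a b o) _ _ :=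
      exec_popMain (exec_popMain (exec_pushOut true))
    have : Exec writeOut (store i [some true, some false, some false] a b o) _ _ := exec_popMain h
    exact this.mono (by omega)

theorem encSize_word_le (w : List Symbol) : encSize w ≤ 16 * w.length + 1 := by
  induction w with
  | nil => rfl
  | cons s w ih =>
    have := encSize_symbol_le s
    rw [encSize_cons, List.length_cons]
    omega

/-- Languages with a characteristic function that is computable in polynomial time are in
`PTime`. -/
theorem PolyFn.inPTime {f : List Symbol → Bool} (hf : PolyFn f) {P : Language Symbol}
    (h : ∀ w, f w.reverse = true ↔ w ∈ P) : InPTime P := by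
  obtain ⟨p, Q, hp⟩ := hf
  -- Moving the input onto another stack reverses it, so `f` receives the reversed word.
  refine ⟨fun w => f w.reverse, h, ⟨?_⟩⟩
  -- The initial symbol is the code of the empty list, to which the loop adds the input symbols.
  let prog : TProg := ((pushMain (some false)).seq loadLoop).seq (p.seq writeOut)
  have hexec : ∀ w, Exec prog (store w [] [] [] []) (store [] [] [] [] [f w.reverse])
      ((34 * X + 20 + Q.comp (16 * X + 1) : Polynomial ℕ).eval w.length) := by
    intro w
    have h1 := exec_loadLoop (a := []) (b := []) (o := []) w []
    rw [List.append_nil] at h1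
    have h2 := (hp w.reverse).2 [] [] [] [] []
    rw [List.append_nil, List.append_nil] at h2
    refine ((((exec_pushMain (some false)).seq h1).seq (h2.seq (exec_writeOut _)))).mono ?_
    have h3 := eval_le_eval_nat Q (encSize_word_le w.reverse)
    simp only [eval_add, eval_mul, eval_X, eval_ofNat, eval_comp, eval_one]
    rw [List.length_reverse] at h3
    omega
  have hout : ∀ w, Nonempty (Turing.TM2OutputsInTime (prog.toFinTM2 .inp .out)
      (List.map (Equiv.refl Symbol).invFun w)
      (some (List.map (Equiv.refl Bool).invFun (Computability.encodeBool (f w.reverse))))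
      ((34 * X + 20 + Q.comp (16 * X + 1) + 1 : Polynomial ℕ).eval w.length)) := by
    intro w
    have h1 := (hexec w).evalsTo .inp .out
    have hinit : Turing.initList (prog.toFinTM2 .inp .out)
        (List.map (Equiv.refl Symbol).invFun w) =
        ⟨some (prog.label [prog]), fun _ => none, store w [] [] [] []⟩ := by
      have : List.map (Equiv.refl Symbol).invFun w = w := List.map_id w
      refine (congrArg (Turing.initList (prog.toFinTM2 .inp .out)) this).trans ?_
      refine congrArg (Turing.TM2.Cfg.mk _ _) ?_
      funext k
      cases k <;> rfl
    have hhalt : Turing.haltList (prog.toFinTM2 .inp .out)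
        (List.map (Equiv.refl Bool).invFun (Computability.encodeBool (f w.reverse))) =
        ⟨none, fun _ => none, store [] [] [] [] [f w.reverse]⟩ := by
      refine congrArg (Turing.TM2.Cfg.mk _ _) ?_
      funext k
      cases k <;> rfl
    rw [Turing.TM2OutputsInTime, Option.map_some, hinit, hhalt, eval_add (q := 1), eval_one]
    exact h1
  exact
    { tm := prog.toFinTM2 .inp .out
      inputAlphabet := Equiv.refl _
      outputAlphabet := Equiv.refl _
      time := 34 * X + 20 + Q.comp (16 * X + 1) + 1
      outputsFun := fun w => Classical.choice (hout w) }

end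

end OntologyFitting

namespace OntologyFitting

/-! ### Polynomial-time list functions -/

section Fold

variable {α β σ : Type}

/-- One step of a fold. -/
def foldStep (f : (σ × β) × α → σ) (s : (List β × σ) × α) : (List β × σ) × α :=
  match s.1.1 with
  | [] => s
  | y :: t => ((t, f ((s.1.2, y), s.2)), s.2)

theorem foldStep_iterate (f : (σ × β) × α → σ) (x : α) (n : ℕ) : ∀ (l : List β) (s : σ),
    (foldStep f)^[n] ((l, s), x) =
      ((l.drop n, (l.take n).foldl (fun s y => f ((s, y), x)) s), x) := by
  induction n with
  | zero => intro l s; rfl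
  | succ n ih =>
    rintro (_ | ⟨y, t⟩) s
    · rw [Function.iterate_succ_apply]
      exact (ih [] s).trans (by simp)
    · rw [Function.iterate_succ_apply]
      exact ih t _

end Fold

/-! ### Least fixed points -/

/-- The `n`-th stage of the inductive definition of a subset of `cand` by `φ`. -/
def lfp {β : Type} (n : ℕ) (cand : List β) (φ : List β → β → Bool) : List β :=
  (fun s => cand.filter (φ s))^[n] []

section Lfp

variable {β : Type} {cand : List β} {φ : List β → β → Bool}

theorem lfp_succ (n : ℕ) : lfp (n + 1) cand φ = cand.filter (φ (lfp n cand φ)) :=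
  Function.iterate_succ_apply' _ _ _

theorem filter_sublist_filter {p q : β → Bool} (h : ∀ y ∈ cand, p y = true → q y = true) :
    (cand.filter p).Sublist (cand.filter q) := by
  have : cand.filter p = (cand.filter q).filter p := by
    rw [List.filter_filter]
    refine List.filter_congr fun y hy => ?_
    have := h y hy
    revert this
    cases p y <;> cases q y <;> simp
  rw [this]
  exact List.filter_sublist

/-- Sublists rather than subsets: two successive stages of equal length are then equal, even if
candidates are repeated. Monotonicity is required at candidates only, since it may fail elsewhere.
-/
theorem lfp_sublist_succ (hφ : ∀ s s', s ⊆ s' → ∀ y ∈ cand, φ s y = true → φ s' y = true) (n : ℕ) :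
    (lfp n cand φ).Sublist (lfp (n + 1) cand φ) := by
  induction n with
  | zero => exact List.nil_sublist _
  | succ n ih =>
    rw [lfp_succ, lfp_succ (n + 1)]
    exact filter_sublist_filter fun y => hφ _ _ ih.subset y

/-- Stages grow by at least one entry until two successive ones agree, and agreement persists. -/
theorem lfp_length_or (hφ : ∀ s s', s ⊆ s' → ∀ y ∈ cand, φ s y = true → φ s' y = true) (n : ℕ) :
    lfp (n + 1) cand φ = lfp n cand φ ∨ n + 1 ≤ (lfp (n + 1) cand φ).length := by
  induction n with
  | zero =>
    rcases h : lfp 1 cand φ with _ | ⟨y, t⟩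
    · exact Or.inl rfl
    · exact Or.inr (by simp)
  | succ n ih =>
    rcases ih with ih | ih
    · left
      rw [lfp_succ, ih, ← lfp_succ]
      exact ih.symm ▸ rfl
    · have hs := lfp_sublist_succ (cand := cand) hφ (n + 1)
      rcases hs.length_le.eq_or_lt with h | h
      · exact Or.inl (hs.eq_of_length h).symm
      · exact Or.inr (by omega)

/-- A stage that still grew would be longer than the list of candidates. -/
theorem lfp_stable (hφ : ∀ s s', s ⊆ s' → ∀ y ∈ cand, φ s y = true → φ s' y = true) {n : ℕ}
    (hn : cand.length ≤ n) : cand.filter (φ (lfp n cand φ)) = lfp n cand φ := by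
  rw [← lfp_succ]
  rcases lfp_length_or (cand := cand) hφ n with h | h
  · exact h
  · have : (lfp (n + 1) cand φ).length ≤ cand.length := by
      rw [lfp_succ]
      exact List.length_filter_le _ _
    omega

/-- Leastness, used to keep pairs of a simulation out of `nonSim` and to keep the derived queries
inside every closed ABox. -/
theorem lfp_induction {Y : β → Prop}
    (hY : ∀ s, (∀ y ∈ s, Y y) → ∀ y ∈ cand, φ s y = true → Y y) (n : ℕ) :
    ∀ y ∈ lfp n cand φ, Y y := by
  induction n with
  | zero => intro y hy; simp [lfp] at hy
  | succ n ih =>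
    intro y hy
    rw [lfp_succ, List.mem_filter] at hy
    exact hY _ ih y hy.1 hy.2

end Lfp

/-! ### Closure of polynomial-time functions under Boolean operations, folds and inductive
definitions -/

section

open Polynomial

variable {α β γ σ : Type} [Enc α] [Enc β] [Enc γ] [Enc σ]

theorem encSize_le_of_mem {y : β} {l : List β} (h : y ∈ l) : encSize y ≤ encSize l := by
  induction l with
  | nil => simp at h
  | cons a l ih =>
    rw [encSize_cons]
    rcases List.mem_cons.1 h with rfl | h
    · omega
    · have := ih h
      omega

theorem encSize_append (l l' : List β) : encSize (l ++ l') + 1 = encSize l + encSize l' := by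
  induction l with
  | nil => rw [List.nil_append, encSize_nil, Nat.add_comm]
  | cons a l ih =>
    rw [List.cons_append, encSize_cons, encSize_cons]
    omega

theorem encSize_le_of_sublist {l l' : List β} (h : l.Sublist l') : encSize l ≤ encSize l' := by
  induction h with
  | slnil => exact le_rfl
  | cons a _ ih =>
    rw [encSize_cons]
    omega
  | cons_cons a _ ih =>
    rw [encSize_cons, encSize_cons]
    omega

namespace PolyFn

theorem and {f g : α → Bool} (hf : PolyFn f) (hg : PolyFn g) : PolyFn fun x => f x && g x :=
  (cond hf hg (const false)).of_eq fun x => by cases f x <;> rfl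

theorem or {f g : α → Bool} (hf : PolyFn f) (hg : PolyFn g) : PolyFn fun x => f x || g x :=
  (cond hf (const true) hg).of_eq fun x => by cases f x <;> rfl

theorem not {f : α → Bool} (hf : PolyFn f) : PolyFn fun x => !f x :=
  (cond hf (const false) (const true)).of_eq fun x => by cases f x <;> rfl

theorem cons {f : α → β} {l : α → List β} (hf : PolyFn f) (hl : PolyFn l) :
    PolyFn fun x => f x :: l x :=
  (of_enc_eq (f := fun p : β × List β => p.1 :: p.2) fun _ => rfl).comp (hf.pair hl)

theorem assertionCases {s : α → Assertion β} {f : (ConceptName × β) × α → γ}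
    {g : (RoleName × β × β) × α → γ} (hs : PolyFn s) (hf : PolyFn f) (hg : PolyFn g) :
    PolyFn fun x => match s x with
      | .conc P a => f ((P, a), x)
      | .role r a b => g ((r, a, b), x) :=
  (sumCases ((of_enc_eq (f := assertionSum (N := β)) fun _ => rfl).comp hs) hf hg).of_eq
    fun x => by cases s x <;> rfl

/-- A fold with intermediate values of polynomial size. -/
theorem foldl {l : α → List β} {init : α → σ} {f : (σ × β) × α → σ} (hl : PolyFn l)
    (hi : PolyFn init) (hf : PolyFn f) (B : Polynomial ℕ)
    (hB : ∀ x l', l' <+: l x →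
      encSize (l'.foldl (fun s y => f ((s, y), x)) (init x)) ≤ B.eval (encSize x)) :
    PolyFn fun x => (l x).foldl (fun s y => f ((s, y), x)) (init x) := by
  have hstep : PolyFn (foldStep f) := by
    refine (listCases (l := fun s : (List β × σ) × α => s.1.1) (f := fun s => s)
      (g := fun p => ((p.1.2, f ((p.2.1.2, p.1.1), p.2.2)), p.2.2)) id.fst.fst id ?_).of_eq ?_
    · exact (id.fst.snd.pair (hf.comp ((id.snd.fst.snd.pair id.fst.fst).pair id.snd.snd))).pair
        id.snd.snd
    · rintro ⟨⟨_ | ⟨y, t⟩, s⟩, x⟩ <;> rfl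
  obtain ⟨p, P, hp⟩ := hl
  have hl : PolyFn l := ⟨p, P, hp⟩
  -- The number of rounds is the size of the code of the list, which is at least its length. Surplus
  -- rounds are harmless because `foldStep` is idle on an empty list.
  refine (iterate hl ((hl.pair hi).pair id) hstep (P + B + X + 2) fun x j _ => ?_).fst.snd.of_eq
    fun x => ?_
  · rw [foldStep_iterate]
    simp only [encSize_prod, eval_add, eval_X, eval_ofNat]
    have h1 := hB x _ (List.take_prefix j (l x))
    have h2 := (encSize_le_of_sublist (List.drop_sublist j (l x))).trans (hp x).1
    omega
  · rw [foldStep_iterate, List.take_of_length_le (length_le_encSize _)]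

/-- A fold where each step adds a polynomial to the size. -/
theorem foldl_of_add {l : α → List β} {init : α → σ} {f : (σ × β) × α → σ} (hl : PolyFn l)
    (hi : PolyFn init) (hf : PolyFn f) (D : Polynomial ℕ)
    (hD : ∀ s y x, encSize (f ((s, y), x)) ≤ encSize s + D.eval (encSize y + encSize x)) :
    PolyFn fun x => (l x).foldl (fun s y => f ((s, y), x)) (init x) := by
  obtain ⟨p, P, hp⟩ := hl
  obtain ⟨q, Q, hq⟩ := hi
  -- The value of `P` bounds both the number of entries of the list and the size of each of them.
  refine foldl ⟨p, P, hp⟩ ⟨q, Q, hq⟩ hf (Q + P * D.comp (P + X)) fun x l' hl' => ?_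
  have key : ∀ (l' : List β) (s : σ), l' ⊆ l x →
      encSize (l'.foldl (fun s y => f ((s, y), x)) s) ≤
        encSize s + l'.length * D.eval (P.eval (encSize x) + encSize x) := by
    intro l'
    induction l' with
    | nil => intro s _; simp
    | cons y t ih =>
      intro s hs
      have h1 := ih (f ((s, y), x)) fun z hz => hs (List.mem_cons_of_mem _ hz)
      have h2 := hD s y x
      have h3 : encSize y + encSize x ≤ P.eval (encSize x) + encSize x :=
        Nat.add_le_add_right ((encSize_le_of_mem (hs List.mem_cons_self)).trans (hp x).1) _
      have h4 := eval_le_eval_nat D h3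
      rw [List.foldl_cons, List.length_cons, Nat.succ_mul]
      omega
  refine (key l' (init x) hl'.subset).trans ?_
  simp only [eval_add, eval_mul, eval_comp, eval_X]
  exact Nat.add_le_add (hq x).1 (Nat.mul_le_mul_right _
    ((hl'.length_le.trans (length_le_encSize _)).trans (hp x).1))

theorem any {l : α → List β} {p : β × α → Bool} (hl : PolyFn l) (hp : PolyFn p) :
    PolyFn fun x => (l x).any fun y => p (y, x) := by
  refine (foldl_of_add (f := fun s => s.1.1 || p (s.1.2, s.2)) hl (const false)
    (id.fst.fst.or (hp.comp (id.fst.snd.pair id.snd))) 3 fun s y x => ?_).of_eq fun x => ?_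
  · have := encSize_bool_le (s || p (y, x))
    simp only [eval_ofNat]
    omega
  · have key : ∀ (l : List β) (s : Bool),
        l.foldl (fun s y => s || p (y, x)) s = (s || l.any fun y => p (y, x)) := by
      intro l
      induction l with
      | nil => simp
      | cons y t ih => intro s; simp [ih, Bool.or_assoc]
    exact (key (l x) false).symm

theorem all {l : α → List β} {p : β × α → Bool} (hl : PolyFn l) (hp : PolyFn p) :
    PolyFn fun x => (l x).all fun y => p (y, x) :=
  (any hl hp.not).not.of_eq fun x => by simp [List.all_eq_not_any_not]

theorem mem {f : α → β} {l : α → List β} {_ : ∀ x, Decidable (f x ∈ l x)} (hf : PolyFn f)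
    (hl : PolyFn l) : PolyFn fun x => decide (f x ∈ l x) := by
  classical
  exact (any (p := fun y => decide (y.1 = f y.2)) hl (id.fst.eq (hf.comp id.snd))).of_eq
    fun x => by rw [Bool.eq_iff_iff]; simp

theorem foldl_cons {l : α → List β} {init : α → List γ} {f : β × α → γ} (hl : PolyFn l)
    (hi : PolyFn init) (hf : PolyFn f) :
    PolyFn fun x => (l x).foldl (fun s y => f (y, x) :: s) (init x) := by
  have hg : PolyFn fun s : (List γ × β) × α => f (s.1.2, s.2) :: s.1.1 :=
    (hf.comp (id.fst.snd.pair id.snd)).cons id.fst.fst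
  obtain ⟨p, P, hp⟩ := hf
  refine foldl_of_add (f := fun s => f (s.1.2, s.2) :: s.1.1) hl hi hg (P.comp (X + 1) + 1)
    fun s y x => ?_
  have := (hp (y, x)).1
  simp only [encSize_prod] at this
  simp only [encSize_cons, eval_add, eval_comp, eval_X, eval_one]
  omega

theorem append {l l' : α → List β} (hl : PolyFn l) (hl' : PolyFn l') :
    PolyFn fun x => l x ++ l' x :=
  (foldl_cons (f := Prod.fst) (foldl_cons (f := Prod.fst) hl (const []) id.fst) hl' id.fst).of_eq
    fun x => by simp

/-- Folding with `cons` reverses the list; a second fold restores the order. -/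
theorem map {l : α → List β} {f : β × α → γ} (hl : PolyFn l) (hf : PolyFn f) :
    PolyFn fun x => (l x).map fun y => f (y, x) :=
  (foldl_cons (f := Prod.fst) (foldl_cons hl (const []) hf) (const []) id.fst).of_eq
    fun x => by simp

theorem flatMap {l : α → List β} {f : β × α → List γ} (hl : PolyFn l) (hf : PolyFn f) :
    PolyFn fun x => (l x).flatMap fun y => f (y, x) := by
  have hg : PolyFn fun s : (List γ × β) × α => s.1.1 ++ f (s.1.2, s.2) :=
    id.fst.fst.append (hf.comp (id.fst.snd.pair id.snd))
  obtain ⟨p, P, hp⟩ := hf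
  refine (foldl_of_add (f := fun s => s.1.1 ++ f (s.1.2, s.2)) hl (const []) hg (P.comp (X + 1))
    fun s y x => ?_).of_eq fun x => ?_
  · have h1 := (hp (y, x)).1
    have h2 := encSize_append s (f (y, x))
    simp only [encSize_prod] at h1
    simp only [eval_add, eval_comp, eval_X, eval_one]
    omega
  · have key : ∀ (l : List β) (s : List γ),
        l.foldl (fun s y => s ++ f (y, x)) s = s ++ l.flatMap fun y => f (y, x) := by
      intro l
      induction l with
      | nil => simp
      | cons y t ih => intro s; simp [ih]
    exact (key (l x) []).symm

theorem filter {l : α → List β} {p : β × α → Bool} (hl : PolyFn l) (hp : PolyFn p) :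
    PolyFn fun x => (l x).filter fun y => p (y, x) :=
  (flatMap hl (cond hp (id.fst.cons (const [])) (const []))).of_eq fun x => by
    induction l x with
    | nil => rfl
    | cons y t ih =>
      rw [List.filter_cons, ih, List.flatMap_cons]
      cases p (y, x) <;> simp

end PolyFn

/-- The inductive definition is computable in polynomial time. -/
theorem PolyFn.lfp {cand : α → List β} {φ : (β × List β) × α → Bool} (hc : PolyFn cand)
    (hφ : PolyFn φ) :
    PolyFn fun x => lfp (encSize (cand x)) (cand x) fun s y => φ ((y, s), x) := by
  obtain ⟨p, P, hp⟩ := hc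
  have hc : PolyFn cand := ⟨p, P, hp⟩
  let g : List β × α → List β × α := fun s =>
    ((cand s.2).filter fun y => φ ((y, s.1), s.2), s.2)
  have hg : PolyFn g := PolyFn.pair (PolyFn.filter (p := fun y => φ ((y.1, y.2.1), y.2.2))
    (hc.comp .prod_snd) (hφ.comp ((PolyFn.id.fst.pair PolyFn.id.snd.fst).pair PolyFn.id.snd.snd)))
    .prod_snd
  have key : ∀ x n, g^[n] ([], x) = (OntologyFitting.lfp n (cand x) fun s y => φ ((y, s), x), x) := by
    intro x n
    induction n with
    | zero => rfl
    | succ n ih =>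
      rw [Function.iterate_succ_apply', ih, lfp_succ]
  refine (PolyFn.iterate hc ((PolyFn.const []).pair .id) hg (P + X + 2) fun x j _ => ?_).fst.of_eq
    fun x => ?_
  · rw [key]
    -- Each stage is a sublist of the candidates, so the iterates stay small.
    have h1 : encSize (OntologyFitting.lfp j (cand x) fun s y => φ ((y, s), x)) ≤
        encSize (cand x) := by
      cases j with
      | zero => exact encSize_pos _
      | succ j =>
        rw [lfp_succ]
        exact encSize_le_of_sublist List.filter_sublist
    have h2 := (hp x).1
    simp only [encSize_prod, eval_add, eval_X, eval_ofNat]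
    omega
  · rw [key]

end

end OntologyFitting

namespace OntologyFitting

/-! ### Parsing -/

/-- An example as it is written: the list of assertions, the concept name and the individual. -/
abbrev RawExample := List (Assertion IndName) × ConceptName × IndName

/-- The word for an example without the label. -/
def writeBody (e : RawExample) : List Symbol :=
  e.1.flatMap encodeAssertion ++ Symbol.query :: (encodeName e.2.1 ++ encodeName e.2.2)

/-- The word for an example. -/
def writeExample (s : Symbol) (e : RawExample) : List Symbol := s :: writeBody e

/-- The word for a list of positive and a list of negative examples. -/
def writeCollection (R : List RawExample × List RawExample) : List Symbol :=
  R.1.flatMap (writeExample .pos) ++ R.2.flatMap (writeExample .neg)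

/-- The state of the parser, which reads from right to left. -/
structure ParseState where
  /-- Cleared on errors. -/
  ok : Bool
  /-- The names that are not used yet. -/
  names : List (List Bool)
  /-- The example that is being read, if any. -/
  cur : List RawExample
  /-- The positive examples. -/
  pos : List RawExample
  /-- The negative examples. -/
  neg : List RawExample

namespace ParseState

variable (st : ParseState)

/-- The first unused name. -/
def name₀ : List Bool := st.names.headD []
/-- The second unused name. -/
def name₁ : List Bool := st.names.tail.headD []
/-- The third unused name. -/
def name₂ : List Bool := st.names.tail.tail.headD []
/-- The example that is being read. -/
def cur₀ : RawExample := st.cur.headD ([], [], [])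

/-- Read a bit. -/
def stepBit (b : Bool) : ParseState :=
  ⟨st.ok && !decide (st.names = []), (b :: st.name₀) :: st.names.tail, st.cur, st.pos, st.neg⟩

/-- Read the end of a name. -/
def stepDelim : ParseState := ⟨st.ok, [] :: st.names, st.cur, st.pos, st.neg⟩

/-- Read the start of a concept assertion. -/
def stepConc : ParseState :=
  ⟨st.ok && (decide (st.names = [st.name₀, st.name₁]) && decide (st.cur = [st.cur₀])), [],
    [(Assertion.conc st.name₀ st.name₁ :: st.cur₀.1, st.cur₀.2)], st.pos, st.neg⟩

/-- Read the start of a role assertion. -/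
def stepRole : ParseState :=
  ⟨st.ok && (decide (st.names = [st.name₀, st.name₁, st.name₂]) && decide (st.cur = [st.cur₀])), [],
    [(Assertion.role st.name₀ st.name₁ st.name₂ :: st.cur₀.1, st.cur₀.2)], st.pos, st.neg⟩

/-- Read the start of a query. -/
def stepQuery : ParseState :=
  ⟨st.ok && (decide (st.names = [st.name₀, st.name₁]) && decide (st.cur = [])), [],
    [([], st.name₀, st.name₁)], st.pos, st.neg⟩

/-- Read the start of a positive example. -/
def stepPos : ParseState :=
  ⟨st.ok && (decide (st.names = []) && decide (st.cur = [st.cur₀])), [], [],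
    st.cur₀ :: st.pos, st.neg⟩

/-- Read the start of a negative example. -/
def stepNeg : ParseState :=
  -- Read from the right, all negative examples come before the positive ones, hence the test that
  -- `pos` is still empty.
  ⟨st.ok && (decide (st.names = []) && (decide (st.cur = [st.cur₀]) && decide (st.pos = []))), [],
    [], [], st.cur₀ :: st.neg⟩

/-- Read a symbol. -/
def step (s : Symbol) : ParseState :=
  match s with
  | .bit b => st.stepBit b
  | .delim => st.stepDelim
  | .conc => st.stepConc
  | .role => st.stepRole
  | .query => st.stepQuery
  | .pos => st.stepPos
  | .neg => st.stepNeg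

/-- The word that leads to a state. -/
def unparse : List Symbol :=
  st.names.flatMap encodeName ++ (st.cur.flatMap writeBody ++ writeCollection (st.pos, st.neg))

/-- Read from the right, a keyword arrives when the names it governs are already pending. Testing
their exact number makes every accepted step invertible. -/
theorem step_sound (s : Symbol) (h : (st.step s).ok = true) :
    st.ok = true ∧ (st.step s).unparse = s :: st.unparse := by
  cases s with
  | bit b =>
    obtain ⟨ok, names, cur, pos, neg⟩ := st
    cases names with
    | nil => simp [step, stepBit] at h
    | cons n ns =>
      simp only [step, stepBit, Bool.and_eq_true] at h
      exact ⟨h.1, by simp [step, stepBit, unparse, name₀, encodeName]⟩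
  | delim => exact ⟨h, by simp [step, stepDelim, unparse, encodeName]⟩
  | conc =>
    simp only [step, stepConc, Bool.and_eq_true, decide_eq_true_eq] at h
    obtain ⟨h1, h2, h3⟩ := h
    refine ⟨h1, ?_⟩
    simp only [unparse, step, stepConc]
    rw [h2, h3]
    simp [writeBody, encodeAssertion, writeCollection]
  | role =>
    simp only [step, stepRole, Bool.and_eq_true, decide_eq_true_eq] at h
    obtain ⟨h1, h2, h3⟩ := h
    refine ⟨h1, ?_⟩
    simp only [unparse, step, stepRole]
    rw [h2, h3]
    simp [writeBody, encodeAssertion, writeCollection]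
  | query =>
    simp only [step, stepQuery, Bool.and_eq_true, decide_eq_true_eq] at h
    obtain ⟨h1, h2, h3⟩ := h
    refine ⟨h1, ?_⟩
    simp only [unparse, step, stepQuery]
    rw [h2, h3]
    simp [writeBody, writeCollection]
  | pos =>
    simp only [step, stepPos, Bool.and_eq_true, decide_eq_true_eq] at h
    obtain ⟨h1, h2, h3⟩ := h
    refine ⟨h1, ?_⟩
    simp only [unparse, step, stepPos]
    rw [h2, h3]
    simp [writeBody, writeCollection, writeExample]
  | neg =>
    simp only [step, stepNeg, Bool.and_eq_true, decide_eq_true_eq] at h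
    obtain ⟨h1, h2, h3, h4⟩ := h
    refine ⟨h1, ?_⟩
    simp only [unparse, step, stepNeg]
    rw [h2, h3, h4]
    simp [writeBody, writeCollection, writeExample]

end ParseState

/-- The state of the parser after reading a word. -/
def parse (w : List Symbol) : ParseState :=
  w.foldr (fun s st => st.step s) ⟨true, [], [], [], []⟩

/-- The parser has read a complete collection. -/
def ParseState.complete (st : ParseState) : Bool :=
  st.ok && (decide (st.names = []) && decide (st.cur = []))

theorem parse_sound (w : List Symbol) (h : (parse w).ok = true) : (parse w).unparse = w := by
  induction w with
  | nil => rfl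
  | cons s w ih =>
    obtain ⟨h1, h2⟩ := ParseState.step_sound (parse w) s h
    exact h2.trans (by rw [ih h1])

theorem eq_write_of_complete {w : List Symbol} (h : (parse w).complete = true) :
    w = writeCollection ((parse w).pos, (parse w).neg) := by
  simp only [ParseState.complete, Bool.and_eq_true, decide_eq_true_eq] at h
  have := parse_sound w h.1
  simpa [ParseState.unparse, h.2.1, h.2.2] using this.symm

theorem foldr_encodeName (n : List Bool) (names : List (List Bool)) (c p q : List RawExample) :
    (encodeName n).foldr (fun s st => ParseState.step st s) ⟨true, names, c, p, q⟩ =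
      ⟨true, n :: names, c, p, q⟩ := by
  have : ∀ m : List Bool, (m.map Symbol.bit).foldr (fun s st => ParseState.step st s)
      ⟨true, [] :: names, c, p, q⟩ = ⟨true, m :: names, c, p, q⟩ := by
    intro m
    induction m with
    | nil => rfl
    | cons b m ih =>
      rw [List.map_cons, List.foldr_cons, ih]
      rfl
  rw [encodeName, List.foldr_append]
  exact this n

theorem foldr_encodeAssertion (α : Assertion IndName) (e : RawExample) (p q : List RawExample) :
    (encodeAssertion α).foldr (fun s st => ParseState.step st s) ⟨true, [], [e], p, q⟩ =
      ⟨true, [], [(α :: e.1, e.2)], p, q⟩ := by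
  cases α <;>
  · simp only [encodeAssertion, List.foldr_cons, List.foldr_append, foldr_encodeName]
    simp [ParseState.step, ParseState.stepConc, ParseState.stepRole, ParseState.name₀,
      ParseState.name₁, ParseState.name₂, ParseState.cur₀]

theorem foldr_writeBody (e : RawExample) (p q : List RawExample) :
    (writeBody e).foldr (fun s st => ParseState.step st s) ⟨true, [], [], p, q⟩ =
      ⟨true, [], [e], p, q⟩ := by
  have : ∀ l : List (Assertion IndName), (l.flatMap encodeAssertion).foldr
      (fun s st => ParseState.step st s) ⟨true, [], [([], e.2)], p, q⟩ =
      ⟨true, [], [(l, e.2)], p, q⟩ := by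
    intro l
    induction l with
    | nil => rfl
    | cons α l ih => rw [List.flatMap_cons, List.foldr_append, ih, foldr_encodeAssertion]
  rw [writeBody, List.foldr_append, List.foldr_cons, List.foldr_append, foldr_encodeName,
    foldr_encodeName]
  refine Eq.trans ?_ (this e.1)
  congr 1
  simp [ParseState.step, ParseState.stepQuery, ParseState.name₀, ParseState.name₁]

/-- The parser recovers both lists, so at most one pair of raw lists is written by a given word. -/
theorem parse_writeCollection (R : List RawExample × List RawExample) :
    parse (writeCollection R) = ⟨true, [], [], R.1, R.2⟩ := by
  have hneg : ∀ l : List RawExample, (l.flatMap (writeExample .neg)).foldr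
      (fun s st => ParseState.step st s) ⟨true, [], [], [], []⟩ = ⟨true, [], [], [], l⟩ := by
    intro l
    induction l with
    | nil => rfl
    | cons e l ih =>
      rw [List.flatMap_cons, List.foldr_append, ih, writeExample, List.foldr_cons, foldr_writeBody]
      simp [ParseState.step, ParseState.stepNeg, ParseState.cur₀]
  have hpos : ∀ l : List RawExample, (l.flatMap (writeExample .pos)).foldr
      (fun s st => ParseState.step st s) ⟨true, [], [], [], R.2⟩ = ⟨true, [], [], l, R.2⟩ := by
    intro l
    induction l with
    | nil => rfl
    | cons e l ih =>
      rw [List.flatMap_cons, List.foldr_append, ih, writeExample, List.foldr_cons, foldr_writeBody]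
      simp [ParseState.step, ParseState.stepPos, ParseState.cur₀]
  rw [parse, writeCollection, List.foldr_append, hneg, hpos]

/-! ### The parser runs in polynomial time -/

section

open Polynomial PolyFn

variable {α β : Type} [Enc α] [Enc β]

theorem PolyFn.headD {l : α → List β} (hl : PolyFn l) (d : β) : PolyFn fun x => (l x).headD d :=
  (hl.listCases (f := fun _ => d) (g := fun y => y.1.1) (const d) PolyFn.id.fst.fst).of_eq
    fun x => by cases l x <;> rfl

theorem PolyFn.tail {l : α → List β} (hl : PolyFn l) : PolyFn fun x => (l x).tail :=
  (hl.listCases (f := fun _ => []) (g := fun y => y.1.2) (const []) PolyFn.id.fst.snd).of_eq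
    fun x => by cases l x <;> rfl

theorem PolyFn.conc {P : α → ConceptName} {a : α → β} (hP : PolyFn P) (ha : PolyFn a) :
    PolyFn fun x => Assertion.conc (P x) (a x) :=
  ((const false).pair (hP.pair ha)).congr_enc fun _ => rfl

theorem PolyFn.role {r : α → RoleName} {a b : α → β} (hr : PolyFn r) (ha : PolyFn a)
    (hb : PolyFn b) : PolyFn fun x => Assertion.role (r x) (a x) (b x) :=
  ((const true).pair (hr.pair (ha.pair hb))).congr_enc fun _ => rfl

/-- A parser step only redistributes parts of its state. This inequality lets the sizes of the parts
be added without loss. -/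
theorem encSize_headD_add_tail (l : List β) (d : β) :
    encSize (l.headD d) + encSize l.tail ≤ encSize l + encSize d := by
  cases l with
  | nil => simp only [List.headD_nil, List.tail_nil]; omega
  | cons a l => simp only [List.headD_cons, List.tail_cons, encSize_cons]; omega

namespace ParseState

/-- The state as a tuple. -/
def toProd (st : ParseState) :
    Bool × List (List Bool) × List RawExample × List RawExample × List RawExample :=
  (st.ok, st.names, st.cur, st.pos, st.neg)

instance : Enc ParseState where
  enc st := Enc.enc st.toProd
  inj := Enc.inj.comp <| by
    rintro ⟨_, _, _, _, _⟩ ⟨_, _, _, _, _⟩ h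
    simp only [toProd, Prod.mk.injEq] at h
    simpa using h

theorem encSize_eq (st : ParseState) : encSize st = encSize st.ok + encSize st.names + encSize st.cur +
    encSize st.pos + encSize st.neg + 4 := by
  have : encSize st = encSize st.toProd := rfl
  rw [this]
  simp only [encSize_prod, toProd]
  omega

theorem polyFn_toProd : PolyFn toProd := of_enc_eq fun _ => rfl
theorem polyFn_ok : PolyFn ok := polyFn_toProd.fst
theorem polyFn_names : PolyFn names := polyFn_toProd.snd.fst
theorem polyFn_cur : PolyFn cur := polyFn_toProd.snd.snd.fst
theorem polyFn_pos : PolyFn pos := polyFn_toProd.snd.snd.snd.fst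
theorem polyFn_neg : PolyFn neg := polyFn_toProd.snd.snd.snd.snd
theorem polyFn_name₀ : PolyFn name₀ := polyFn_names.headD []
theorem polyFn_name₁ : PolyFn name₁ := polyFn_names.tail.headD []
theorem polyFn_name₂ : PolyFn name₂ := polyFn_names.tail.tail.headD []
theorem polyFn_cur₀ : PolyFn cur₀ := polyFn_cur.headD _

theorem polyFn_mk {f : α → Bool} {g : α → List (List Bool)} {c p n : α → List RawExample}
    (hf : PolyFn f) (hg : PolyFn g) (hc : PolyFn c) (hp : PolyFn p) (hn : PolyFn n) :
    PolyFn fun x => (⟨f x, g x, c x, p x, n x⟩ : ParseState) :=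
  (hf.pair (hg.pair (hc.pair (hp.pair hn)))).congr_enc fun _ => rfl

theorem polyFn_stepBit (b : Bool) : PolyFn fun st : ParseState => st.stepBit b :=
  polyFn_mk (polyFn_ok.and (polyFn_names.eq (const [])).not)
    (((const b).cons polyFn_name₀).cons polyFn_names.tail) polyFn_cur polyFn_pos polyFn_neg

theorem polyFn_stepDelim : PolyFn stepDelim :=
  polyFn_mk polyFn_ok ((const []).cons polyFn_names) polyFn_cur polyFn_pos polyFn_neg

theorem polyFn_names_eq_two :
    PolyFn fun st : ParseState => decide (st.names = [st.name₀, st.name₁]) :=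
  polyFn_names.eq (polyFn_name₀.cons (polyFn_name₁.cons (const [])))

theorem polyFn_cur_eq : PolyFn fun st : ParseState => decide (st.cur = [st.cur₀]) :=
  polyFn_cur.eq (polyFn_cur₀.cons (const []))

theorem polyFn_stepConc : PolyFn stepConc :=
  polyFn_mk (polyFn_ok.and (polyFn_names_eq_two.and polyFn_cur_eq)) (const [])
    ((((polyFn_name₀.conc polyFn_name₁).cons polyFn_cur₀.fst).pair polyFn_cur₀.snd).cons (const []))
    polyFn_pos polyFn_neg

theorem polyFn_stepRole : PolyFn stepRole :=
  polyFn_mk (polyFn_ok.and ((polyFn_names.eq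
      (polyFn_name₀.cons (polyFn_name₁.cons (polyFn_name₂.cons (const []))))).and polyFn_cur_eq))
    (const [])
    ((((polyFn_name₀.role polyFn_name₁ polyFn_name₂).cons polyFn_cur₀.fst).pair
      polyFn_cur₀.snd).cons (const []))
    polyFn_pos polyFn_neg

theorem polyFn_stepQuery : PolyFn stepQuery :=
  polyFn_mk (polyFn_ok.and (polyFn_names_eq_two.and (polyFn_cur.eq (const [])))) (const [])
    (((const []).pair (polyFn_name₀.pair polyFn_name₁)).cons (const [])) polyFn_pos polyFn_neg

theorem polyFn_stepPos : PolyFn stepPos :=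
  polyFn_mk (polyFn_ok.and ((polyFn_names.eq (const [])).and polyFn_cur_eq)) (const []) (const [])
    (polyFn_cur₀.cons polyFn_pos) polyFn_neg

theorem polyFn_stepNeg : PolyFn stepNeg :=
  polyFn_mk (polyFn_ok.and ((polyFn_names.eq (const [])).and
      (polyFn_cur_eq.and (polyFn_pos.eq (const []))))) (const []) (const []) (const [])
    (polyFn_cur₀.cons polyFn_neg)

theorem polyFn_step : PolyFn fun x : ParseState × Symbol => x.1.step x.2 := by
  have hs : ∀ s : Symbol, PolyFn fun x : ParseState × Symbol => decide (x.2 = s) :=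
    fun s => PolyFn.id.snd.eq (const s)
  refine (cond (hs (.bit false)) ((polyFn_stepBit false).comp prod_fst) <|
    cond (hs (.bit true)) ((polyFn_stepBit true).comp prod_fst) <|
    cond (hs .delim) (polyFn_stepDelim.comp prod_fst) <|
    cond (hs .conc) (polyFn_stepConc.comp prod_fst) <|
    cond (hs .role) (polyFn_stepRole.comp prod_fst) <|
    cond (hs .query) (polyFn_stepQuery.comp prod_fst) <|
    cond (hs .pos) (polyFn_stepPos.comp prod_fst) (polyFn_stepNeg.comp prod_fst)).of_eq ?_
  rintro ⟨st, s⟩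
  rcases s with (_ | _) | _ | _ | _ | _ | _ | _ <;> rfl

/-- Growth by an additive constant is what `foldl_of_add` needs; a constant factor per symbol would
permit exponential size. -/
theorem encSize_step_le (st : ParseState) (s : Symbol) : encSize (st.step s) ≤ encSize st + 100 := by
  have h0 : ∀ b : Bool, encSize b ≤ 3 := encSize_bool_le
  have hp0 : ∀ b : Bool, 1 ≤ encSize b := encSize_pos
  have h1 := encSize_headD_add_tail st.names []
  have h2 := encSize_headD_add_tail st.names.tail []
  have h3 := encSize_headD_add_tail st.names.tail.tail []
  have h4 := encSize_headD_add_tail st.cur ([], [], [])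
  have h5 := encSize_pos st.names.tail.tail
  have h6 := encSize_pos st.names.tail.tail.tail
  have h7 := encSize_pos st.cur.tail
  have h8 := encSize_pos st.pos
  have h9 := encSize_pos st.ok
  have hc : ∀ (P a : List Bool), encSize (Assertion.conc P a) = 1 + (encSize P + encSize a + 1) + 1 :=
    fun P a => by rw [← encSize_prod (P, a)]; exact Code.size_cons _ _
  have hr : ∀ (r a b : List Bool), encSize (Assertion.role r a b) =
      3 + (encSize r + (encSize a + encSize b + 1) + 1) + 1 := fun r a b => by
    rw [← encSize_prod (a, b), ← encSize_prod (r, a, b)]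
    exact Code.size_cons _ _
  change encSize st.name₀ + _ ≤ _ at h1
  change encSize st.name₁ + _ ≤ _ at h2
  change encSize st.name₂ + _ ≤ _ at h3
  change encSize st.cur₀ + _ ≤ _ at h4
  have h10 := encSize_prod st.cur₀
  simp only [encSize_prod, encSize_nil] at h1 h2 h3 h4
  rw [encSize_eq, encSize_eq st]
  cases s with
  | bit b =>
    simp only [step, stepBit, encSize_cons]
    have := h0 b
    have := h0 (st.ok && !decide (st.names = []))
    omega
  | delim =>
    simp only [step, stepDelim, encSize_cons, encSize_nil]
    omega
  | conc =>
    simp only [step, stepConc, encSize_cons, encSize_nil, hc, encSize_prod] at *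
    have := h0 (st.ok && (decide (st.names = [st.name₀, st.name₁]) && decide (st.cur = [st.cur₀])))
    omega
  | role =>
    simp only [step, stepRole, encSize_cons, encSize_nil, hr, encSize_prod] at *
    have := h0 (st.ok && (decide (st.names = [st.name₀, st.name₁, st.name₂]) &&
      decide (st.cur = [st.cur₀])))
    omega
  | query =>
    simp only [step, stepQuery, encSize_cons, encSize_nil, encSize_prod] at *
    have := h0 (st.ok && (decide (st.names = [st.name₀, st.name₁]) && decide (st.cur = [])))
    omega
  | pos =>
    simp only [step, stepPos, encSize_cons, encSize_nil, encSize_prod] at *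
    have := h0 (st.ok && (decide (st.names = []) && decide (st.cur = [st.cur₀])))
    omega
  | neg =>
    simp only [step, stepNeg, encSize_cons, encSize_nil, encSize_prod] at *
    have := h0 (st.ok && (decide (st.names = []) && (decide (st.cur = [st.cur₀]) &&
      decide (st.pos = []))))
    omega

theorem polyFn_complete : PolyFn complete :=
  polyFn_ok.and ((polyFn_names.eq (const [])).and (polyFn_cur.eq (const [])))

end ParseState

theorem polyFn_parse_reverse : PolyFn fun w : List Symbol => parse w.reverse := by
  refine (foldl_of_add (l := fun w : List Symbol => w)
    (init := fun _ => (⟨true, [], [], [], []⟩ : ParseState)) (f := fun x => x.1.1.step x.1.2)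
    .id (const _) (ParseState.polyFn_step.comp PolyFn.id.fst) 100 fun s y x => ?_).of_eq fun w => ?_
  · have := ParseState.encSize_step_le s y
    simpa using this
  · rw [parse, List.foldr_reverse]

end

end OntologyFitting

namespace OntologyFitting

/-! ### Encodings of collections -/

/-- The raw example `r` writes the example `e`. -/
def Represents (r : RawExample) (e : Example) : Prop :=
  r.1.toFinset = e.abox ∧ r.2 = (e.concept, e.individual)

/-- The list `rs` writes the examples in `F`. -/
def RepresentsAll (rs : List RawExample) (F : Finset Example) : Prop :=
  (∀ r ∈ rs, ∃ e ∈ F, Represents r e) ∧ ∀ e ∈ F, ∃ r ∈ rs, Represents r e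

theorem Represents.unique {r : RawExample} {e e' : Example} (h : Represents r e)
    (h' : Represents r e') : e = e' := by
  obtain ⟨A, Q, a, _, _⟩ := e
  obtain ⟨A', Q', a', _, _⟩ := e'
  have h1 : A = A' := h.1.symm.trans h'.1
  have h2 : (Q, a) = (Q', a') := h.2.symm.trans h'.2
  cases h1
  cases h2
  rfl

theorem encodesExample_iff {s : Symbol} {e : Example} {w : List Symbol} :
    EncodesExample s e w ↔ ∃ r, Represents r e ∧ w = writeExample s r := by
  constructor
  · rintro ⟨l, hl, rfl⟩
    refine ⟨(l, e.concept, e.individual), ⟨?_, rfl⟩, rfl⟩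
    ext α
    rw [List.mem_toFinset, hl]
  · rintro ⟨⟨l, x⟩, ⟨hl, hx⟩, rfl⟩
    refine ⟨l, fun α => ?_, ?_⟩
    · rw [← hl, List.mem_toFinset]
    · simp only at hx
      rw [hx]
      rfl

/-- Replaces examples, which carry proofs and unordered ABoxes, by the raw data on which the
algorithm works. -/
theorem encodesExamples_iff {s : Symbol} {F : Finset Example} {w : List Symbol} :
    EncodesExamples s F w ↔ ∃ rs : List RawExample,
      RepresentsAll rs F ∧ w = rs.flatMap (writeExample s) := by
  constructor
  · rintro ⟨l, hl, hw, rfl⟩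
    have key : ∀ l : List (Example × List Symbol), (∀ p ∈ l, EncodesExample s p.1 p.2) →
        ∃ rs : List RawExample, (∀ r ∈ rs, ∃ e ∈ l.map Prod.fst, Represents r e) ∧
          (∀ e ∈ l.map Prod.fst, ∃ r ∈ rs, Represents r e) ∧
          l.flatMap Prod.snd = rs.flatMap (writeExample s) := by
      intro l
      induction l with
      | nil => exact fun _ => ⟨[], by simp, by simp, rfl⟩
      | cons p l ih =>
        intro h
        obtain ⟨rs, h1, h2, h3⟩ := ih fun q hq => h q (List.mem_cons_of_mem _ hq)
        obtain ⟨r, hr, hpr⟩ := encodesExample_iff.1 (h p List.mem_cons_self)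
        refine ⟨r :: rs, ?_, ?_, ?_⟩
        · rintro r' (_ | ⟨_, hr'⟩)
          · exact ⟨p.1, by simp, hr⟩
          · obtain ⟨e, he, hre⟩ := h1 r' hr'
            exact ⟨e, List.mem_cons_of_mem _ he, hre⟩
        · intro e he
          rw [List.map_cons, List.mem_cons] at he
          rcases he with rfl | he
          · exact ⟨r, List.mem_cons_self, hr⟩
          · obtain ⟨r', hr', hre⟩ := h2 e he
            exact ⟨r', List.mem_cons_of_mem _ hr', hre⟩
        · rw [List.flatMap_cons, List.flatMap_cons, h3, hpr]
    obtain ⟨rs, h1, h2, h3⟩ := key l hw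
    refine ⟨rs, ⟨fun r hr => ?_, fun e he => h2 e ((hl e).2 he)⟩, h3⟩
    obtain ⟨e, he, hre⟩ := h1 r hr
    exact ⟨e, (hl e).1 he, hre⟩
  · rintro ⟨rs, ⟨h1, h2⟩, rfl⟩
    choose f hf using h1
    refine ⟨rs.attach.map fun r => (f r.1 r.2, writeExample s r.1), fun e => ?_, ?_, ?_⟩
    · rw [List.map_map]
      simp only [List.mem_map, Function.comp_apply]
      constructor
      · rintro ⟨r, -, rfl⟩
        exact (hf r.1 r.2).1
      · intro he
        obtain ⟨r, hr, hre⟩ := h2 e he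
        exact ⟨⟨r, hr⟩, List.mem_attach _ _, (hf r hr).2.unique hre⟩
    · intro p hp
      obtain ⟨r, -, rfl⟩ := List.mem_map.1 hp
      exact encodesExample_iff.2 ⟨r.1, (hf r.1 r.2).2, rfl⟩
    · rw [List.flatMap_map]
      conv_lhs => rw [← List.attach_map_subtype_val rs, List.flatMap_map]

/-! ### The algorithm -/

/-- The individuals in a list of assertions. -/
def individuals {N : Type} (A : List (Assertion N)) : List N := A.flatMap Assertion.inds

theorem mem_individuals {N : Type} [DecidableEq N] {A : List (Assertion N)} {a : N} :
    a ∈ individuals A ↔ a ∈ ABox.ind A.toFinset := by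
  simp [individuals, ABox.ind]

/-- The queried individual of the raw example occurs in its assertions. -/
def RawExample.valid (r : RawExample) : Bool := decide (r.2.2 ∈ individuals r.1)

/-- Membership of the queried individual is the only test required, as it implies that the ABox is
nonempty. -/
theorem exists_representsAll_iff {rs : List RawExample} :
    (∃ F, RepresentsAll rs F) ↔ ∀ r ∈ rs, RawExample.valid r = true := by
  constructor
  · rintro ⟨F, h, -⟩ r hr
    obtain ⟨e, -, h1, h2⟩ := h r hr
    rw [RawExample.valid, decide_eq_true_iff, mem_individuals, h1, h2]
    exact e.individual_mem
  · intro h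
    have hex : ∀ r ∈ rs, ∃ e, Represents r e := by
      intro r hr
      have hm := mem_individuals.1 (of_decide_eq_true (h r hr))
      obtain ⟨α, hα, -⟩ := id hm
      exact ⟨⟨r.1.toFinset, r.2.1, r.2.2, ⟨α, hα⟩, hm⟩, rfl, rfl⟩
    choose f hf using hex
    refine ⟨(rs.attach.map fun r => f r.1 r.2).toFinset, fun r hr => ⟨f r hr, ?_, hf r hr⟩, ?_⟩
    · exact List.mem_toFinset.2 (List.mem_map_of_mem (List.mem_attach _ ⟨r, hr⟩))
    · intro e he
      obtain ⟨r, -, rfl⟩ := List.mem_map.1 (List.mem_toFinset.1 he)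
      exact ⟨r.1, r.2, hf r.1 r.2⟩

section Algorithm

variable {M : Type}

theorem right_mem_individuals {C : List (Assertion M)} {r : RoleName} {b c : M}
    (h : Assertion.role r b c ∈ C) : c ∈ individuals C :=
  List.mem_flatMap.2 ⟨_, h, by simp [Assertion.inds]⟩

theorem left_mem_individuals {C : List (Assertion M)} {r : RoleName} {b c : M}
    (h : Assertion.role r b c ∈ C) : b ∈ individuals C :=
  List.mem_flatMap.2 ⟨_, h, by simp [Assertion.inds]⟩

/-- All pairs of individuals. -/
def allPairs (A : List (Assertion IndName)) (C : List (Assertion M)) : List (IndName × M) :=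
  (individuals A).flatMap fun a => (individuals C).map fun b => (a, b)

theorem mem_allPairs {A : List (Assertion IndName)} {C : List (Assertion M)} {a : IndName} {b : M} :
    (a, b) ∈ allPairs A C ↔ a ∈ individuals A ∧ b ∈ individuals C := by
  simp [allPairs]

variable [DecidableEq M]

/-- The pair `p` violates a condition on simulations from `A` to `C` if the pairs in `s` are known
not to be in any simulation. -/
def violates (hi : Bool) (A : List (Assertion IndName)) (C : List (Assertion M))
    (s : List (IndName × M)) (p : IndName × M) : Bool :=
  A.any fun
    | .conc P d => decide (d = p.1) && !decide (Assertion.conc P p.2 ∈ C)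
    | .role r d e =>
      (decide (d = p.1) && !(individuals C).any fun e' =>
        decide (Assertion.role r p.2 e' ∈ C) && !decide ((e, e') ∈ s)) ||
      (hi && (decide (e = p.1) && !(individuals C).any fun d' =>
        decide (Assertion.role r d' p.2 ∈ C) && !decide ((d, d') ∈ s)))

/-- The searches may be restricted to `individuals C`, since every role partner occurs there. -/
theorem violates_iff {hi : Bool} {A : List (Assertion IndName)} {C : List (Assertion M)}
    {s : List (IndName × M)} {a : IndName} {b : M} :
    violates hi A C s (a, b) = true ↔
      (∃ P, Assertion.conc P a ∈ A ∧ Assertion.conc P b ∉ C) ∨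
      (∃ r e, Assertion.role r a e ∈ A ∧ ∀ e', Assertion.role r b e' ∈ C → (e, e') ∈ s) ∨
      (hi = true ∧
        ∃ r d, Assertion.role r d a ∈ A ∧ ∀ d', Assertion.role r d' b ∈ C → (d, d') ∈ s) := by
  have h1 : ∀ r e, ((!(individuals C).any fun e' =>
      decide (Assertion.role r b e' ∈ C) && !decide ((e, e') ∈ s)) = true) ↔
      ∀ e', Assertion.role r b e' ∈ C → (e, e') ∈ s := by
    intro r e
    simp only [Bool.not_eq_true', List.any_eq_false, Bool.and_eq_true, decide_eq_true_eq,
      Bool.not_eq_true', decide_eq_false_iff_not, not_and, not_not]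
    exact ⟨fun h e' he' => h e' (right_mem_individuals he') he', fun h e' _ => h e'⟩
  have h2 : ∀ r d, ((!(individuals C).any fun d' =>
      decide (Assertion.role r d' b ∈ C) && !decide ((d, d') ∈ s)) = true) ↔
      ∀ d', Assertion.role r d' b ∈ C → (d, d') ∈ s := by
    intro r d
    simp only [Bool.not_eq_true', List.any_eq_false, Bool.and_eq_true, decide_eq_true_eq,
      Bool.not_eq_true', decide_eq_false_iff_not, not_and, not_not]
    exact ⟨fun h e' he' => h e' (left_mem_individuals he') he', fun h e' _ => h e'⟩
  rw [violates, List.any_eq_true]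
  constructor
  · rintro ⟨P | ⟨r, d, e⟩, hα, h⟩
    · simp only [Bool.and_eq_true, decide_eq_true_eq, Bool.not_eq_true',
        decide_eq_false_iff_not] at h
      obtain ⟨rfl, h⟩ := h
      exact Or.inl ⟨_, hα, h⟩
    · rw [Bool.or_eq_true, Bool.and_eq_true, h1, Bool.and_eq_true, Bool.and_eq_true, h2,
        decide_eq_true_iff, decide_eq_true_iff] at h
      rcases h with ⟨rfl, h⟩ | ⟨hi, rfl, h⟩
      · exact Or.inr (Or.inl ⟨_, _, hα, h⟩)
      · exact Or.inr (Or.inr ⟨hi, _, _, hα, h⟩)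
  · rintro (⟨P, hα, h⟩ | ⟨r, e, hα, h⟩ | ⟨h0, r, d, hα, h⟩)
    · exact ⟨_, hα, by simpa using h⟩
    · refine ⟨_, hα, ?_⟩
      simp only
      rw [Bool.or_eq_true, Bool.and_eq_true, h1]
      exact Or.inl ⟨by simp, h⟩
    · refine ⟨_, hα, ?_⟩
      simp only
      rw [Bool.or_eq_true, Bool.and_eq_true hi]
      refine Or.inr ⟨h0, ?_⟩
      rw [Bool.and_eq_true, h2]
      exact ⟨by simp, h⟩

variable [Enc M]

/-- The pairs that violate the local conditions on simulations, inductively. -/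
def nonSim (hi : Bool) (A : List (Assertion IndName)) (C : List (Assertion M)) :
    List (IndName × M) :=
  lfp (encSize (allPairs A C)) (allPairs A C) (violates hi A C)

/-- There are at least as many stages as candidate pairs, so `nonSim` is a fixed point and its
complement obeys the local conditions on simulations. -/
theorem mem_nonSim {hi : Bool} {A : List (Assertion IndName)} {C : List (Assertion M)}
    {p : IndName × M} :
    p ∈ nonSim hi A C ↔ p ∈ allPairs A C ∧ violates hi A C (nonSim hi A C) p = true := by
  have h : (allPairs A C).filter (violates hi A C (nonSim hi A C)) = nonSim hi A C := by
    refine lfp_stable ?_ (length_le_encSize _)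
    rintro s s' hs ⟨a, b⟩ - h
    rw [violates_iff] at h ⊢
    rcases h with h | ⟨r, e, h1, h2⟩ | ⟨h0, r, e, h1, h2⟩
    · exact Or.inl h
    · exact Or.inr (Or.inl ⟨r, e, h1, fun e' he' => hs (h2 e' he')⟩)
    · exact Or.inr (Or.inr ⟨h0, r, e, h1, fun e' he' => hs (h2 e' he')⟩)
  rw [← List.mem_filter, h]

/-- Some simulation from `A` to `C` contains the pair `(a, b)`. -/
def simulates (hi hb : Bool) (A : List (Assertion IndName)) (C : List (Assertion M)) (a : IndName)
    (b : M) : Bool :=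
  !decide ((a, b) ∈ nonSim hi A C) &&
    (!hb || (individuals A).all fun a => (individuals C).any fun b =>
      !decide ((a, b) ∈ nonSim hi A C))

theorem not_mem_nonSim_of_isSimulation {L : DL} {hi : Bool} (hhi : hi = true ↔ L.HasInv)
    {A : List (Assertion IndName)} {C : List (Assertion M)}
    {S : (ABox.toRelStr A.toFinset).Dom → (ABox.toRelStr C.toFinset).Dom → Prop}
    (hS : IsSimulation L (ABox.toRelStr A.toFinset) (ABox.toRelStr C.toFinset) S) {a b}
    (hab : S a b) : (a.1, b.1) ∉ nonSim hi A C := by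
  intro hmem
  have key := lfp_induction (cand := allPairs A C) (φ := violates hi A C)
    (Y := fun p => ∀ a b, S a b → (a.1, b.1) ≠ p) ?_ (encSize (allPairs A C)) _ hmem
  · exact key a b hab rfl
  rintro s hs p - hp a b hab rfl
  rcases violates_iff.1 hp with ⟨P, h1, h2⟩ | ⟨r, e, h1, h2⟩ | ⟨h0, r, d, h1, h2⟩
  · exact h2 (List.mem_toFinset.1 (hS.atom P a b (List.mem_toFinset.2 h1) hab))
  · obtain ⟨e', hr, he⟩ := hS.rel r a ⟨e, mem_individuals.1 (right_mem_individuals h1)⟩ b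
      (List.mem_toFinset.2 h1) hab
    exact hs _ (h2 e'.1 (List.mem_toFinset.1 hr)) _ _ he rfl
  · obtain ⟨e', hr, he⟩ := hS.irel (hhi.1 h0) r a ⟨d, mem_individuals.1 (left_mem_individuals h1)⟩ b
      (List.mem_toFinset.2 h1) hab
    exact hs _ (h2 e'.1 (List.mem_toFinset.1 hr)) _ _ he rfl

/-- The complement of `nonSim` is the largest relation with the local properties. Totality is
inherited by larger relations, so it suffices to test it there. -/
theorem simulates_iff {L : DL} {hi hb : Bool} (hhi : hi = true ↔ L.HasInv)
    (hhb : hb = true ↔ L.HasBot) {A : List (Assertion IndName)} {C : List (Assertion M)}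
    (a : (ABox.toRelStr A.toFinset).Dom) (b : (ABox.toRelStr C.toFinset).Dom) :
    simulates hi hb A C a.1 b.1 = true ↔
      ∃ S, IsSimulation L (ABox.toRelStr A.toFinset) (ABox.toRelStr C.toFinset) S ∧ S a b := by
  have hmem : ∀ (a : (ABox.toRelStr A.toFinset).Dom) (b : (ABox.toRelStr C.toFinset).Dom),
      (a.1, b.1) ∈ allPairs A C := fun a b =>
    mem_allPairs.2 ⟨mem_individuals.2 a.2, mem_individuals.2 b.2⟩
  simp only [simulates, Bool.and_eq_true, Bool.not_eq_true', decide_eq_false_iff_not,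
    Bool.or_eq_true, List.all_eq_true, List.any_eq_true]
  constructor
  · rintro ⟨hab, htot⟩
    refine ⟨fun a b => (a.1, b.1) ∉ nonSim hi A C, ⟨?_, ?_, ?_, ?_⟩, hab⟩
    · intro P d d' hd hdd'
      by_contra hcon
      exact hdd' (mem_nonSim.2 ⟨hmem d d', violates_iff.2 (Or.inl
        ⟨P, List.mem_toFinset.1 hd, fun h => hcon (List.mem_toFinset.2 h)⟩)⟩)
    · intro r d e d' hd hdd'
      by_contra! hcon
      refine hdd' (mem_nonSim.2 ⟨hmem d d', violates_iff.2 (Or.inr (Or.inl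
        ⟨r, e.1, List.mem_toFinset.1 hd, fun e' he' => ?_⟩))⟩)
      exact hcon ⟨e', mem_individuals.1 (right_mem_individuals he')⟩ (List.mem_toFinset.2 he')
    · intro hinv r d e d' hd hdd'
      by_contra! hcon
      refine hdd' (mem_nonSim.2 ⟨hmem d d', violates_iff.2 (Or.inr (Or.inr
        ⟨hhi.2 hinv, r, e.1, List.mem_toFinset.1 hd, fun e' he' => ?_⟩))⟩)
      exact hcon ⟨e', mem_individuals.1 (left_mem_individuals he')⟩ (List.mem_toFinset.2 he')
    · intro hbot d
      rcases htot with htot | htot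
      · rw [hhb.2 hbot] at htot
        cases htot
      · obtain ⟨d', hd', h⟩ := htot d.1 (mem_individuals.2 d.2)
        exact ⟨⟨d', mem_individuals.1 hd'⟩, h⟩
  · rintro ⟨S, hS, hab⟩
    refine ⟨not_mem_nonSim_of_isSimulation hhi hS hab, ?_⟩
    cases hb with
    | false => exact Or.inl rfl
    | true =>
      refine Or.inr fun d hd => ?_
      obtain ⟨d', hd'⟩ := hS.tot (hhb.1 rfl) ⟨d, mem_individuals.1 hd⟩
      exact ⟨d'.1, mem_individuals.2 d'.2, not_mem_nonSim_of_isSimulation hhi hS hd'⟩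

end Algorithm

instance : DecidableEq RawExample := inferInstance

/-- The disjoint union of the assertions of the negative examples. -/
def rawUnion (neg : List RawExample) : List (Assertion (RawExample × IndName)) :=
  neg.flatMap fun e => e.1.map fun α => α.map fun a => (e, a)

/-- Add the queries in `s` to `C`. -/
def addQueries (C : List (Assertion (RawExample × IndName)))
    (s : List (RawExample × RawExample × IndName)) : List (Assertion (RawExample × IndName)) :=
  C ++ s.map fun q => .conc q.1.2.1 q.2

/-- The queries that the rule (R) may add. -/
def candidates (pos neg : List RawExample) : List (RawExample × RawExample × IndName) :=
  pos.flatMap fun p => (individuals (rawUnion neg)).map fun b => (p, b)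

/-- The rule (R) adds `q` to the queries in `s`. -/
def ruleAdds (hi hb : Bool) (neg : List RawExample) (s : List (RawExample × RawExample × IndName))
    (q : RawExample × RawExample × IndName) : Bool :=
  simulates hi hb q.1.1 (addQueries (rawUnion neg) s) q.1.2.2 q.2

/-- The exhaustive application of the rule (R). -/
def saturate (hi hb : Bool) (pos neg : List RawExample) : List (Assertion (RawExample × IndName)) :=
  addQueries (rawUnion neg)
    (lfp (encSize (candidates pos neg)) (candidates pos neg) (ruleAdds hi hb neg))

/-- The saturation contains no negative query. -/
def accepts (hi hb : Bool) (pos neg : List RawExample) : Bool :=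
  !neg.any fun e => decide ((Assertion.conc e.2.1 (e, e.2.2) :
    Assertion (RawExample × IndName)) ∈ saturate hi hb pos neg)

end OntologyFitting

namespace OntologyFitting

/-! ### Correctness of the algorithm -/

/-- The rule (R) for the positive example `e` yields the query for `c` in `C`. -/
def Yields {N : Type} (L : DL) (e : Example) (C : ABox N) (c : N) : Prop :=
  ∃ S, IsSimulation L e.abox.toRelStr C.toRelStr S ∧
    ∃ b, S ⟨e.individual, e.individual_mem⟩ b ∧ b.1 = c

theorem Yields.mono {N : Type} {L : DL} {e : Example} {C C' : ABox N} {c : N}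
    (h : Yields L e C c) (hC : C ⊆ C') : Yields L e C' c := by
  obtain ⟨S, hS, b, hb, rfl⟩ := h
  exact ⟨_, hS.comp_hom (ABox.isHom_incl hC), ABox.incl hC b, ⟨b, hb, rfl⟩, rfl⟩

theorem closed_iff {N : Type} {L : DL} {pos : Finset Example} {C : ABox N} :
    Closed L pos C ↔ ∀ e ∈ pos, ∀ c, Yields L e C c → Assertion.conc e.concept c ∈ C := by
  constructor
  · rintro h e he _ ⟨S, hS, b, hb, rfl⟩
    exact h e he S hS b hb
  · exact fun h e he S hS b hb => h e he _ ⟨S, hS, b, hb, rfl⟩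

theorem yields_iff {M : Type} [DecidableEq M] [Enc M] {L : DL} {hi hb : Bool}
    (hhi : hi = true ↔ L.HasInv) (hhb : hb = true ↔ L.HasBot) {r : RawExample} {e : Example}
    (hr : Represents r e) {C : List (Assertion M)} {c : M} (hc : c ∈ individuals C) :
    simulates hi hb r.1 C r.2.2 c = true ↔ Yields L e C.toFinset c := by
  obtain ⟨A, Q, a, hA, ha⟩ := e
  obtain ⟨l, Q', a'⟩ := r
  obtain ⟨h1, h2⟩ := hr
  obtain ⟨rfl, rfl⟩ := Prod.mk.inj h2
  subst h1
  refine (simulates_iff hhi hhb ⟨_, ha⟩ ⟨c, mem_individuals.1 hc⟩).trans ⟨?_, ?_⟩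
  · rintro ⟨S, hS, h⟩
    exact ⟨S, hS, _, h, rfl⟩
  · rintro ⟨S, hS, b, h, rfl⟩
    exact ⟨S, hS, h⟩

theorem mem_addQueries {C : List (Assertion (RawExample × IndName))}
    {s : List (RawExample × RawExample × IndName)} {α : Assertion (RawExample × IndName)} :
    α ∈ addQueries C s ↔ α ∈ C ∨ ∃ q ∈ s, α = .conc q.1.2.1 q.2 := by
  simp [addQueries, eq_comm]

theorem addQueries_subset {C : List (Assertion (RawExample × IndName))}
    {s s' : List (RawExample × RawExample × IndName)} (h : s ⊆ s') :
    (addQueries C s).toFinset ⊆ (addQueries C s').toFinset := by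
  intro α
  rw [List.mem_toFinset, List.mem_toFinset, mem_addQueries, mem_addQueries]
  rintro (hα | ⟨q, hq, hα⟩)
  · exact Or.inl hα
  · exact Or.inr ⟨q, h hq, hα⟩

theorem mem_individuals_addQueries {C : List (Assertion (RawExample × IndName))}
    {s : List (RawExample × RawExample × IndName)} {c : RawExample × IndName} :
    c ∈ individuals (addQueries C s) ↔ c ∈ individuals C ∨ ∃ q ∈ s, q.2 = c := by
  rw [individuals, addQueries, List.flatMap_append, List.mem_append, List.flatMap_map]
  simp only [Assertion.inds, List.mem_flatMap (l := s), List.mem_singleton, eq_comm (a := c)]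
  rfl

theorem mem_candidates {pos neg : List RawExample} {q : RawExample × RawExample × IndName} :
    q ∈ candidates pos neg ↔ q.1 ∈ pos ∧ q.2 ∈ individuals (rawUnion neg) := by
  simp only [candidates, List.mem_flatMap, List.mem_map]
  constructor
  · rintro ⟨p, hp, b, hb, rfl⟩
    exact ⟨hp, hb⟩
  · exact fun h => ⟨_, h.1, _, h.2, rfl⟩

theorem toFinset_rawUnion (neg : List RawExample) :
    (rawUnion neg).toFinset = tagged neg.toFinset fun t => t.1.toFinset := by
  ext α
  rw [mem_tagged]
  simp [rawUnion]

section Correctness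

variable {L : DL} {hi hb : Bool} (hhi : hi = true ↔ L.HasInv) (hhb : hb = true ↔ L.HasBot)
  {pos neg : List RawExample} {F : Finset Example} (hpos : RepresentsAll pos F)
include hhi hhb

theorem ruleAdds_iff {s : List (RawExample × RawExample × IndName)}
    {q : RawExample × RawExample × IndName} {e : Example} (he : Represents q.1 e)
    (hq : q ∈ candidates pos neg) :
    ruleAdds hi hb neg s q = true ↔ Yields L e (addQueries (rawUnion neg) s).toFinset q.2 :=
  yields_iff hhi hhb he (mem_individuals_addQueries.2 (Or.inl (mem_candidates.1 hq).2))

include hpos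

/-- The added queries form a fixed point of one simultaneous round of (R), so another application
finds every query it yields already present. -/
theorem saturate_closed : Closed L F (saturate hi hb pos neg).toFinset := by
  rw [closed_iff]
  intro e he c hc
  obtain ⟨r, hr, hre⟩ := hpos.2 e he
  have hstable : (candidates pos neg).filter (ruleAdds hi hb neg
      (lfp (encSize (candidates pos neg)) (candidates pos neg) (ruleAdds hi hb neg))) =
      lfp (encSize (candidates pos neg)) (candidates pos neg) (ruleAdds hi hb neg) := by
    refine lfp_stable (fun s s' hs q hq h => ?_) (length_le_encSize _)
    -- Only the first component of a candidate is known to represent an example, so `Yields.mono` is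
    -- available at candidates only.
    obtain ⟨e, -, he⟩ := hpos.1 q.1 (mem_candidates.1 hq).1
    rw [ruleAdds_iff hhi hhb he hq] at h ⊢
    exact h.mono (addQueries_subset hs)
  -- Added queries concern old individuals, so the list of candidates is never outgrown.
  have hcU : c ∈ individuals (rawUnion neg) := by
    obtain ⟨S, -, b, -, rfl⟩ := id hc
    rcases mem_individuals_addQueries.1 (mem_individuals.2 b.2) with h | ⟨q, hq, h⟩
    · exact h
    · rw [← hstable] at hq
      rw [← h]
      exact (mem_candidates.1 (List.mem_filter.1 hq).1).2
  have hcand : (r, c) ∈ candidates pos neg := mem_candidates.2 ⟨hr, hcU⟩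
  rw [List.mem_toFinset, saturate, mem_addQueries]
  refine Or.inr ⟨(r, c), ?_, ?_⟩
  · rw [← hstable]
    exact List.mem_filter.2 ⟨hcand, (ruleAdds_iff hhi hhb hre hcand).2 hc⟩
  · rw [hre.2]

theorem saturate_subset {C : ABox (RawExample × IndName)} (h0 : (rawUnion neg).toFinset ⊆ C)
    (hC : Closed L F C) : (saturate hi hb pos neg).toFinset ⊆ C := by
  intro α hα
  rw [List.mem_toFinset, saturate, mem_addQueries] at hα
  rcases hα with hα | ⟨q, hq, rfl⟩
  · exact h0 (List.mem_toFinset.2 hα)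
  · refine lfp_induction (cand := candidates pos neg) (φ := ruleAdds hi hb neg)
      (Y := fun q => Assertion.conc q.1.2.1 q.2 ∈ C) (fun s hs q hq h => ?_) _ _ hq
    obtain ⟨e, heF, he⟩ := hpos.1 q.1 (mem_candidates.1 hq).1
    rw [ruleAdds_iff hhi hhb he hq] at h
    rw [he.2]
    refine closed_iff.1 hC e heF _ (h.mono fun α hα => ?_)
    rw [List.mem_toFinset, mem_addQueries] at hα
    rcases hα with hα | ⟨q, hq, rfl⟩
    · exact h0 (List.mem_toFinset.2 hα)
    · exact hs q hq

/-- `exists_fitting_iff` applies with raw examples as tags. Several raw examples may represent one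
example, which only duplicates components and queries. -/
theorem hasFitting_iff_accepts {G : Finset Example} (hneg : RepresentsAll neg G) :
    HasFitting L ⟨F, G⟩ ↔ accepts hi hb pos neg = true := by
  have h := exists_fitting_iff (L := L) (pos := F) (neg := neg.toFinset)
    (abox := fun t => t.1.toFinset) (Q := fun t => t.2.1) (a := fun t => t.2.2)
    (C := (saturate hi hb pos neg).toFinset) (fun t ht => ?_) ?_ (saturate_closed hhi hhb hpos)
    fun C' _ h0 hC' => saturate_subset hhi hhb hpos ((toFinset_rawUnion neg).le.trans h0) hC'
  · have h1 : accepts hi hb pos neg = true ↔ ∀ t ∈ neg.toFinset,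
        Assertion.conc t.2.1 (t, t.2.2) ∉ (saturate hi hb pos neg).toFinset := by
      simp [accepts]
    rw [h1, ← h]
    refine exists_congr fun O => and_congr_right fun _ => and_congr_right fun _ => ?_
    constructor
    · intro hO t ht
      obtain ⟨e, heG, h1, h2⟩ := hneg.1 t (List.mem_toFinset.1 ht)
      rw [h1, h2]
      exact hO e heG
    · intro hO e heG
      obtain ⟨t, ht, h1, h2⟩ := hneg.2 e heG
      have := hO t (List.mem_toFinset.2 ht)
      rwa [h1, h2] at this
  · obtain ⟨e, -, h1, h2⟩ := hneg.1 t (List.mem_toFinset.1 ht)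
    rw [h1, h2]
    exact e.individual_mem
  · rw [← toFinset_rawUnion]
    intro α hα
    rw [List.mem_toFinset, saturate, mem_addQueries]
    exact Or.inl (List.mem_toFinset.1 hα)

end Correctness

/-- The final test of the algorithm. -/
def ParseState.check (hi hb : Bool) (st : ParseState) : Bool :=
  st.complete && (st.pos.all RawExample.valid && st.neg.all RawExample.valid &&
    accepts hi hb st.pos st.neg)

theorem mem_fittingProblem_iff {L : DL} {hi hb : Bool} (hhi : hi = true ↔ L.HasInv)
    (hhb : hb = true ↔ L.HasBot) (w : List Symbol) :
    (parse w).check hi hb = true ↔ w ∈ fittingProblem L := by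
  simp only [ParseState.check, Bool.and_eq_true, List.all_eq_true]
  constructor
  · rintro ⟨hw, ⟨hp, hn⟩, hacc⟩
    obtain ⟨F, hF⟩ := exists_representsAll_iff.2 hp
    obtain ⟨G, hG⟩ := exists_representsAll_iff.2 hn
    exact ⟨⟨F, G⟩, ⟨_, _, encodesExamples_iff.2 ⟨_, hF, rfl⟩, encodesExamples_iff.2 ⟨_, hG, rfl⟩,
      eq_write_of_complete hw⟩, (hasFitting_iff_accepts hhi hhb hF hG).2 hacc⟩
  · rintro ⟨⟨F, G⟩, ⟨u, v, hu, hv, rfl⟩, hfit⟩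
    obtain ⟨rs, hF, rfl⟩ := encodesExamples_iff.1 hu
    obtain ⟨rs', hG, rfl⟩ := encodesExamples_iff.1 hv
    have h := parse_writeCollection (rs, rs')
    rw [writeCollection] at h
    rw [h]
    exact ⟨rfl, ⟨exists_representsAll_iff.1 ⟨F, hF⟩, exists_representsAll_iff.1 ⟨G, hG⟩⟩,
      (hasFitting_iff_accepts hhi hhb hF hG).1 hfit⟩

end OntologyFitting

namespace OntologyFitting

/-! ### Running time of the algorithm -/

namespace PolyFn

section

variable {α β : Type} [Enc α] [Enc β]

/-- Here and below arguments are functions of a common parameter, so that the results can be used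
inside `map`, `any` and `lfp`, where the parameter is carried along in a pair. -/
theorem individuals {A : α → List (Assertion β)} (hA : PolyFn A) :
    PolyFn fun x => individuals (A x) :=
  (flatMap (f := fun y => y.1.inds) hA ((assertionCases (f := fun y => [y.1.2])
    (g := fun y => [y.1.2.1, y.1.2.2]) PolyFn.id.fst (id.fst.snd.cons (const []))
    (id.fst.snd.fst.cons (id.fst.snd.snd.cons (const [])))).of_eq fun y => by
      cases h : y.1 <;> rfl)).of_eq fun _ => rfl

theorem allPairs {A : α → List (Assertion IndName)} {C : α → List (Assertion β)} (hA : PolyFn A)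
    (hC : PolyFn C) : PolyFn fun x => allPairs (A x) (C x) :=
  flatMap (f := fun y => (OntologyFitting.individuals (C y.2)).map fun b => (y.1, b)) hA.individuals
    (map (f := fun z => (z.2.1, z.1)) (hC.comp .prod_snd).individuals (id.snd.fst.pair id.fst))

variable [DecidableEq β]

theorem violates {hi : Bool} {A : α → List (Assertion IndName)} {C : α → List (Assertion β)}
    {s : α → List (IndName × β)} {p : α → IndName × β} (hA : PolyFn A) (hC : PolyFn C)
    (hs : PolyFn s) (hp : PolyFn p) : PolyFn fun x => violates hi (A x) (C x) (s x) (p x) := by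
  refine any (p := fun y => match y.1 with
    | .conc P d => decide (d = (p y.2).1) && !decide (Assertion.conc P (p y.2).2 ∈ C y.2)
    | .role r d e =>
      (decide (d = (p y.2).1) && !(OntologyFitting.individuals (C y.2)).any fun e' =>
        decide (Assertion.role r (p y.2).2 e' ∈ C y.2) && !decide ((e, e') ∈ s y.2)) ||
      (hi && (decide (e = (p y.2).1) && !(OntologyFitting.individuals (C y.2)).any fun d' =>
        decide (Assertion.role r d' (p y.2).2 ∈ C y.2) && !decide ((d, d') ∈ s y.2)))) hA ?_
  refine (assertionCases
    (f := fun z => decide (z.1.2 = (p z.2.2).1) &&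
      !decide (Assertion.conc z.1.1 (p z.2.2).2 ∈ C z.2.2))
    (g := fun z => (decide (z.1.2.1 = (p z.2.2).1) &&
        !(OntologyFitting.individuals (C z.2.2)).any fun e' =>
          decide (Assertion.role z.1.1 (p z.2.2).2 e' ∈ C z.2.2) &&
            !decide ((z.1.2.2, e') ∈ s z.2.2)) ||
      (hi && (decide (z.1.2.2 = (p z.2.2).1) &&
        !(OntologyFitting.individuals (C z.2.2)).any fun d' =>
          decide (Assertion.role z.1.1 d' (p z.2.2).2 ∈ C z.2.2) &&
            !decide ((z.1.2.1, d') ∈ s z.2.2)))) PolyFn.id.fst ?_ ?_).of_eq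
    fun y => by cases h : y.1 <;> rfl
  · have hx : PolyFn fun z : (ConceptName × IndName) × Assertion IndName × α => z.2.2 := id.snd.snd
    exact (id.fst.snd.eq (hp.comp hx).fst).and
      (((id.fst.fst).conc (hp.comp hx).snd).mem (hC.comp hx)).not
  · have hx : PolyFn fun z : (RoleName × IndName × IndName) × Assertion IndName × α => z.2.2 :=
      id.snd.snd
    have hy : PolyFn fun y : β × (RoleName × IndName × IndName) × Assertion IndName × α =>
      y.2.2.2 := id.snd.snd.snd
    have h1 : PolyFn fun y : β × (RoleName × IndName × IndName) × Assertion IndName × α =>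
        decide (Assertion.role y.2.1.1 (p y.2.2.2).2 y.1 ∈ C y.2.2.2) &&
          !decide ((y.2.1.2.2, y.1) ∈ s y.2.2.2) :=
      ((id.snd.fst.fst.role (hp.comp hy).snd id.fst).mem (hC.comp hy)).and
        ((id.snd.fst.snd.snd.pair id.fst).mem (hs.comp hy)).not
    have h2 : PolyFn fun y : β × (RoleName × IndName × IndName) × Assertion IndName × α =>
        decide (Assertion.role y.2.1.1 y.1 (p y.2.2.2).2 ∈ C y.2.2.2) &&
          !decide ((y.2.1.2.1, y.1) ∈ s y.2.2.2) :=
      ((id.snd.fst.fst.role id.fst (hp.comp hy).snd).mem (hC.comp hy)).and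
        ((id.snd.fst.snd.fst.pair id.fst).mem (hs.comp hy)).not
    exact ((id.fst.snd.fst.eq (hp.comp hx).fst).and (any (hC.comp hx).individuals h1).not).or
      ((const hi).and ((id.fst.snd.snd.eq (hp.comp hx).fst).and
        (any (hC.comp hx).individuals h2).not))

theorem nonSim {hi : Bool} {A : α → List (Assertion IndName)} {C : α → List (Assertion β)}
    (hA : PolyFn A) (hC : PolyFn C) : PolyFn fun x => nonSim hi (A x) (C x) :=
  PolyFn.lfp (φ := fun z => OntologyFitting.violates hi (A z.2) (C z.2) z.1.2 z.1.1)
    (hA.allPairs hC) (violates (hA.comp .prod_snd) (hC.comp .prod_snd) id.fst.snd id.fst.fst)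

theorem simulates {hi hb : Bool} {A : α → List (Assertion IndName)} {C : α → List (Assertion β)}
    {a : α → IndName} {b : α → β} (hA : PolyFn A) (hC : PolyFn C) (ha : PolyFn a) (hb' : PolyFn b) :
    PolyFn fun x => simulates hi hb (A x) (C x) (a x) (b x) := by
  have h1 : PolyFn fun z : β × IndName × α =>
      !decide ((z.2.1, z.1) ∈ OntologyFitting.nonSim hi (A z.2.2) (C z.2.2)) :=
    have hx : PolyFn fun z : β × IndName × α => z.2.2 := id.snd.snd
    have hp : PolyFn fun z : β × IndName × α => (z.2.1, z.1) := id.snd.fst.pair id.fst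
    have hn : PolyFn fun z : β × IndName × α =>
      OntologyFitting.nonSim hi (A z.2.2) (C z.2.2) := (hA.comp hx).nonSim (hC.comp hx)
    (hp.mem hn).not
  have h2 : PolyFn fun y : IndName × α => (OntologyFitting.individuals (C y.2)).any fun b =>
      !decide ((y.1, b) ∈ OntologyFitting.nonSim hi (A y.2) (C y.2)) :=
    any (hC.comp .prod_snd).individuals h1
  have h3 : PolyFn fun x => (OntologyFitting.individuals (A x)).all fun a =>
      (OntologyFitting.individuals (C x)).any fun b =>
        !decide ((a, b) ∈ OntologyFitting.nonSim hi (A x) (C x)) :=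
    all hA.individuals h2
  have h4 : PolyFn fun x => decide ((a x, b x) ∈ OntologyFitting.nonSim hi (A x) (C x)) :=
    (ha.pair hb').mem (hA.nonSim hC)
  exact h4.not.and ((const !hb).or h3)

end

section

variable {α : Type} [Enc α]

theorem rawUnion {neg : α → List RawExample} (hn : PolyFn neg) : PolyFn fun x => rawUnion (neg x) := by
  have h1 : PolyFn fun z : Assertion IndName × RawExample × α => z.1.map fun a => (z.2.1, a) := by
    have hc : PolyFn fun u : (ConceptName × IndName) × Assertion IndName × RawExample × α =>
        Assertion.conc u.1.1 (u.2.2.1, u.1.2) :=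
      id.fst.fst.conc (id.snd.snd.fst.pair id.fst.snd)
    have hr : PolyFn fun u : (RoleName × IndName × IndName) × Assertion IndName × RawExample × α =>
        Assertion.role u.1.1 (u.2.2.1, u.1.2.1) (u.2.2.1, u.1.2.2) :=
      id.fst.fst.role (id.snd.snd.fst.pair id.fst.snd.fst) (id.snd.snd.fst.pair id.fst.snd.snd)
    exact (assertionCases prod_fst hc hr).of_eq fun z => by cases h : z.1 <;> rfl
  have h2 : PolyFn fun y : RawExample × α => y.1.1.map fun α => α.map fun a => (y.1, a) :=
    map id.fst.fst h1
  exact flatMap hn h2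

theorem addQueries {C : α → List (Assertion (RawExample × IndName))}
    {s : α → List (RawExample × RawExample × IndName)} (hC : PolyFn C) (hs : PolyFn s) :
    PolyFn fun x => addQueries (C x) (s x) :=
  hC.append (map (f := fun q : (RawExample × RawExample × IndName) × α =>
    Assertion.conc q.1.1.2.1 q.1.2) hs (id.fst.fst.snd.fst.conc id.fst.snd))

theorem candidates {pos neg : α → List RawExample} (hp : PolyFn pos) (hn : PolyFn neg) :
    PolyFn fun x => candidates (pos x) (neg x) :=
  flatMap (f := fun p => (OntologyFitting.individuals (OntologyFitting.rawUnion (neg p.2))).map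
    fun b => (p.1, b)) hp (map (f := fun z => (z.2.1, z.1)) (hn.comp .prod_snd).rawUnion.individuals
      (id.snd.fst.pair id.fst))

theorem ruleAdds {hi hb : Bool} {neg : α → List RawExample}
    {s : α → List (RawExample × RawExample × IndName)} {q : α → RawExample × RawExample × IndName}
    (hn : PolyFn neg) (hs : PolyFn s) (hq : PolyFn q) :
    PolyFn fun x => ruleAdds hi hb (neg x) (s x) (q x) :=
  hq.fst.fst.simulates (hn.rawUnion.addQueries hs) hq.fst.snd.snd hq.snd

theorem saturate {hi hb : Bool} {pos neg : α → List RawExample} (hp : PolyFn pos)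
    (hn : PolyFn neg) : PolyFn fun x => saturate hi hb (pos x) (neg x) :=
  hn.rawUnion.addQueries (PolyFn.lfp
    (φ := fun z => OntologyFitting.ruleAdds hi hb (neg z.2) z.1.2 z.1.1) (hp.candidates hn)
    (ruleAdds (hn.comp .prod_snd) id.fst.snd id.fst.fst))

theorem accepts {hi hb : Bool} {pos neg : α → List RawExample} (hp : PolyFn pos)
    (hn : PolyFn neg) : PolyFn fun x => accepts hi hb (pos x) (neg x) := by
  have h : PolyFn fun y : RawExample × α =>
      decide ((Assertion.conc y.1.2.1 (y.1, y.1.2.2) : Assertion (RawExample × IndName)) ∈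
        OntologyFitting.saturate hi hb (pos y.2) (neg y.2)) :=
    (id.fst.snd.fst.conc (id.fst.pair id.fst.snd.snd)).mem
      ((hp.comp .prod_snd).saturate (hn.comp .prod_snd))
  exact (any hn h).not

theorem valid : PolyFn RawExample.valid :=
  ((id (α := RawExample)).snd.snd.mem (id (α := RawExample)).fst.individuals).of_eq
    fun _ => RawExample.valid.eq_1 _

theorem check (hi hb : Bool) : PolyFn (ParseState.check hi hb) :=
  ParseState.polyFn_complete.and
    (((all (p := fun y => RawExample.valid y.1) ParseState.polyFn_pos (valid.comp .prod_fst)).and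
      (all (p := fun y => RawExample.valid y.1) ParseState.polyFn_neg (valid.comp .prod_fst))).and
      (accepts ParseState.polyFn_pos ParseState.polyFn_neg))

end

end PolyFn

/-- The second part of the theorem: fitting is decidable in polynomial time. -/
theorem fittingProblem_inPTime (L : DL) : InPTime (fittingProblem L) := by
  classical
  refine PolyFn.inPTime
    ((PolyFn.check (decide L.HasInv) (decide L.HasBot)).comp polyFn_parse_reverse) fun w => ?_
  rw [List.reverse_reverse]
  exact mem_fittingProblem_iff decide_eq_true_iff decide_eq_true_iff w

end OntologyFitting

open OntologyFitting in
theorem mainTheorem11 (L : DL) :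
    (∀ E : Collection,
      ∃ C : ABox (Example × IndName),
        IsSaturation L E C ∧ (∀ C', IsSaturation L E C' → C' = C) ∧ IsCompletion E C ∧
        (¬ HasFitting L E ↔ ∃ e ∈ E.neg, Assertion.conc e.concept (e, e.individual) ∈ C)) ∧
    InPTime (fittingProblem L) :=
  ⟨saturation_spec L, fittingProblem_inPTime L⟩
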